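/- Let $\Gamma_\cdot\to\pi$ be a free simplicial resolution of a group $\pi$: $\Gamma_\cdot$ is a simplicial group, free in each degree on a graded set $\mathbb X_\cdot$ closed under degeneracies, with $\mathbb X_0,\mathbb X_1$ finite (so $\pi$ is finitely presented), with $\pi_0(\Gamma_\cdot)\cong\pi$ via the augmentation and $\pi_i(\Gamma_\cdot)=0$ for $i\ge 1$. Let $n\ge 1$, let $x\in H_n(B\pi;\mathbb C)$ be an integral class, and let $\tilde x\in\Gamma_{n-1}$ be a lift of $x$: the class of $\tilde x$ in $D_n:=H_1(B\Gamma_{n-1};\mathbb Z)$ is a cycle of the complex $D_*=H_1(B\Gamma_{*-1};\mathbb Z)$ (differential: alternating sum of the faces), and it represents, through $H_n(D_*)\cong H_n(B\Gamma_\cdot;\mathbb Z)\to H_n(B\Gamma_\cdot;\mathbb C)\cong H_n(B\pi;\mathbb C)$, the class $x$. If $n\ge 3$, let $W\subseteq\mathbb X_{n-2}$ be a finite set such that $\prod_{0\le i\le n-1}\partial_i(\tilde x)^{(-1)^i}$ is a product of commutators of elements of the subgroup generated by $W$. Let $\mathbb X'_\cdot\subseteq\mathbb X_\cdot$ be the smallest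 graded subset which contains $\mathbb X_0$ and $\mathbb X_1$ and, if $n\ge 3$, contains $W$ and all letters of the reduced words of the iterated faces of $\tilde x$ (and of the degeneracies of these faces), and which is closed under passing from an element $z$ to the letters of the reduced words of its images under all simplicial operators. Let $\Gamma(\tilde x)_\cdot$ be the free simplicial group on $\mathbb X'_\cdot$ if $n\le 2$, and on $\mathbb X'_\cdot$ together with one symbol $s_{\tilde x}$ of degree $n-1$, with $\partial_i s_{\tilde x}=\partial_i\tilde x$, and its degeneracies if $n\ge 3$. Let $\iota:\Gamma(\tilde x)_\cdot\to\Gamma_\cdot$ be the canonical map, which is the identity on $\mathbb X'_\cdot$ and sends $s_{\tilde x}$ to $\tilde x$; put $s_{\tilde x}:=\tilde x$ if $n\le 2$; augment $\Gamma(\tilde x)_\cdot$ by $\Gamma(\tilde x)_{-1}=\pi$. Then: 1. $\iota(s_{\tilde x})=\tilde x$, and if $x\ne 0$ then $\iota$ is injective in every degree, so that $\Gamma(\tilde x)_\cdot$ is a simplicial subgroup of $\Gamma_\cdot$. 2. $\iota$ is an isomorphism $\Gamma(\tilde x)_i\cong\Gamma_i$ for $-1\le i\le 1$. 3. $\Gamma(\tilde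 x)_\cdot$ is free on the above generators, which are closed under degeneracies and finite in number in each degree. 4. There is an integral fundamental class $\mu_{\tilde x}\in H_n(B\Gamma(\tilde x)_\cdot;\mathbb Z)$, represented by the class of $s_{\tilde x}$ in $H_1(B\Gamma(\tilde x)_{n-1};\mathbb Z)$, such that $\mu_{\tilde x}\mapsto x$ under $H_n(B\Gamma(\tilde x)_\cdot;\mathbb Z)\to H_n(B\Gamma(\tilde x)_\cdot;\mathbb C)\to H_n(B\Gamma_\cdot;\mathbb C)\cong H_n(B\pi;\mathbb C)$. If $n\ge3$, then $H_n(B\Gamma(\tilde x)_\cdot;\mathbb Z)\cong\mathbb Z$, generated by $\mu_{\tilde x}$. 5. In the spectral sequence $E^1_{p,q}=HC_p(\mathbb C[\Gamma(\tilde x)_q])\Rightarrow HC_{p+q}(\mathbb C[\Gamma(\tilde x)_\cdot])$, the class of $s_{\tilde x}^{-1}\otimes s_{\tilde x}$ (the image of the class of $s_{\tilde x}$ in $H_1(B\Gamma(\tilde x)_{n-1})$) is a permanent cycle in bidegree $(1,n-1)$. It represents in $E^\infty_{1,n-1}$ the image of $\mu_{\tilde x}$ in $HC_n(\mathbb C[\Gamma(\tilde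 x)_\cdot])$, and it is nonzero in $E^\infty_{1,n-1}$ if $x\neq0$. 6. If $x\ne 0$, there is a dual class $\mu^*_{\tilde x}\in H^n(B\Gamma(\tilde x)_\cdot;\mathbb Z)$ with $\langle\mu^*_{\tilde x},\mu_{\tilde x}\rangle\ne0$. If moreover $n\ge 3$, then $\langle\mu^*_{\tilde x},\mu_{\tilde x}\rangle=1$ and $H^n(B\Gamma(\tilde x)_\cdot;\mathbb Z)\cong\mathbb Z$, generated by $\mu^*_{\tilde x}$. The class $\mu^*_{\tilde x}$ is represented by an integral cochain $f$ on $\Gamma(\tilde x)_{n-1}$ in bidegree $(1,n-1)$ for which there is a cyclic cochain $\varphi$ on $\mathbb C[\Gamma(\tilde x)_{n-1}]$ with $\varphi(g^{-1}\otimes g)=f(g)$ for all $g\in\Gamma(\tilde x)_{n-1}$, such that $\varphi$ is a permanent cycle of the spectral sequence $E_1^{p,q}=HC^p(\mathbb C[\Gamma(\tilde x)_q])\Rightarrow HC^{p+q}(\mathbb C[\Gamma(\tilde x)_\cdot])$ and is nonzero in $E_\infty^{1,n-1}$. It represents there a class in $HC^n(\mathbb C[\Gamma(\tilde x)_\cdot])$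 which pairs nontrivially with the image of $\mu_{\tilde x}$. -/

import Mathlib

open CategoryTheory Opposite
noncomputable section
namespace LocalClass

open Classical in
/-- The element `y` of `X` occurs, with exponent `1` or `-1`, in the reduced word in the letters `X` that
represents `g` (the reduced word is unique when `X` is a free basis of `G`). -/
def Occurs {G : Type} [Group G] (X : Set G) (g y : G) : Prop :=
  ∃ w : FreeGroup X, FreeGroup.lift (Subtype.val : X → G) w = g ∧
    ∃ (h : y ∈ X) (e : Bool), (⟨y, h⟩, e) ∈ w.toWord

theorem mem_closure_occurs {G : Type} [Group G] (X : Set G)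
    (h : Function.Surjective (FreeGroup.lift (Subtype.val : X → G))) (g : G) :
    g ∈ Subgroup.closure {y | Occurs X g y} := by
  classical
  obtain ⟨w, rfl⟩ := h g
  have : ∀ L : List (X × Bool), (∀ a ∈ L, Occurs X (FreeGroup.lift (Subtype.val : X → G) w) a.1) →
      FreeGroup.lift (Subtype.val : X → G) (FreeGroup.mk L) ∈
        Subgroup.closure {y | Occurs X (FreeGroup.lift (Subtype.val : X → G) w) y} := by
    intro L hL
    rw [FreeGroup.lift_mk]
    refine Subgroup.list_prod_mem _ fun z hz => ?_
    obtain ⟨⟨a, e⟩, ha, rfl⟩ := List.mem_map.1 hz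
    have hm : (a : G) ∈ Subgroup.closure {y | Occurs X (FreeGroup.lift (Subtype.val : X → G) w) y} :=
      Subgroup.subset_closure (hL _ ha)
    cases e
    · exact inv_mem hm
    · exact hm
  have h2 := this w.toWord fun a ha => ⟨w, rfl, a.1.2, a.2, by
    convert ha⟩
  rwa [FreeGroup.mk_toWord] at h2

/-- The elements of the basis `X` of `Γ` which generate the local group of the element `xt` of `Γ_N`: all of
`X_0` and `X_1`; if `2 ≤ N`, the elements of the finite set `W` used to write the alternating face product of
`xt` as a product of commutators, and the letters of the reduced words of all iterated faces of `xt` (the values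
of the non-surjective operators on `xt`); and, recursively, the letters of the reduced words of `θ^* z` for all
simplicial operators `θ` (iterated faces and degeneracies) and all generators `z` obtained so far. -/
inductive LocalGen (Γ : SimplicialObject GrpCat.{0}) (X : ∀ m : SimplexCategoryᵒᵖ, Set (Γ.obj m))
    (N : ℕ) (xt : Γ.obj (op (.mk N))) (W : Set (Γ.obj (op (.mk (N - 1))))) :
    (m : SimplexCategoryᵒᵖ) → Γ.obj m → Prop where
  | zero (y : Γ.obj (op (.mk 0))) : y ∈ X (op (.mk 0)) → LocalGen Γ X N xt W (op (.mk 0)) y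
  | one (y : Γ.obj (op (.mk 1))) : y ∈ X (op (.mk 1)) → LocalGen Γ X N xt W (op (.mk 1)) y
  | comm (y : Γ.obj (op (.mk (N - 1)))) : 2 ≤ N → y ∈ W → LocalGen Γ X N xt W (op (.mk (N - 1))) y
  | bdry {k : SimplexCategoryᵒᵖ} (θ : k.unop ⟶ (.mk N)) (y : Γ.obj k) : 2 ≤ N →
      ¬ Function.Surjective θ.toOrderHom → Occurs (X k) (Γ.map θ.op xt) y → LocalGen Γ X N xt W k y
  | oper {m k : SimplexCategoryᵒᵖ} (θ : m ⟶ k) (z : Γ.obj m) (y : Γ.obj k) : LocalGen Γ X N xt W m z →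
      Occurs (X k) (Γ.map θ z) y → LocalGen Γ X N xt W k y

open Simplicial

namespace Cyclic
variable {G : Type} [Group G]

/-- Cyclic rotation `(g_0, …, g_p) ↦ (g_p, g_0, …, g_{p-1})`. -/
def rot {α : Type} {p : ℕ} (g : Fin (p + 1) → α) : Fin (p + 1) → α :=
  Fin.cons (g (Fin.last p)) (Fin.init g)

/-- Hochschild faces: `d_i` multiplies `g_i` with `g_{i+1}` for `i ≤ p`, and the last face is
`(g_0, …, g_{p+1}) ↦ (g_{p+1} g_0, g_1, …, g_p)`. -/
def face {p : ℕ} (i : Fin (p + 2)) (g : Fin (p + 2) → G) : Fin (p + 1) → G :=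
  if i = Fin.last (p + 1) then Fin.contractNth 0 (· * ·) (rot g)
  else Fin.contractNth i (· * ·) g

theorem face_apply {p : ℕ} (i : Fin (p + 2)) (g : Fin (p + 2) → G) (k : Fin (p + 1)) :
    face i g k = if (k : ℕ) < i then
        (if (i : ℕ) = p + 1 ∧ (k : ℕ) = 0 then g (Fin.last _) * g 0 else g k.castSucc)
      else if (k : ℕ) = i then g k.castSucc * g k.succ else g k.succ := by
  rcases eq_or_ne i (Fin.last _) with rfl | h
  · cases k using Fin.cases with
    | zero => simp [face, Fin.contractNth, rot, Fin.init]
    | succ k => simp [face, Fin.contractNth, rot, Fin.init]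
  · have h' : (i : ℕ) ≠ p + 1 := fun h2 => h (Fin.ext h2)
    simp [face, h, h', Fin.contractNth]

theorem face_face {p : ℕ} (i : Fin (p + 2)) (j : Fin (p + 3)) (h : (j : ℕ) ≤ i)
    (g : Fin (p + 3) → G) :
    face i (face j g) = face (Fin.castLT j (lt_of_le_of_lt h i.2)) (face i.succ g) := by
  obtain ⟨e, he⟩ : ∃ e : ℕ → G, ∀ k, g k = e k := ⟨fun n => if hn : n < p + 3 then g ⟨n, hn⟩ else 1, fun k => by simp⟩
  have hi := i.2
  funext k
  have hk := k.2
  simp only [face_apply, Fin.val_castSucc, Fin.val_succ, Fin.val_castLT, Fin.val_last, Fin.val_zero, he]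
  generalize (i : ℕ) = i at *
  generalize (j : ℕ) = j at *
  generalize (k : ℕ) = k at *
  grind

theorem face_rot_succ {p : ℕ} (i : Fin (p + 1)) (g : Fin (p + 2) → G) :
    face i.succ (rot g) = rot (face i.castSucc g) := by
  have hi := i.2
  funext k
  cases k using Fin.cases with
  | zero => 
    simp [face_apply, rot, Fin.init]
    grind
  | succ k =>
    have hk := k.2
    simp [face_apply, rot, Fin.init]
    grind

theorem face_rot_zero {p : ℕ} (g : Fin (p + 2) → G) :
    face 0 (rot g) = face (Fin.last _) g := by
  simp [face, Fin.ext_iff]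

theorem face_comp {H : Type} [Group H] (f : G →* H) {p : ℕ} (i : Fin (p + 2))
    (g : Fin (p + 2) → G) : (f ∘ face i g : Fin (p + 1) → H) = face i (f ∘ g) := by
  funext k
  simp only [Function.comp_apply, face_apply]
  split_ifs <;> simp

theorem rot_comp {α β : Type} (f : α → β) {p : ℕ} (g : Fin (p + 1) → α) :
    f ∘ rot g = rot (f ∘ g) := by
  funext k
  cases k using Fin.cases <;> simp [rot, Fin.init]

variable (G) in
/-- The group `ℂ[G]^{⊗(p+1)}`, through its basis `G^{p+1}`. -/
abbrev Chain (p : ℕ) : Type := (Fin (p + 1) → G) →₀ ℂ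

variable (G) in
/-- The signed cyclic operator. -/
def t (p : ℕ) : Chain G p →ₗ[ℂ] Chain G p :=
  (-1 : ℂ) ^ p • Finsupp.lmapDomain ℂ ℂ rot

variable (G) in
/-- The Hochschild boundary. -/
def b (p : ℕ) : Chain G (p + 1) →ₗ[ℂ] Chain G p :=
  ∑ i : Fin (p + 2), (-1 : ℂ) ^ (i : ℕ) • Finsupp.lmapDomain ℂ ℂ (face i)

variable (G) in
/-- The boundary without its last face. -/
def bPre (p : ℕ) : Chain G (p + 1) →ₗ[ℂ] Chain G p :=
  ∑ i : Fin (p + 1), (-1 : ℂ) ^ (i : ℕ) • Finsupp.lmapDomain ℂ ℂ (face i.castSucc)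

set_option linter.unusedSectionVars false in
theorem t_single (p : ℕ) (g : Fin (p + 1) → G) (a : ℂ) :
    t G p (Finsupp.single g a) = (-1 : ℂ) ^ p • Finsupp.single (rot g) a := by
  simp [t]

theorem b_single (p : ℕ) (g : Fin (p + 2) → G) (a : ℂ) :
    b G p (Finsupp.single g a) = ∑ i : Fin (p + 2), (-1 : ℂ) ^ (i : ℕ) • Finsupp.single (face i g) a := by
  simp [b]

theorem bPre_single (p : ℕ) (g : Fin (p + 2) → G) (a : ℂ) :
    bPre G p (Finsupp.single g a) = ∑ i : Fin (p + 1), (-1 : ℂ) ^ (i : ℕ) • Finsupp.single (face i.castSucc g) a := by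
  simp [bPre]

theorem b_comp_one_sub_t (p : ℕ) :
    b G p ∘ₗ (LinearMap.id - t G (p + 1)) = (LinearMap.id - t G p) ∘ₗ bPre G p := by
  refine Finsupp.lhom_ext fun g a => ?_
  simp only [LinearMap.comp_apply, LinearMap.sub_apply, LinearMap.id_apply, map_sub, t_single,
    map_smul, b_single, bPre_single, map_sum]
  rw [Fin.sum_univ_castSucc (n := p + 1), Fin.sum_univ_succ (n := p + 1)]
  simp only [face_rot_zero, face_rot_succ, Fin.val_castSucc, Fin.val_succ, Fin.val_last, Fin.val_zero]
  simp only [smul_add, Finset.smul_sum, smul_smul, pow_succ, pow_zero]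
  have : ∀ i : Fin (p + 1), (-1 : ℂ) ^ p * -1 * ((-1) ^ (i : ℕ) * -1) = (-1) ^ (i : ℕ) * (-1) ^ p := by
    intro i; ring
  simp only [this, mul_one, smul_sub, Finset.sum_sub_distrib, smul_smul]
  abel

theorem b_b (p : ℕ) : b G p ∘ₗ b G (p + 1) = 0 := by
  refine Finsupp.lhom_ext fun g a => ?_
  simp only [LinearMap.comp_apply, LinearMap.zero_apply, b_single, map_sum, map_smul, Finset.smul_sum,
    smul_smul]
  rw [← Finset.sum_product']
  refine Finset.sum_involution
    (fun ij _ => if h : (ij.1 : ℕ) ≤ ij.2 then (ij.2.succ, Fin.castLT ij.1 (lt_of_le_of_lt h ij.2.2))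
      else (ij.2.castSucc, ij.1.pred (by rintro h'; simp [h'] at h))) ?_ ?_ ?_ ?_
  · rintro ⟨j, i⟩ _
    by_cases h : (j : ℕ) ≤ i
    · simp only [h, dif_pos, face_face i j h]
      rw [← add_smul]
      simp [pow_succ, mul_comm]
    · simp only [h, dif_neg, not_false_iff]
      have h0 : j ≠ 0 := by rintro rfl; simp at h
      have h1 : ((i.castSucc : Fin (p + 3)) : ℕ) ≤ (j.pred h0 : ℕ) := by simp; omega
      have := face_face (j.pred h0) i.castSucc h1 g
      simp only [Fin.castLT_castSucc, Fin.succ_pred] at this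
      rw [this, ← add_smul]
      obtain ⟨j, rfl⟩ := Fin.exists_succ_eq.2 h0
      simp [pow_succ, mul_comm]
  · rintro ⟨j, i⟩ _ _
    by_cases h : (j : ℕ) ≤ i
    · simp only [h, dif_pos]; intro h2; simp [Prod.ext_iff, Fin.ext_iff] at h2; omega
    · simp only [h, dif_neg, not_false_iff]; intro h2; simp [Prod.ext_iff, Fin.ext_iff] at h2; omega
  · simp
  · rintro ⟨j, i⟩ _
    by_cases h : (j : ℕ) ≤ i
    · have : ¬ ((i : ℕ) + 1 ≤ j) := by omega
      simp [h, this]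
    · have h0 : j ≠ 0 := by rintro rfl; simp at h
      have : (i : ℕ) ≤ j - 1 := by omega
      simp [h, this]

variable (G) in
/-- Chains of the Connes complex `C^λ_p = ℂ[G]^{⊗(p+1)} / (1 - t)`, which computes the cyclic homology of
`ℂ[G]` since the ground field has characteristic zero. -/
abbrev Coinv (p : ℕ) : Type := Chain G p ⧸ LinearMap.range (LinearMap.id - t G p)

variable (G) in
/-- The Hochschild boundary on the Connes complex. -/
def bCoinv (p : ℕ) : Coinv G (p + 1) →ₗ[ℂ] Coinv G p :=
  Submodule.mapQ _ _ (b G p) (by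
    rintro _ ⟨c, rfl⟩
    exact ⟨bPre G p c, (LinearMap.congr_fun (b_comp_one_sub_t p) c).symm⟩)

variable {H K : Type} [Group H] [Group K]

/-- The map of chains induced by a homomorphism. -/
def mapChain (f : G →* H) (p : ℕ) : Chain G p →ₗ[ℂ] Chain H p :=
  Finsupp.lmapDomain ℂ ℂ (f ∘ ·)

theorem mapChain_single (f : G →* H) (p : ℕ) (g : Fin (p + 1) → G) (a : ℂ) :
    mapChain f p (Finsupp.single g a) = Finsupp.single (f ∘ g) a := by
  simp [mapChain]

theorem mapChain_t (f : G →* H) (p : ℕ) : mapChain f p ∘ₗ t G p = t H p ∘ₗ mapChain f p := by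
  refine Finsupp.lhom_ext fun g a => ?_
  simp only [LinearMap.comp_apply, t_single, map_smul, mapChain_single, rot_comp]

theorem mapChain_b (f : G →* H) (p : ℕ) : mapChain f p ∘ₗ b G p = b H p ∘ₗ mapChain f (p + 1) := by
  refine Finsupp.lhom_ext fun g a => ?_
  simp only [LinearMap.comp_apply, b_single, map_sum, map_smul, mapChain_single, face_comp]

/-- The map of Connes chains induced by a homomorphism. -/
def mapCoinv (f : G →* H) (p : ℕ) : Coinv G p →ₗ[ℂ] Coinv H p :=
  Submodule.mapQ _ _ (mapChain f p) (by
    rintro _ ⟨c, rfl⟩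
    refine ⟨mapChain f p c, ?_⟩
    have := LinearMap.congr_fun (mapChain_t f p) c
    simp only [LinearMap.comp_apply] at this
    simp [this])

variable (G) in
/-- The Connes complex of `ℂ[G]`. -/
def cx : ChainComplex (ModuleCat.{0} ℂ) ℕ :=
  ChainComplex.of (fun p => ModuleCat.of ℂ (Coinv G p)) (fun p => ModuleCat.ofHom (bCoinv G p))
    (fun p => by
      refine ModuleCat.hom_ext (Submodule.linearMap_qext _ (LinearMap.ext fun c => ?_))
      exact congrArg (Submodule.mkQ _) (LinearMap.congr_fun (b_b (G := G) p) c))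

theorem cx_d (p : ℕ) : (cx G).d (p + 1) p = ModuleCat.ofHom (bCoinv G p) := by
  simp [cx]

/-- The map of Connes complexes induced by a homomorphism. -/
def cxMap (f : G →* H) : cx G ⟶ cx H :=
  ChainComplex.ofHom (fun p => ModuleCat.ofHom (mapCoinv f p)) fun p => by
    rw [cx_d, cx_d]
    refine ModuleCat.hom_ext (Submodule.linearMap_qext _ (LinearMap.ext fun c => ?_))
    exact congrArg (Submodule.mkQ _) (LinearMap.congr_fun (mapChain_b f p) c).symm

/-- The functor from groups to complexes that sends `G` to the Connes complex of `ℂ[G]`. -/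
def functor : GrpCat.{0} ⥤ ChainComplex (ModuleCat.{0} ℂ) ℕ where
  obj G := cx G
  map f := cxMap f.hom
  map_id G := by
    refine HomologicalComplex.hom_ext _ _ fun p => ModuleCat.hom_ext
      (Submodule.linearMap_qext _ (Finsupp.lhom_ext fun g a => ?_))
    exact congrArg (Submodule.mkQ _) (mapChain_single (MonoidHom.id G) p g a)
  map_comp {G H K} f g := by
    refine HomologicalComplex.hom_ext _ _ fun p => ModuleCat.hom_ext
      (Submodule.linearMap_qext _ (Finsupp.lhom_ext fun x a => ?_))
    exact congrArg (Submodule.mkQ _) (((mapChain_single (g.hom.comp f.hom) p x a).trans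
      (mapChain_single g.hom p (f.hom ∘ x) a).symm).trans
      (congrArg (mapChain g.hom p) (mapChain_single f.hom p x a).symm))


/-- The map of inhomogeneous bar complexes induced by a homomorphism. -/
def barMap (R : Type) [CommRing R] {G H : Type} [Group G] [Group H] (f : G →* H) :
    groupHomology.inhomogeneousChains (Rep.trivial R G R) ⟶
      groupHomology.inhomogeneousChains (Rep.trivial R H R) :=
  groupHomology.chainsMap f (𝟙 (Rep.trivial R G R))

theorem barMap_single (R : Type) [CommRing R] {G H : Type} [Group G] [Group H] (f : G →* H)
    (p : ℕ) (g : Fin p → G) (a : R) :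
    (barMap R f).f p (Finsupp.single g a) = (Finsupp.single (f ∘ g) a : (Fin p → H) →₀ R) :=
  groupHomology.chainsMap_f_single _ _ _ _ _

/-- The functor from groups to complexes that sends `G` to the complex of inhomogeneous chains of `G`, that is
the simplicial chains of the classifying space `BG`, with coefficients in `R`. -/
def bar (R : Type) [CommRing R] : GrpCat.{0} ⥤ ChainComplex (ModuleCat.{0} R) ℕ where
  obj G := groupHomology.inhomogeneousChains (Rep.trivial R G R)
  map f := barMap R f.hom
  map_id G := groupHomology.chainsMap_id
  map_comp {G H K} f g := by
    refine HomologicalComplex.hom_ext _ _ fun p => ModuleCat.hom_ext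
      (Finsupp.lhom_ext fun x a => ?_)
    refine (barMap_single R (g.hom.comp f.hom) p x a).trans ?_
    exact ((barMap_single R g.hom p (f.hom ∘ x) a).symm).trans
      (congrArg ((barMap R g.hom).f p) (barMap_single R f.hom p x a).symm)

theorem bar_d_single (R : Type) [CommRing R] {G : GrpCat.{0}} (p : ℕ) (g : Fin (p+1) → G) (a : R) :
   ((bar R).obj G).d (p+1) p (Finsupp.single g a) = (Finsupp.single (fun i => g i.succ) a + 
     ∑ j : Fin (p + 1), (-1 : R) ^ ((j : ℕ) + 1) • Finsupp.single (Fin.contractNth j (· * ·) g) a : (Fin p → G) →₀ R) := by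
  refine Eq.trans (congrArg (fun f => f.hom (Finsupp.single g a)) (groupHomology.inhomogeneousChains.d_def (Rep.trivial R G R) p)) ?_
  exact groupHomology.inhomogeneousChains.d_single (A := Rep.trivial R G R) p g a

/-- The tuple `((g_1 ⋯ g_p)⁻¹, g_1, …, g_p)`. -/
def nerveLift {G : Type} [Group G] {p : ℕ} (g : Fin p → G) : Fin (p + 1) → G :=
  Fin.cons (List.ofFn g).prod⁻¹ g

theorem comp_nerveLift {G H : Type} [Group G] [Group H] (f : G →* H) {p : ℕ} (g : Fin p → G) :
    f ∘ nerveLift g = nerveLift (f ∘ g) := by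
  funext k
  cases k using Fin.cases <;> simp [nerveLift, map_list_prod, List.map_ofFn]

/-- The map `[g_1 | ⋯ | g_p] ↦ (g_1 ⋯ g_p)⁻¹ ⊗ g_1 ⊗ ⋯ ⊗ g_p`. -/
def barToCyclicLin (G : Type) [Group G] (p : ℕ) : ((Fin p → G) →₀ ℂ) →ₗ[ℂ] Coinv G p :=
  Submodule.mkQ _ ∘ₗ Finsupp.lmapDomain ℂ ℂ nerveLift

theorem barToCyclicLin_single (G : Type) [Group G] (p : ℕ) (g : Fin p → G) (a : ℂ) :
    barToCyclicLin G p (Finsupp.single g a) = Submodule.Quotient.mk (Finsupp.single (nerveLift g) a) := by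
  simp [barToCyclicLin]

theorem face_nerveLift_zero {G : Type} [Group G] (p : ℕ) (g : Fin (p + 1) → G) :
    face 0 (nerveLift g) = nerveLift (fun i => g i.succ) := by
  funext k
  cases k using Fin.cases <;> simp [face_apply, List.ofFn_succ, nerveLift]

theorem prod_contract {G : Type} [Group G] (p : ℕ) (j : Fin p) (g : Fin (p + 1) → G) :
    (List.ofFn (Fin.contractNth j.castSucc (· * ·) g)).prod = (List.ofFn g).prod := by
  induction p with
  | zero => exact j.elim0
  | succ p ih =>
    cases j using Fin.cases with
    | zero => simp [List.ofFn_succ, Fin.contractNth, mul_assoc]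
    | succ j =>
      rw [List.ofFn_succ, List.ofFn_succ (f := g), List.prod_cons, List.prod_cons,
        ← ih j (fun i => g i.succ)]
      congr 1
      congr 2
      funext k
      simp [Fin.contractNth]

theorem face_nerveLift_succ {G : Type} [Group G] (p : ℕ) (j : Fin (p + 1)) (g : Fin (p + 1) → G) :
    face j.succ (nerveLift g) = nerveLift (Fin.contractNth j (· * ·) g) := by
  have hj := j.2
  funext k
  cases k using Fin.cases with
  | zero =>
    cases j using Fin.lastCases with
    | last =>
      have : Fin.contractNth (Fin.last p) (· * ·) g = fun k => g k.castSucc := by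
        funext k; simp [Fin.contractNth]
      have h2 : (List.ofFn g).prod = (List.ofFn fun k => g k.castSucc).prod * g (Fin.last p) := by
        rw [List.ofFn_succ']; simp
      simp only [this, nerveLift, h2]
      simp [face_apply]
    | cast j =>
      simp only [nerveLift]
      rw [prod_contract]
      have := j.2
      simp [face_apply]
      omega
  | succ k =>
    have := k.2
    simp only [nerveLift, Fin.cons_succ]
    simp [face_apply, Fin.contractNth]

/-- The natural map from the bar complex of `G` to the Connes complex of `ℂ[G]`; it induces the standard map
`H_*(BG; ℂ) → HC_*(ℂ[G])`. -/
def barToCyclic : bar ℂ ⟶ functor where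
  app G := ChainComplex.ofHom (fun p => ModuleCat.ofHom (barToCyclicLin G p)) fun p => by
    refine ModuleCat.hom_ext (Finsupp.lhom_ext fun g a => ?_)
    change ((cx G).d (p + 1) p).hom (barToCyclicLin G (p + 1) (Finsupp.single g a)) =
      barToCyclicLin G p (((bar ℂ).obj G).d (p + 1) p (Finsupp.single g a))
    rw [bar_d_single, barToCyclicLin_single, cx_d]
    refine (congrArg (Submodule.Quotient.mk) (b_single p (nerveLift g) a)).trans ?_
    rw [Fin.sum_univ_succ]
    simp only [face_nerveLift_zero, face_nerveLift_succ, map_add, map_sum, map_smul, barToCyclicLin_single]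
    refine (map_add (Submodule.mkQ _) _ _).trans ?_
    rw [map_sum]
    congr 1
    · simp
  naturality G H f := by
    refine HomologicalComplex.hom_ext _ _ fun p => ModuleCat.hom_ext
      (Finsupp.lhom_ext fun g a => ?_)
    refine (congrArg (barToCyclicLin H p) (barMap_single ℂ f.hom p g a)).trans ?_
    refine Eq.trans ?_ (congrArg (mapCoinv f.hom p) (barToCyclicLin_single G p g a)).symm
    rw [barToCyclicLin_single]
    refine Eq.trans ?_ (congrArg (Submodule.mkQ _) (mapChain_single f.hom p (nerveLift g) a)).symm
    congr 2
    exact (comp_nerveLift f.hom g).symm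

end Cyclic

/-- First quadrant bicomplexes: `(K.X q).X p` is the term `K_{p,q}` of internal degree `p` and simplicial
degree `q`. -/
abbrev Bicomplex (R : Type) [CommRing R] : Type 1 :=
  ChainComplex (ChainComplex (ModuleCat.{0} R) ℕ) ℕ

namespace Bicomplex

variable {R : Type} [CommRing R] (K : Bicomplex R)

/-- The internal differential `K_{p+1,q} → K_{p,q}`. -/
abbrev dv (p q : ℕ) : (K.X q).X (p + 1) →ₗ[R] (K.X q).X p := ((K.X q).d (p + 1) p).hom

/-- The simplicial differential `K_{p,q+1} → K_{p,q}`. -/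
abbrev dh (p q : ℕ) : (K.X (q + 1)).X p →ₗ[R] (K.X q).X p := ((K.d (q + 1) q).f p).hom

/-- All terms of the bicomplex at once. -/
abbrev Tot : Type := ∀ p q : ℕ, (K.X q).X p

/-- The component in bidegree `(p, q)`. -/
def comp (p q : ℕ) : K.Tot →ₗ[R] (K.X q).X p :=
  LinearMap.proj (φ := fun q => (K.X q).X p) q ∘ₗ LinearMap.proj (φ := fun p => ∀ q, (K.X q).X p) p

/-- The differential of the total complex. -/
def totD : K.Tot →ₗ[R] K.Tot :=
  LinearMap.pi fun p => LinearMap.pi fun q =>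
    K.dv p q ∘ₗ K.comp (p + 1) q + (-1 : R) ^ p • (K.dh p q ∘ₗ K.comp p (q + 1))

theorem totD_apply (t : K.Tot) (p q : ℕ) :
    K.totD t p q = K.dv p q (t (p + 1) q) + (-1 : R) ^ p • K.dh p q (t p (q + 1)) := rfl

/-- Elements of total degree `n`. -/
def homog (n : ℕ) : Submodule R K.Tot where
  carrier := {t | ∀ p q, p + q ≠ n → t p q = 0}
  add_mem' ha hb p q h := by simp [ha p q h, hb p q h]
  zero_mem' _ _ _ := rfl
  smul_mem' c t ht p q h := by simp [ht p q h]

/-- The filtration by simplicial degree: elements which vanish in simplicial degrees `≥ k`. -/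
def filtLT (k : ℕ) : Submodule R K.Tot where
  carrier := {t | ∀ p q, k ≤ q → t p q = 0}
  add_mem' ha hb p q h := by simp [ha p q h, hb p q h]
  zero_mem' _ _ _ := rfl
  smul_mem' c t ht p q h := by simp [ht p q h]

/-- Cycles of total degree `n`. -/
def cycles (n : ℕ) : Submodule R K.Tot := K.homog n ⊓ LinearMap.ker K.totD
/-- Boundaries of total degree `n`. -/
def boundaries (n : ℕ) : Submodule R K.Tot := (K.homog (n + 1)).map K.totD
/-- The homology of the total complex. -/
abbrev H (n : ℕ) : Type := K.cycles n ⧸ (K.boundaries n).submoduleOf (K.cycles n)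

/-- The elements of `K_{p,q}` that survive to the page `E^r`: leading terms `c` of elements of total degree
`p + q` and filtration `≤ q` whose total differential has filtration `≤ q - r`. -/
def Z (r p q : ℕ) : Submodule R ((K.X q).X p) :=
  (K.homog (p + q) ⊓ K.filtLT (q + 1) ⊓ (K.filtLT (q + 1 - r)).comap K.totD).map (K.comp p q)
/-- The elements of `K_{p,q}` that vanish on the page `E^r`: leading terms of total boundaries, of filtration
`≤ q`, of elements of filtration `≤ q + r - 1`. -/
def B (r p q : ℕ) : Submodule R ((K.X q).X p) :=
  (K.filtLT (q + 1) ⊓ (K.homog (p + q + 1) ⊓ K.filtLT (q + r)).map K.totD).map (K.comp p q)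
/-- The page `E^r_{p,q}` of the spectral sequence of the filtration by simplicial degree; `E^1_{p,q}` is the
homology of the column `K_{*,q}` and the page converges to `H_{p+q}`. -/
abbrev E (r p q : ℕ) : Type := K.Z r p q ⧸ (K.B r p q).submoduleOf (K.Z r p q)
/-- Permanent cycles in bidegree `(p, q)`. -/
def ZInf (p q : ℕ) : Submodule R ((K.X q).X p) := ⨅ r, K.Z r p q
/-- Elements of bidegree `(p, q)` that are eventually killed. -/
def BInf (p q : ℕ) : Submodule R ((K.X q).X p) := ⨆ r, K.B r p q
/-- The page `E^∞_{p,q}`. -/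
abbrev EInf (p q : ℕ) : Type := K.ZInf p q ⧸ (K.BInf p q).submoduleOf (K.ZInf p q)

theorem Z_one_succ (p q : ℕ) : K.Z 1 (p + 1) q = LinearMap.ker (K.dv p q) := by
  classical
  ext c
  constructor
  · rintro ⟨t, ⟨⟨h1, h2⟩, h3⟩, rfl⟩
    have := h3 p q (by simp)
    rw [totD_apply, h2 p (q + 1) le_rfl] at this
    have h4 : K.dv p q (t (p + 1) q) = 0 := by simpa using this
    exact h4
  · intro hc
    refine ⟨Pi.single (p + 1) (Pi.single q c), ⟨⟨?_, ?_⟩, ?_⟩, ?_⟩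
    · intro a b hab
      by_cases ha : a = p + 1
      · subst ha
        have hb : b ≠ q := by rintro rfl; exact hab rfl
        simp [hb]
      · simp [ha]
    · intro a b hab
      have hb : b ≠ q := by omega
      by_cases ha : a = p + 1
      · subst ha; simp [hb]
      · simp [ha]
    · intro a b hab
      rw [totD_apply]
      have hab : q ≤ b := by simpa using hab
      have hb : b + 1 ≠ q := by omega
      have h2 : (Pi.single (p + 1) (Pi.single q c) : K.Tot) a (b + 1) = 0 := by
        by_cases ha : a = p + 1
        · subst ha; simp [hb]
        · simp [ha]
      rw [h2, map_zero, smul_zero, add_zero]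
      by_cases ha : a = p
      · subst ha
        by_cases hb : b = q
        · subst hb; simpa using hc
        · simp [hb]
      · simp [ha]
    · simp [comp]

theorem B_one (p q : ℕ) : K.B 1 p q = LinearMap.range (K.dv p q) := by
  classical
  ext c
  constructor
  · rintro ⟨_, ⟨h1, t, ⟨h2, h3⟩, rfl⟩, rfl⟩
    refine ⟨t (p + 1) q, ?_⟩
    change _ = K.totD t p q
    rw [totD_apply, h3 p (q + 1) le_rfl]
    simp
  · rintro ⟨c, rfl⟩
    have key : ∀ a b, b ≠ q → (Pi.single (p + 1) (Pi.single q c) : K.Tot) a b = 0 := by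
      intro a b hb
      by_cases ha : a = p + 1
      · subst ha; simp [hb]
      · simp [ha]
    refine ⟨_, ⟨?_, Pi.single (p + 1) (Pi.single q c), ⟨?_, ?_⟩, rfl⟩, ?_⟩
    · intro a b hab
      rw [totD_apply, key _ b (by omega), key _ (b + 1) (by omega)]
      simp
    · intro a b hab
      by_cases ha : a = p + 1
      · subst ha
        have hb : b ≠ q := by rintro rfl; omega
        simp [hb]
      · simp [ha]
    · intro a b hab
      exact key _ _ (by omega)
    · change K.totD _ p q = _
      rw [totD_apply, key _ (q + 1) (by omega)]
      simp

/-- The homology class `ξ` is represented in `E^∞_{p,q}` by the element `c`: it has a cycle representative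
of filtration `≤ q` with leading term `c`. -/
def Detects (n : ℕ) {p q : ℕ} (c : (K.X q).X p) (ξ : K.H n) : Prop :=
  ∃ z : K.cycles n, z.1 ∈ K.filtLT (q + 1) ∧ z.1 p q = c ∧ Submodule.Quotient.mk z = ξ

/-- All terms of the dual bicomplex, with terms `Hom(K_{p,q}, R)`. -/
def CoTot : Type := ∀ p q : ℕ, ((K.X q).X p →ₗ[R] R)

instance : AddCommGroup K.CoTot :=
  inferInstanceAs (AddCommGroup (∀ p q : ℕ, ((K.X q).X p →ₗ[R] R)))

instance : Module R K.CoTot :=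
  inferInstanceAs (Module R (∀ p q : ℕ, ((K.X q).X p →ₗ[R] R)))

/-- The component in bidegree `(p, q)`. -/
def cocomp (p q : ℕ) : K.CoTot →ₗ[R] ((K.X q).X p →ₗ[R] R) :=
  LinearMap.proj (φ := fun q => ((K.X q).X p →ₗ[R] R)) q ∘ₗ
    LinearMap.proj (φ := fun p => ∀ q, (K.X q).X p →ₗ[R] R) p

/-- The dual of the internal differential. -/
def codv (p q : ℕ) : K.CoTot →ₗ[R] ((K.X q).X p →ₗ[R] R) :=
  match p with
  | 0 => 0
  | p + 1 => (K.dv p q).dualMap ∘ₗ K.cocomp p q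

/-- The dual of the simplicial differential. -/
def codh (p q : ℕ) : K.CoTot →ₗ[R] ((K.X q).X p →ₗ[R] R) :=
  match q with
  | 0 => 0
  | q + 1 => (K.dh p q).dualMap ∘ₗ K.cocomp p q

/-- The differential of the total cochain complex. -/
def totCoD : K.CoTot →ₗ[R] K.CoTot :=
  LinearMap.pi fun p => LinearMap.pi fun q => K.codv p q + (-1 : R) ^ p • K.codh p q

/-- Cochains of total degree `n`. -/
def cohomog (n : ℕ) : Submodule R K.CoTot where
  carrier := {t | ∀ p q, p + q ≠ n → t p q = 0}
  add_mem' {f g} hf hg p q h := by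
    change f p q + g p q = 0
    rw [hf p q h, hg p q h, add_zero]
  zero_mem' _ _ _ := rfl
  smul_mem' c f hf p q h := by
    change c • f p q = 0
    rw [hf p q h, smul_zero]

/-- Cochains of total degree `n - 1` (none if `n = 0`). -/
def cohomogPred (n : ℕ) : Submodule R K.CoTot where
  carrier := {t | ∀ p q, p + q + 1 ≠ n → t p q = 0}
  add_mem' {f g} hf hg p q h := by
    change f p q + g p q = 0
    rw [hf p q h, hg p q h, add_zero]
  zero_mem' _ _ _ := rfl
  smul_mem' c f hf p q h := by
    change c • f p q = 0
    rw [hf p q h, smul_zero]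

/-- The filtration by simplicial degree: cochains which vanish in simplicial degrees `< k`. -/
def filtGE (k : ℕ) : Submodule R K.CoTot where
  carrier := {t | ∀ p q, q < k → t p q = 0}
  add_mem' {f g} hf hg p q h := by
    change f p q + g p q = 0
    rw [hf p q h, hg p q h, add_zero]
  zero_mem' _ _ _ := rfl
  smul_mem' c f hf p q h := by
    change c • f p q = 0
    rw [hf p q h, smul_zero]

/-- Cocycles of total degree `n`. -/
def cocycles (n : ℕ) : Submodule R K.CoTot := K.cohomog n ⊓ LinearMap.ker K.totCoD
/-- Coboundaries of total degree `n`. -/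
def coboundaries (n : ℕ) : Submodule R K.CoTot := (K.cohomogPred n).map K.totCoD
/-- The cohomology of the total cochain complex. -/
abbrev CoH (n : ℕ) : Type := K.cocycles n ⧸ (K.coboundaries n).submoduleOf (K.cocycles n)

/-- The cochains on `K_{p,q}` that survive to the page `E_r`. -/
def coZ (r p q : ℕ) : Submodule R (((K.X q).X p →ₗ[R] R)) :=
  (K.cohomog (p + q) ⊓ K.filtGE q ⊓ (K.filtGE (q + r)).comap K.totCoD).map (K.cocomp p q)
/-- The cochains on `K_{p,q}` that vanish on the page `E_r`. -/
def coB (r p q : ℕ) : Submodule R (((K.X q).X p →ₗ[R] R)) :=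
  (K.filtGE q ⊓ (K.cohomogPred (p + q) ⊓ K.filtGE (q + 1 - r)).map K.totCoD).map (K.cocomp p q)

/-- Permanent cocycles in bidegree `(p, q)`. -/
def coZInf (p q : ℕ) : Submodule R ((K.X q).X p →ₗ[R] R) := ⨅ r, K.coZ r p q
/-- Cochains of bidegree `(p, q)` that are eventually killed. -/
def coBInf (p q : ℕ) : Submodule R ((K.X q).X p →ₗ[R] R) := ⨆ r, K.coB r p q
set_option maxSynthPendingDepth 3 in
/-- The page `E_∞^{p,q}` of the dual spectral sequence. -/
abbrev coEInf (p q : ℕ) : Type := K.coZInf p q ⧸ (K.coBInf p q).submoduleOf (K.coZInf p q)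

/-- The cohomology class `η` is represented in `E_∞^{p,q}` by the cochain `f`. -/
def CoDetects (n : ℕ) {p q : ℕ} (f : (K.X q).X p →ₗ[R] R) (η : K.CoH n) : Prop :=
  ∃ F : K.cocycles n, F.1 ∈ K.filtGE q ∧ F.1 p q = f ∧ Submodule.Quotient.mk F = η

/-- Evaluation of cochains on chains in total degree `n`. -/
def pairTot (n : ℕ) : K.CoTot →ₗ[R] K.Tot →ₗ[R] R :=
  ∑ a ∈ Finset.HasAntidiagonal.antidiagonal n, (LinearMap.id (M := (K.X a.2).X a.1 →ₗ[R] R)).compl₁₂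
    (K.cocomp a.1 a.2) (K.comp a.1 a.2)

theorem pairTot_apply (n : ℕ) (f : K.CoTot) (t : K.Tot) :
    K.pairTot n f t = ∑ a ∈ Finset.HasAntidiagonal.antidiagonal n, f a.1 a.2 (t a.1 a.2) := by
  simp only [pairTot, LinearMap.sum_apply]
  rfl

theorem pairTot_totCoD (n : ℕ) (f : K.CoTot) (t : K.Tot) :
    K.pairTot (n + 1) (K.totCoD f) t = K.pairTot n f (K.totD t) := by
  simp only [pairTot_apply]
  have h : ∀ a : ℕ × ℕ, K.totCoD f a.1 a.2 (t a.1 a.2) =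
      K.codv a.1 a.2 f (t a.1 a.2) + (-1 : R) ^ a.1 * K.codh a.1 a.2 f (t a.1 a.2) := by
    intro a; rfl
  simp only [h, Finset.sum_add_distrib, totD_apply, map_add]
  rw [Finset.Nat.sum_antidiagonal_succ, Finset.Nat.sum_antidiagonal_succ']
  simp [codv, codh, cocomp]
  rfl

theorem totCoD_cohomogPred_zero {f : K.CoTot} (hf : f ∈ K.cohomogPred 0) : f = 0 := by
  funext p q
  exact hf p q (by omega)

/-- The pairing of cohomology with homology. -/
def pairing (n : ℕ) : K.CoH n →ₗ[R] K.H n →ₗ[R] R :=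
  Submodule.liftQ _
    (LinearMap.flip (Submodule.liftQ _
      (((K.pairTot n).compl₁₂ (K.cocycles n).subtype (K.cycles n).subtype).flip) (by
        rintro ⟨_, _⟩ ⟨w, hw, rfl⟩
        ext ⟨f, hf⟩
        have := K.pairTot_totCoD n f w
        rw [LinearMap.mem_ker.1 hf.2] at this
        simpa using this.symm)))
    (by
      rintro ⟨_, hf⟩ ⟨g, hg, rfl⟩
      refine LinearMap.mem_ker.2 (Submodule.linearMap_qext _ (LinearMap.ext ?_))
      rintro ⟨t, ht⟩
      change K.pairTot n (K.totCoD g) t = 0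
      cases n with
      | zero => rw [K.totCoD_cohomogPred_zero hg]; simp
      | succ n => rw [pairTot_totCoD, LinearMap.mem_ker.1 ht.2]; simp)

/-- Additive maps of bicomplexes, possibly over different rings. -/
structure Morphism {R S : Type} [CommRing R] [CommRing S] (K : Bicomplex R) (L : Bicomplex S) where
  toFun : ∀ p q : ℕ, (K.X q).X p →+ (L.X q).X p
  map_dv : ∀ p q c, toFun p q (K.dv p q c) = L.dv p q (toFun (p + 1) q c)
  map_dh : ∀ p q c, toFun p q (K.dh p q c) = L.dh p q (toFun p (q + 1) c)

/-- A morphism of bicomplexes over the same ring. -/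
def Morphism.ofHom {K L : Bicomplex R} (φ : K ⟶ L) : Morphism K L where
  toFun p q := ((φ.f q).f p).hom.toAddMonoidHom
  map_dv p q c := (ConcreteCategory.congr_hom ((φ.f q).comm (p + 1) p) c).symm
  map_dh p q c := by
    have := congrArg (fun f => f.f p) (φ.comm (q + 1) q)
    exact (ConcreteCategory.congr_hom this c).symm

namespace Morphism
variable {S : Type} [CommRing S] {K} {L : Bicomplex S} (φ : Morphism K L)

/-- The map on total complexes. -/
def tot : K.Tot →+ L.Tot where
  toFun t p q := φ.toFun p q (t p q)
  map_zero' := by funext p q; exact map_zero _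
  map_add' s t := by funext p q; exact map_add _ _ _

theorem tot_totD (t : K.Tot) : φ.tot (K.totD t) = L.totD (φ.tot t) := by
  funext p q
  change φ.toFun p q (K.totD t p q) = _
  rw [totD_apply, totD_apply, map_add, φ.map_dv]
  congr 1
  rcases neg_one_pow_eq_or R p with h | h <;> rcases Nat.even_or_odd p with hp | hp <;>
    simp [hp, φ.map_dh, tot]

theorem tot_homog {n : ℕ} {t : K.Tot} (ht : t ∈ K.homog n) : φ.tot t ∈ L.homog n := by
  intro p q h
  change φ.toFun p q (t p q) = 0
  rw [ht p q h, map_zero]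

/-- The map on cycles. -/
def cyclesMap (n : ℕ) : K.cycles n →+ L.cycles n :=
  (φ.tot.comp (K.cycles n).subtype.toAddMonoidHom).codRestrict (L.cycles n) (by
    rintro ⟨t, h1, h2⟩
    refine ⟨φ.tot_homog h1, ?_⟩
    change L.totD (φ.tot t) = 0
    rw [← φ.tot_totD, LinearMap.mem_ker.1 h2, map_zero])

/-- The map on homology. -/
def map (n : ℕ) : K.H n →+ L.H n :=
  QuotientAddGroup.map _ _ (φ.cyclesMap n) (by
    rintro ⟨_, _⟩ ⟨w, hw, rfl⟩
    exact ⟨φ.tot w, φ.tot_homog hw, (φ.tot_totD w).symm⟩)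

end Morphism
end Bicomplex


/-- `Γ` is a free simplicial group on the graded set `X`: each `Γ_m` is free on `X_m`, and `X` is closed under
degeneracies. -/
def IsFreeSimplicialBasis (Γ : SimplicialObject GrpCat.{0})
    (X : ∀ m : SimplexCategoryᵒᵖ, Set (Γ.obj m)) : Prop :=
  (∀ m, Function.Bijective (FreeGroup.lift (Subtype.val : X m → Γ.obj m))) ∧
    ∀ (m : ℕ) (i : Fin (m + 1)), ∀ y ∈ X (op ⦋m⦌), Γ.σ i y ∈ X (op ⦋m + 1⦌)

/-- The augmentation `Γ_0 → π` of an augmented simplicial group `Γ → π`. -/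
def augmentation (A : SimplicialObject.Augmented GrpCat.{0}) : A.left _⦋0⦌ ⟶ A.right :=
  A.hom.app (op ⦋0⦌)

/-- A free simplicial resolution of the group `π = A.right`: the simplicial group `Γ = A.left` is free on a
graded set `gens` closed under degeneracies, with finitely many generators in degrees `0` and `1`, the
augmentation identifies `π_0(Γ)` with `π`, and the higher homotopy groups of `Γ` (the homology of the Moore
complex) vanish. -/
structure FreeResolution (A : SimplicialObject.Augmented GrpCat.{0}) where
  gens : ∀ m : SimplexCategoryᵒᵖ, Set (A.left.obj m)
  isBasis : IsFreeSimplicialBasis A.left gens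
  finite_zero : (gens (op ⦋0⦌)).Finite
  finite_one : (gens (op ⦋1⦌)).Finite
  surj : Function.Surjective (augmentation A)
  exact_zero : ∀ g : A.left _⦋0⦌, augmentation A g = 1 →
    ∃ h : A.left _⦋1⦌, A.left.δ 0 h = 1 ∧ A.left.δ 1 h = g
  exact_succ : ∀ (m : ℕ) (g : A.left _⦋m + 1⦌), (∀ i, A.left.δ i g = 1) →
    ∃ h : A.left _⦋m + 2⦌, (∀ i : Fin (m + 2), A.left.δ i.castSucc h = 1) ∧
      A.left.δ (Fin.last (m + 2)) h = g

section Attach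
variable (Γ : SimplicialObject GrpCat.{0}) (N : ℕ) (xt : Γ _⦋N⦌)

/-- Surjective monotone maps `[m] → [N]`, indexing the degeneracies of a simplex of degree `N`. -/
abbrev Surj (m : SimplexCategoryᵒᵖ) : Type :=
  {σ : m.unop ⟶ ⦋N⦌ // Function.Surjective σ.toOrderHom}

/-- In degree `m`, the free product of `Γ_m` with the free group on the degeneracies of a new symbol of
degree `N`. -/
abbrev AttachGroup (m : SimplexCategoryᵒᵖ) : Type :=
  Monoid.Coprod (Γ.obj m) (FreeGroup (Surj N m))

variable {Γ N}

open Classical in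
/-- The value of an operator `θ` on the degeneracy `σ` of the new symbol, whose faces are those of `xt`. -/
def attachGen {m k : SimplexCategoryᵒᵖ} (θ : m ⟶ k) (σ : m.unop ⟶ ⦋N⦌) : AttachGroup Γ N k :=
  if h : Function.Surjective (θ.unop ≫ σ).toOrderHom then
    Monoid.Coprod.inr (FreeGroup.of ⟨θ.unop ≫ σ, h⟩)
  else Monoid.Coprod.inl (Γ.map (θ.unop ≫ σ).op xt)

/-- The operators of the simplicial group `attach`. -/
def attachMap {m k : SimplexCategoryᵒᵖ} (θ : m ⟶ k) : AttachGroup Γ N m →* AttachGroup Γ N k :=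
  Monoid.Coprod.lift (Monoid.Coprod.inl.comp (Γ.map θ).hom)
    (FreeGroup.lift fun σ => attachGen xt θ σ.1)

theorem attachMap_inl {m k : SimplexCategoryᵒᵖ} (θ : m ⟶ k) (y : Γ.obj m) :
    attachMap xt θ (Monoid.Coprod.inl y) = Monoid.Coprod.inl (Γ.map θ y) := rfl

theorem attachMap_gen {m k l : SimplexCategoryᵒᵖ} (θ : m ⟶ k) (η : k ⟶ l) (σ : m.unop ⟶ ⦋N⦌) :
    attachMap xt η (attachGen xt θ σ) = attachGen xt (θ ≫ η) σ := by
  by_cases h : Function.Surjective (θ.unop ≫ σ).toOrderHom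
  · rw [attachGen, dif_pos h]
    simp only [attachMap, Monoid.Coprod.lift_apply_inr, FreeGroup.lift_apply_of]
    simp only [attachGen, unop_comp, Category.assoc]
  · have h2 : ¬ Function.Surjective ((θ ≫ η).unop ≫ σ).toOrderHom := by
      intro h3
      apply h
      intro y
      obtain ⟨x, hx⟩ := h3 y
      exact ⟨η.unop.toOrderHom x, hx⟩
    rw [attachGen, dif_neg h, attachGen, dif_neg h2, attachMap_inl]
    congr 1
    simp

/-- The simplicial group obtained from `Γ` by freely adjoining a symbol `s` of degree `N` and its degeneracies,
with `∂_i s = ∂_i xt` for all `i`. -/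
def attach : SimplicialObject GrpCat.{0} where
  obj m := GrpCat.of (AttachGroup Γ N m)
  map θ := GrpCat.ofHom (attachMap xt θ)
  map_id m := by
    refine GrpCat.hom_ext (Monoid.Coprod.hom_ext ?_ (FreeGroup.ext_hom _ _ fun σ => ?_))
    · ext y
      simp [attachMap]
    · have h : Function.Surjective (((𝟙 m : m ⟶ m).unop ≫ σ.1).toOrderHom) := by
        simpa using σ.2
      have e : (⟨(𝟙 m : m ⟶ m).unop ≫ σ.1, h⟩ : Surj N m) = σ := Subtype.ext (by simp)
      change FreeGroup.lift (fun σ => attachGen xt (𝟙 m) σ.1) (FreeGroup.of σ) = _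
      rw [FreeGroup.lift_apply_of, attachGen, dif_pos h, e]
      rfl
  map_comp θ η := by
    refine GrpCat.hom_ext (Monoid.Coprod.hom_ext ?_ (FreeGroup.ext_hom _ _ fun σ => ?_))
    · ext y
      simp [attachMap]
    · change FreeGroup.lift (fun σ => attachGen xt (θ ≫ η) σ.1) (FreeGroup.of σ) =
        attachMap xt η (FreeGroup.lift (fun σ => attachGen xt θ σ.1) (FreeGroup.of σ))
      rw [FreeGroup.lift_apply_of, FreeGroup.lift_apply_of, attachMap_gen]


/-- The map that is the identity on `Γ` and sends the symbol `s` to `xt`. -/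
def attachToBase : attach xt ⟶ Γ where
  app m := GrpCat.ofHom (Monoid.Coprod.lift (MonoidHom.id (Γ.obj m))
    (FreeGroup.lift fun σ => Γ.map σ.1.op xt))
  naturality m k θ := by
    refine GrpCat.hom_ext (Monoid.Coprod.hom_ext ?_ (FreeGroup.ext_hom _ _ fun σ => ?_))
    · rfl
    · change Monoid.Coprod.lift (MonoidHom.id (Γ.obj k)) (FreeGroup.lift fun σ => Γ.map σ.1.op xt)
        (FreeGroup.lift (fun σ => attachGen xt θ σ.1) (FreeGroup.of σ)) =
        Γ.map θ (FreeGroup.lift (fun σ : Surj N m => Γ.map σ.1.op xt) (FreeGroup.of σ))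
      rw [FreeGroup.lift_apply_of, FreeGroup.lift_apply_of]
      by_cases h : Function.Surjective (θ.unop ≫ σ.1).toOrderHom
      · rw [attachGen, dif_pos h, Monoid.Coprod.lift_apply_inr, FreeGroup.lift_apply_of]
        simp
      · rw [attachGen, dif_neg h, Monoid.Coprod.lift_apply_inl]
        simp
end Attach

/-- The product `∂_0(xt) ∂_1(xt)⁻¹ ∂_2(xt) ⋯` in `Γ_{N-1}`. -/
def altFaceProd (Γ : SimplicialObject GrpCat.{0}) (N : ℕ) (xt : Γ _⦋N⦌) : Γ _⦋N - 1⦌ :=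
  match N, xt with
  | 0, _ => 1
  | m + 1, xt => (List.ofFn fun i : Fin (m + 2) => (Γ.δ i xt) ^ ((-1 : ℤ) ^ (i : ℕ))).prod

section Local
variable (Γ : SimplicialObject GrpCat.{0}) (X : ∀ m : SimplexCategoryᵒᵖ, Set (Γ.obj m))
  (N : ℕ) (xt : Γ _⦋N⦌) (W : Set (Γ _⦋N - 1⦌))

/-- The generators of the local group in degree `m`: those of `Γ` selected by `LocalGen` and, if `2 ≤ N`, the
degeneracies of the symbol `s`. -/
def localSet (m : SimplexCategoryᵒᵖ) : Set (AttachGroup Γ N m) :=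
  {g | (∃ y, LocalGen Γ X N xt W m y ∧ g = Monoid.Coprod.inl y) ∨
    (2 ≤ N ∧ ∃ σ : Surj N m, g = Monoid.Coprod.inr (FreeGroup.of σ))}

/-- The group generated by `localSet`. -/
def localSubgroup (m : SimplexCategoryᵒᵖ) : Subgroup (AttachGroup Γ N m) :=
  Subgroup.closure (localSet Γ X N xt W m)

variable {Γ X}

theorem inl_mem_localSubgroup
    (hX : ∀ m, Function.Surjective (FreeGroup.lift (Subtype.val : X m → Γ.obj m)))
    {m : SimplexCategoryᵒᵖ} (g : Γ.obj m)
    (hg : ∀ y, Occurs (X m) g y → LocalGen Γ X N xt W m y) :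
    (Monoid.Coprod.inl g : AttachGroup Γ N m) ∈ localSubgroup Γ X N xt W m := by
  have h : Subgroup.closure {y | Occurs (X m) g y} ≤
      (localSubgroup Γ X N xt W m).comap Monoid.Coprod.inl := by
    rw [Subgroup.closure_le]
    intro y hy
    exact Subgroup.subset_closure (Or.inl ⟨y, hg y hy, rfl⟩)
  exact h (mem_closure_occurs _ (hX m) g)

theorem localSubgroup_map
    (hX : ∀ m, Function.Surjective (FreeGroup.lift (Subtype.val : X m → Γ.obj m)))
    {m k : SimplexCategoryᵒᵖ} (θ : m ⟶ k) :
    localSubgroup Γ X N xt W m ≤ (localSubgroup Γ X N xt W k).comap (attachMap xt θ) := by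
  rw [localSubgroup, Subgroup.closure_le]
  rintro _ (⟨y, hy, rfl⟩ | ⟨hN, σ, rfl⟩)
  · exact inl_mem_localSubgroup N xt W hX _ fun z hz => LocalGen.oper θ y z hy hz
  · change attachMap xt θ (Monoid.Coprod.inr (FreeGroup.of σ)) ∈ localSubgroup Γ X N xt W k
    simp only [attachMap, Monoid.Coprod.lift_apply_inr, FreeGroup.lift_apply_of]
    by_cases h : Function.Surjective (θ.unop ≫ σ.1).toOrderHom
    · rw [attachGen, dif_pos h]
      exact Subgroup.subset_closure (Or.inr ⟨hN, _, rfl⟩)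
    · rw [attachGen, dif_neg h]
      exact inl_mem_localSubgroup N xt W hX _ fun z hz => LocalGen.bdry _ z hN h hz
end Local

namespace FreeResolution
variable {A : SimplicialObject.Augmented GrpCat.{0}} (R : FreeResolution A) {N : ℕ}
  (xt : A.left _⦋N⦌) (W : Set (A.left _⦋N - 1⦌))

theorem surj_gens (m) : Function.Surjective (FreeGroup.lift (Subtype.val : R.gens m → A.left.obj m)) :=
  (R.isBasis.1 m).2

/-- The local simplicial group `Γ(xt)`: the free simplicial group on `localSet`. -/
def localGroup : SimplicialObject GrpCat.{0} where
  obj m := GrpCat.of (localSubgroup A.left R.gens N xt W m)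
  map {m k} θ := GrpCat.ofHom (((attachMap xt θ).comp (Subgroup.subtype _)).codRestrict _
    fun g => localSubgroup_map N xt W R.surj_gens θ g.2)
  map_id m := by
    refine GrpCat.hom_ext (MonoidHom.ext fun g => Subtype.ext ?_)
    exact ConcreteCategory.congr_hom ((attach xt).map_id m) g.1
  map_comp θ η := by
    refine GrpCat.hom_ext (MonoidHom.ext fun g => Subtype.ext ?_)
    exact ConcreteCategory.congr_hom ((attach xt).map_comp θ η) g.1

/-- The canonical map `Γ(xt) → Γ`, the identity on the generators from `Γ`, with `s ↦ xt`. -/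
def incl : R.localGroup xt W ⟶ A.left where
  app m := GrpCat.ofHom (((attachToBase xt).app m).hom.comp (Subgroup.subtype _))
  naturality m k θ := by
    ext g
    exact ConcreteCategory.congr_hom ((attachToBase xt).naturality θ) g.1

/-- `Γ(xt)`, augmented over `π`. -/
def localAug : SimplicialObject.Augmented GrpCat.{0} where
  left := R.localGroup xt W
  right := A.right
  hom := R.incl xt W ≫ A.hom

/-- The canonical map of augmented simplicial groups. -/
def inclAug : R.localAug xt W ⟶ A where
  left := R.incl xt W
  right := 𝟙 A.right

/-- The generators of `Γ(xt)`. -/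
def localGens (m : SimplexCategoryᵒᵖ) : Set ((R.localGroup xt W).obj m) :=
  {g | g.1 ∈ localSet A.left R.gens N xt W m}

theorem inl_mem_of_lt_two (hN : N < 2) :
    (Monoid.Coprod.inl xt : AttachGroup A.left N (op ⦋N⦌)) ∈
      localSubgroup A.left R.gens N xt W (op ⦋N⦌) := by
  refine inl_mem_localSubgroup N xt W R.surj_gens xt fun y hy => ?_
  obtain ⟨_, _, hy, _⟩ := hy
  interval_cases N
  · exact LocalGen.zero y hy
  · exact LocalGen.one y hy

/-- The element of `Γ(xt)_N` that corresponds to `xt`: the symbol `s` if `2 ≤ N`, and `xt` itself otherwise. -/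
def fund : (R.localGroup xt W).obj (op ⦋N⦌) :=
  if hN : 2 ≤ N then
    ⟨Monoid.Coprod.inr (FreeGroup.of ⟨𝟙 _, fun y => ⟨y, by simp⟩⟩),
      Subgroup.subset_closure (Or.inr ⟨hN, _, rfl⟩)⟩
  else ⟨Monoid.Coprod.inl xt, R.inl_mem_of_lt_two xt W (by omega)⟩
end FreeResolution


section Homology
variable (R : Type) [CommRing R]

/-- The bicomplex of a simplicial group `Γ` and a functor `F` from groups to chain complexes: `F(Γ_q)_p`, with
the alternating sum of the faces as simplicial differential. -/
def bic {R : Type} [CommRing R] (F : GrpCat.{0} ⥤ ChainComplex (ModuleCat.{0} R) ℕ)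
    (Γ : SimplicialObject GrpCat.{0}) : Bicomplex R :=
  (AlgebraicTopology.alternatingFaceMapComplex _).obj
    (((SimplicialObject.whiskering _ _).obj F).obj Γ)

theorem bic_dh {R : Type} [CommRing R] (F : GrpCat.{0} ⥤ ChainComplex (ModuleCat.{0} R) ℕ)
    (Γ : SimplicialObject GrpCat.{0}) (p q : ℕ) (c : (F.obj (Γ _⦋q + 1⦌)).X p) :
    (bic F Γ).dh p q c =
      ∑ i : Fin (q + 2), (-1 : ℤ) ^ (i : ℕ) • ((F.map (Γ.δ i)).f p).hom c :=
  let S := ((SimplicialObject.whiskering _ _).obj F).obj Γ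
  let ev : (F.obj (Γ _⦋q + 1⦌) ⟶ F.obj (Γ _⦋q⦌)) →+ (F.obj (Γ _⦋q⦌)).X p :=
    AddMonoidHom.mk' (fun φ => (φ.f p).hom c) fun _ _ => rfl
  (congrArg ev (AlgebraicTopology.alternatingFaceMapComplex_obj_d S q)).trans
    ((map_sum ev _ _).trans (Finset.sum_congr rfl fun i _ => map_zsmul ev _ (F.map (Γ.δ i))))

/-- The map of bicomplexes induced by a map of simplicial groups. -/
def bicMap {R : Type} [CommRing R] (F : GrpCat.{0} ⥤ ChainComplex (ModuleCat.{0} R) ℕ)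
    {Γ Γ' : SimplicialObject GrpCat.{0}} (φ : Γ ⟶ Γ') :
    Bicomplex.Morphism (bic F Γ) (bic F Γ') :=
  .ofHom ((AlgebraicTopology.alternatingFaceMapComplex _).map
    (((SimplicialObject.whiskering _ _).obj F).map φ))

/-- The map of bicomplexes induced by a natural transformation. -/
def bicNat {R : Type} [CommRing R] {F F' : GrpCat.{0} ⥤ ChainComplex (ModuleCat.{0} R) ℕ}
    (α : F ⟶ F') (Γ : SimplicialObject GrpCat.{0}) :
    Bicomplex.Morphism (bic F Γ) (bic F' Γ) :=
  .ofHom ((AlgebraicTopology.alternatingFaceMapComplex _).map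
    (((SimplicialObject.whiskering _ _).map α).app Γ))

/-- The inclusion of coefficients on chains. -/
def complexifyHom (S : Type) : (S →₀ ℤ) →+ (S →₀ ℂ) :=
  Finsupp.mapRange.addMonoidHom (Int.castAddHom ℂ)

theorem complexifyHom_single (S : Type) (s : S) (a : ℤ) :
    complexifyHom S (Finsupp.single s a) = Finsupp.single s (a : ℂ) := by
  simp [complexifyHom]

theorem complexify_dv {G : GrpCat.{0}} (p : ℕ) (c : (Fin (p + 1) → G) →₀ ℤ) :
    complexifyHom _ (((Cyclic.bar ℤ).obj G).d (p + 1) p c) =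
      ((Cyclic.bar ℂ).obj G).d (p + 1) p (complexifyHom _ c) := by
  let u : ((Fin (p + 1) → G) →₀ ℤ) →+ ((Fin p → G) →₀ ℂ) :=
    (complexifyHom _).comp (((Cyclic.bar ℤ).obj G).d (p + 1) p).hom.toAddMonoidHom
  let v : ((Fin (p + 1) → G) →₀ ℤ) →+ ((Fin p → G) →₀ ℂ) :=
    AddMonoidHom.comp (((Cyclic.bar ℂ).obj G).d (p + 1) p).hom.toAddMonoidHom (complexifyHom _)
  suffices h : u = v from DFunLike.congr_fun h c
  refine Finsupp.addHom_ext fun g a => ?_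
  refine (congrArg (complexifyHom _) (Cyclic.bar_d_single ℤ p g a)).trans ?_
  refine Eq.trans ?_ (congrArg (((Cyclic.bar ℂ).obj G).d (p + 1) p)
    (complexifyHom_single _ g a)).symm
  refine Eq.trans ?_ (Cyclic.bar_d_single ℂ p g (a : ℂ)).symm
  simp only [map_add, map_sum, Finsupp.smul_single, smul_eq_mul, complexifyHom_single,
    Int.cast_mul, Int.cast_pow, Int.cast_neg, Int.cast_one]

theorem complexify_map {G H : GrpCat.{0}} (f : G ⟶ H) (p : ℕ) (c : (Fin p → G) →₀ ℤ) :
    complexifyHom _ (((Cyclic.bar ℤ).map f).f p c) =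
      ((Cyclic.bar ℂ).map f).f p (complexifyHom _ c) := by
  let u : ((Fin p → G) →₀ ℤ) →+ ((Fin p → H) →₀ ℂ) :=
    (complexifyHom _).comp (((Cyclic.bar ℤ).map f).f p).hom.toAddMonoidHom
  let v : ((Fin p → G) →₀ ℤ) →+ ((Fin p → H) →₀ ℂ) :=
    AddMonoidHom.comp (((Cyclic.bar ℂ).map f).f p).hom.toAddMonoidHom (complexifyHom _)
  suffices h : u = v from DFunLike.congr_fun h c
  refine Finsupp.addHom_ext fun g a => ?_
  refine (congrArg (complexifyHom _) (Cyclic.barMap_single ℤ f.hom p g a)).trans ?_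
  refine Eq.trans ?_ (congrArg (((Cyclic.bar ℂ).map f).f p) (complexifyHom_single _ g a)).symm
  refine Eq.trans ?_ (Cyclic.barMap_single ℂ f.hom p g a).symm
  exact complexifyHom_single _ _ _

/-- The inclusion of coefficients, from integral to complex bar bicomplexes. -/
def complexify (Γ : SimplicialObject GrpCat.{0}) :
    Bicomplex.Morphism (bic (Cyclic.bar ℤ) Γ) (bic (Cyclic.bar ℂ) Γ) where
  toFun p q := complexifyHom (Fin p → Γ _⦋q⦌)
  map_dv p q c := complexify_dv p c
  map_dh p q c := by
    refine (congrArg (complexifyHom _) (bic_dh (Cyclic.bar ℤ) Γ p q c)).trans ?_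
    refine Eq.trans ?_ (bic_dh (Cyclic.bar ℂ) Γ p q (complexifyHom _ c)).symm
    refine (map_sum (complexifyHom _) _ _).trans (Finset.sum_congr rfl fun i _ => ?_)
    refine (map_zsmul (complexifyHom _) _ _).trans ?_
    exact congrArg _ (complexify_map _ p c)

variable (A : SimplicialObject.Augmented GrpCat.{0})

theorem aug_dh (p : ℕ) (c : ((Cyclic.bar R).obj (A.left _⦋1⦌)).X p) :
    (((Cyclic.bar R).map (augmentation A)).f p).hom ((bic (Cyclic.bar R) A.left).dh p 0 c) = 0 := by
  have h : A.left.δ 0 ≫ augmentation A = A.left.δ 1 ≫ augmentation A :=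
    (A.hom.naturality (SimplexCategory.δ 0).op).trans
      (A.hom.naturality (SimplexCategory.δ 1).op).symm
  have key : ∀ i : Fin 2, (((Cyclic.bar R).map (augmentation A)).f p).hom
      ((((Cyclic.bar R).map (A.left.δ i)).f p).hom c) =
      (((Cyclic.bar R).map (A.left.δ 0 ≫ augmentation A)).f p).hom c := by
    intro i
    have hi : A.left.δ 0 ≫ augmentation A = A.left.δ i ≫ augmentation A := by
      fin_cases i
      · rfl
      · exact h
    rw [hi, Functor.map_comp]
    rfl
  refine (congrArg (((Cyclic.bar R).map (augmentation A)).f p).hom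
    (bic_dh (Cyclic.bar R) A.left p 0 c)).trans ?_
  rw [map_sum]
  simp only [map_zsmul, key]
  simp

/-- The chain map induced by the augmentation, which only sees simplicial degree `0`. -/
def augLin (p : ℕ) : (bic (Cyclic.bar R) A.left).Tot →ₗ[R] ((Cyclic.bar R).obj A.right).X p :=
  (((Cyclic.bar R).map (augmentation A)).f p).hom ∘ₗ (bic (Cyclic.bar R) A.left).comp p 0

theorem augLin_totD (p : ℕ) (t : (bic (Cyclic.bar R) A.left).Tot) :
    augLin R A p ((bic (Cyclic.bar R) A.left).totD t) =
      (((Cyclic.bar R).obj A.right).d (p + 1) p).hom (augLin R A (p + 1) t) := by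
  refine (map_add (((Cyclic.bar R).map (augmentation A)).f p).hom
    ((bic (Cyclic.bar R) A.left).dv p 0 (t (p + 1) 0))
    ((-1 : R) ^ p • (bic (Cyclic.bar R) A.left).dh p 0 (t p 1))).trans ?_
  refine (congrArg (_ + ·) ((LinearMap.map_smul (((Cyclic.bar R).map (augmentation A)).f p).hom
    ((-1 : R) ^ p) _).trans ((congrArg _ (aug_dh R A p (t p 1))).trans (smul_zero _)))).trans ?_
  refine (add_zero _).trans ?_
  exact (ConcreteCategory.congr_hom
    (((Cyclic.bar R).map (augmentation A)).comm (p + 1) p) (t (p + 1) 0)).symm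

/-- The map induced by the augmentation on cycles. -/
def augCycles (n : ℕ) : ModuleCat.of R ((bic (Cyclic.bar R) A.left).cycles (n + 1)) ⟶
    groupHomology.cycles (Rep.trivial R A.right R) (n + 1) :=
  HomologicalComplex.liftCycles _
    (ModuleCat.ofHom (augLin R A (n + 1) ∘ₗ Submodule.subtype _)) n (by simp) (by
      refine ModuleCat.hom_ext (LinearMap.ext fun t => ?_)
      refine (augLin_totD R A n t.1).symm.trans ?_
      rw [LinearMap.mem_ker.1 t.2.2, map_zero]
      rfl)

theorem augCycles_i (n : ℕ) (z : (bic (Cyclic.bar R) A.left).cycles (n + 1)) :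
    groupHomology.iCycles _ (n + 1) (augCycles R A n z) = augLin R A (n + 1) z.1 :=
  congrArg (fun f => f.hom z) (HomologicalComplex.liftCycles_i
    (groupHomology.inhomogeneousChains (Rep.trivial R A.right R))
    (ModuleCat.ofHom (augLin R A (n + 1) ∘ₗ
      Submodule.subtype ((bic (Cyclic.bar R) A.left).cycles (n + 1)))) n _ _)

/-- The map `H_{n+1}(BΓ; R) → H_{n+1}(Bπ; R)` induced by the augmentation. -/
def augH (n : ℕ) : (bic (Cyclic.bar R) A.left).H (n + 1) →ₗ[R]
    groupHomology (Rep.trivial R A.right R) (n + 1) :=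
  Submodule.liftQ _ (augCycles R A n ≫ groupHomology.π _ (n + 1)).hom (by
    rintro ⟨_, hz⟩ ⟨w, hw, rfl⟩
    have e : augCycles R A n ⟨_, hz⟩ = groupHomology.toCycles _ (n + 2) (n + 1)
        (augLin R A (n + 2) w) := by
      refine (ModuleCat.mono_iff_injective (groupHomology.iCycles _ (n + 1))).1 inferInstance ?_
      refine (augCycles_i R A n ⟨_, hz⟩).trans ?_
      refine (augLin_totD R A (n + 1) w).trans ?_
      exact (ConcreteCategory.congr_hom (HomologicalComplex.toCycles_i _ _ _)
        (augLin R A (n + 2) w)).symm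
    refine (congrArg (groupHomology.π (Rep.trivial R A.right R) (n + 1)) e).trans ?_
    exact ConcreteCategory.congr_hom (HomologicalComplex.toCycles_comp_homologyπ _ _ _)
      (augLin R A (n + 2) w))

end Homology

section Final

/-- The homology `H_n(BΓ; R)` of the classifying space of a simplicial group. -/
abbrev barHomology (R : Type) [CommRing R] (Γ : SimplicialObject GrpCat.{0}) (n : ℕ) : Type :=
  (bic (Cyclic.bar R) Γ).H n

/-- The cohomology `H^n(BΓ; R)` of the classifying space of a simplicial group. -/
abbrev barCohomology (R : Type) [CommRing R] (Γ : SimplicialObject GrpCat.{0}) (n : ℕ) : Type :=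
  (bic (Cyclic.bar R) Γ).CoH n

/-- The bicomplex whose total homology is the cyclic homology `HC_*(ℂ[Γ])` of the simplicial algebra `ℂ[Γ]`
and whose spectral sequence has `E^1_{p,q} = HC_p(ℂ[Γ_q])`; dually for cyclic cohomology. -/
abbrev cyclicBicomplex (Γ : SimplicialObject GrpCat.{0}) : Bicomplex ℂ :=
  bic Cyclic.functor Γ

/-- The map induced on `H_n(BΓ; R)` by a map of simplicial groups. -/
def barHomologyMap (R : Type) [CommRing R] {Γ Γ' : SimplicialObject GrpCat.{0}} (φ : Γ ⟶ Γ')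
    (n : ℕ) : barHomology R Γ n →+ barHomology R Γ' n :=
  (bicMap (Cyclic.bar R) φ).map n

/-- The map `H_n(BΓ; ℤ) → H_n(BΓ; ℂ)`. -/
def complexifyH (Γ : SimplicialObject GrpCat.{0}) (n : ℕ) :
    barHomology ℤ Γ n →+ barHomology ℂ Γ n :=
  (complexify Γ).map n

/-- The map `H_n(BΓ; ℂ) → HC_n(ℂ[Γ])`. -/
def barToCyclicH (Γ : SimplicialObject GrpCat.{0}) (n : ℕ) :
    barHomology ℂ Γ n →+ (cyclicBicomplex Γ).H n :=
  (bicNat Cyclic.barToCyclic Γ).map n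

/-- The bar chain `[g]`, which represents the class of `g` in `H_1(BΓ_q; R)`. -/
def barSymbol (R : Type) [CommRing R] (Γ : SimplicialObject GrpCat.{0}) {q : ℕ} (g : Γ _⦋q⦌) :
    ((bic (Cyclic.bar R) Γ).X q).X 1 :=
  (Finsupp.single (fun _ : Fin 1 => g) 1 : (Fin 1 → Γ _⦋q⦌) →₀ R)

/-- The Connes chain `g⁻¹ ⊗ g`, the image of the class of `g` in `HC_1(ℂ[Γ_q])`. -/
def cyclicSymbol (Γ : SimplicialObject GrpCat.{0}) {q : ℕ} (g : Γ _⦋q⦌) :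
    ((cyclicBicomplex Γ).X q).X 1 :=
  Cyclic.barToCyclicLin (Γ _⦋q⦌) 1 (Finsupp.single (fun _ : Fin 1 => g) 1)

/-- The element `xt` of `Γ_N` is a lift of the class `x` of degree `N + 1`: the class of `xt` in `H_1(BΓ_N; ℤ)` is
a cycle representing a class `ξ` in `H_{N+1}(BΓ; ℤ)` whose image in `H_{N+1}(Bπ; ℂ)` is `x`. In particular `x` is
an integral class. -/
def IsLift (A : SimplicialObject.Augmented GrpCat.{0}) {N : ℕ}
    (x : groupHomology (Rep.trivial ℂ A.right ℂ) (N + 1)) (xt : A.left _⦋N⦌) : Prop :=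
  ∃ ξ : barHomology ℤ A.left (N + 1),
    (bic (Cyclic.bar ℤ) A.left).Detects (N + 1) (barSymbol ℤ A.left xt) ξ ∧
      augH ℂ A N (complexifyH A.left (N + 1) ξ) = x

/-- A finite set `W` of generators in degree `N - 1` such that the alternating face product of `xt` is a
product of commutators of words in `W`. -/
structure FreeResolution.IsCommutatorSupport {A : SimplicialObject.Augmented GrpCat.{0}}
    (R : FreeResolution A) {N : ℕ} (xt : A.left _⦋N⦌) (W : Set (A.left _⦋N - 1⦌)) : Prop where
  subset : W ⊆ R.gens (op ⦋N - 1⦌)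
  finite : W.Finite
  mem : altFaceProd A.left N xt ∈ ⁅Subgroup.closure W, Subgroup.closure W⁆

end Final

end LocalClass
end
open CategoryTheory Simplicial Opposite LocalClass

/-!
The local group `Λ = Γ(xt)` is free in each degree, and both spectral sequences are controlled by its generators.

*Homology.* The bar complex of a free group has homology only in degrees `0` and `1`, with an explicit contraction
(`exists_contraction`), and the row of degree `0` of the bar bicomplex contributes only in total degree `0`
(`Bicomplex.BarLike`, `barLike`). Hence the homology of `BΛ` in positive degrees is that of the simplicial abelian group
`H_1(BΛ_q; ℤ)`, shifted by one (`exists_cycle_of_altFace`, `mem_boundaries_of_class_eq`). The alternating face product of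
the symbol `s` is a product of commutators already in `Λ` (`FreeResolution.altFace_fund`); this gives the fundamental
class. If `N ≥ 2`, all generators of `Λ_N` except `s`, and all generators of `Λ_{N+1}`, are degenerate, because every
generator of `Λ` which comes from `Γ` is a degeneracy of one of degree `< N` (`LocalGen.exists_core`, which also yields
finiteness). By the normalization theorem (`exists_altFace_eq`, `exists_comp_altFace_eq`) the homology and cohomology in
degree `N + 1` are then infinite cyclic, and the exponent sum of `s` is the dual class.

*Injectivity.* If `x ≠ 0`, then some nondegenerate generator of `Γ_N` occurs in `xt` with nonzero exponent sum; otherwise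
the class of `xt` would be degenerate, hence a boundary (`FreeResolution.exists_nondeg_coord_ne_zero`). Therefore the
images in the abelianization of `Γ_m` of the generators of `Λ_m` are linearly independent over `ℤ`. A homomorphism from a
free group of finite rank to a free group with this property is injective (`freeGroup_injective_of_linearIndependent`):
its image is free by the Nielsen–Schreier theorem, and of the same rank as the source, because the source and the image
have the same abelianization; and free groups of finite rank are Hopfian (`freeGroup_injective_of_surjective`).

*Cyclic cohomology.* Since the bar class of `s` only maps to a cyclic class, nonvanishing on the cyclic side needs a
cyclic cocycle on `ℂ[Λ_N]` that is also closed under the alternating sum of the faces. Cyclic cochains on a group algebra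
are modelled by homogeneous cochains `u(m; x_0, …, x_p)` invariant under conjugation and under multiplication of one
`x_i` by `m` (`conjCochains`). For a free group this complex is exact in degrees `≥ 2`: over `m = 1` it is the bar
complex, and over `m ≠ 1` one averages over the finite group `Z(m)/⟨m⟩` (`exists_homogDiff_eq`,
`finite_centralizer_quotient`). A cocycle on `π` that detects `x` restricts to the elements `m` over `1 ∈ π` in simplicial
degree `0` (`startCochain`), and a zigzag moves it to bidegree `(1, N)` without changing its values on cycles
(`exists_zigzag`). The result, evaluated on `g⁻¹ ⊗ g`, is a homomorphism from `Λ_N` to `ℂ` that does not vanish at `s`. It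
is made integral by a projection `ℂ → ℚ` and a common denominator (`exists_integral_cocycle_of_finite`) or, if `N ≥ 2`,
by a coboundary that turns it into the exponent sum of `s` (`exists_integral_cocycle_of_generates`). The statements about
`E^∞` follow by pairing cocycles with cycles (`Bicomplex.eInf_mk_ne_zero`, `Bicomplex.coEInf_mk_ne_zero`).
-/

namespace LocalClass
noncomputable section

/-! ### Free groups -/

section FreeGroups

/-- Left multiplication by `a`, restricted to the elements of a finite set which it does not move out of the set,
extends to a permutation of the finite set. -/
theorem exists_perm_extending_mul {G : Type} [Group G] (V : Finset G) (a : G) :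
    ∃ σ : Equiv.Perm V, ∀ v w : V, a * v = w → σ v = w := by
  classical
  let e : {v : V // a * v ∈ V} ≃ {v : V // a⁻¹ * v ∈ V} :=
    { toFun := fun v => ⟨⟨a * v.1, v.2⟩, by simp⟩
      invFun := fun v => ⟨⟨a⁻¹ * v.1, v.2⟩, by simp⟩
      left_inv := fun v => by simp
      right_inv := fun v => by simp }
  refine ⟨e.extendSubtype, fun v w h => ?_⟩
  have hv : a * (v : G) ∈ V := h ▸ w.2
  rw [Equiv.extendSubtype_apply_of_mem e v hv]
  exact Subtype.ext h

/-- Free groups are residually finite. The reduced word of `w` is traced by a permutation action on the finite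
set of its suffixes. -/
theorem exists_finite_quotient {S : Type} (w : FreeGroup S) (hw : w ≠ 1) :
    ∃ (V : Type) (_ : Fintype V) (ρ : FreeGroup S →* Equiv.Perm V), ρ w ≠ 1 := by
  classical
  let V : Finset (FreeGroup S) := w.toWord.tails.toFinset.image FreeGroup.mk
  have hV : ∀ L, L <:+ w.toWord → FreeGroup.mk L ∈ V := fun L hL =>
    Finset.mem_image.2 ⟨L, by simpa using hL, rfl⟩
  choose σ hσ using exists_perm_extending_mul V
  let ρ : FreeGroup S →* Equiv.Perm V := FreeGroup.lift fun a => σ (FreeGroup.of a)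
  have key : ∀ L (hL : L <:+ w.toWord),
      ρ (FreeGroup.mk L) ⟨1, hV [] (List.nil_suffix)⟩ = ⟨FreeGroup.mk L, hV L hL⟩ := by
    intro L
    induction L with
    | nil => intro _; rfl
    | cons x L ih =>
      intro hL
      have hL' : L <:+ w.toWord := (List.suffix_cons x L).trans hL
      have h1 : (FreeGroup.mk (x :: L) : FreeGroup S) = FreeGroup.mk [x] * FreeGroup.mk L := by
        rw [FreeGroup.mul_mk]; rfl
      refine (congrArg (fun g => ρ g _) h1).trans ?_
      rw [map_mul, Equiv.Perm.mul_apply, ih hL']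
      obtain ⟨a, _ | _⟩ := x
      · have h2 : (FreeGroup.mk [(a, false)] : FreeGroup S) = (FreeGroup.of a)⁻¹ := rfl
        rw [h2, map_inv, Equiv.Perm.inv_eq_iff_eq]
        simp only [ρ, FreeGroup.lift_apply_of]
        exact (hσ (FreeGroup.of a) _ _ (by simp only [h1, h2, mul_inv_cancel_left])).symm
      · have h2 : (FreeGroup.mk [(a, true)] : FreeGroup S) = FreeGroup.of a := rfl
        rw [h2]
        simp only [ρ, FreeGroup.lift_apply_of]
        exact hσ (FreeGroup.of a) _ _ rfl
  refine ⟨V, inferInstance, ρ, fun h => hw ?_⟩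
  have := congrArg Subtype.val (key w.toWord List.suffix_rfl)
  simp only [FreeGroup.mk_toWord, h] at this
  exact this.symm

/-- A free group of finite rank is Hopfian: the endomorphism permutes the finite set of homomorphisms to any given
finite group. -/
theorem freeGroup_injective_of_surjective {S : Type} [Finite S] (φ : FreeGroup S →* FreeGroup S)
    (hφ : Function.Surjective φ) : Function.Injective φ := by
  refine (injective_iff_map_eq_one φ).2 fun w hw => ?_
  by_contra h
  obtain ⟨V, _, ρ, hρ⟩ := exists_finite_quotient w h
  classical
  have : Finite (FreeGroup S →* Equiv.Perm V) := .of_equiv _ FreeGroup.lift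
  have hi : Function.Injective fun ψ : FreeGroup S →* Equiv.Perm V => ψ.comp φ :=
    fun a b hab => MonoidHom.cancel_right hφ |>.1 hab
  obtain ⟨ψ, hψ⟩ := (Finite.injective_iff_surjective.1 hi) ρ
  exact hρ (by rw [← hψ]; simp [hw])

/-- The exponent sum of the letters of a word, as a vector indexed by the letters. -/
def expSum (T : Type) : FreeGroup T →* Multiplicative (T →₀ ℤ) :=
  FreeGroup.lift fun a => Multiplicative.ofAdd (Finsupp.single a 1)

/-- A homomorphism of free groups of which the source has finite rank is injective if it is injective on
abelianizations: the image is free, it has the same rank as the source, and free groups of finite rank are Hopfian. -/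
theorem freeGroup_injective_of_linearIndependent {S T : Type} [Finite S]
    (φ : FreeGroup S →* FreeGroup T)
    (h : LinearIndependent ℤ fun s => (expSum T (φ (FreeGroup.of s))).toAdd) :
    Function.Injective φ := by
  classical
  let H := φ.range
  let e := (IsFreeGroup.basis H).repr
  let B := IsFreeGroup.Generators H
  let ψ : FreeGroup S →* FreeGroup B := e.toMonoidHom.comp φ.rangeRestrict
  have hψ : Function.Surjective ψ := e.surjective.comp φ.rangeRestrict_surjective
  let j : FreeGroup B →* FreeGroup T := H.subtype.comp e.symm.toMonoidHom
  have hj : ∀ w, j (ψ w) = φ w := fun w => by simp [j, ψ]; rfl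
  -- the maps on abelianizations
  let p : (S →₀ ℤ) →ₗ[ℤ] (B →₀ ℤ) := Finsupp.linearCombination ℤ fun s =>
    (expSum B (ψ (FreeGroup.of s))).toAdd
  let q : (B →₀ ℤ) →ₗ[ℤ] (T →₀ ℤ) := Finsupp.linearCombination ℤ fun b =>
    (expSum T (j (FreeGroup.of b))).toAdd
  have hp : ∀ w, p (expSum S w).toAdd = (expSum B (ψ w)).toAdd := by
    intro w
    have : (p.toAddMonoidHom.toMultiplicative).comp (expSum S) = (expSum B).comp ψ := by
      refine FreeGroup.ext_hom _ _ fun s => ?_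
      refine Multiplicative.toAdd.injective ?_
      simp [expSum, p]
    exact congrArg Multiplicative.toAdd (DFunLike.congr_fun this w)
  have hq : ∀ w, q (expSum B w).toAdd = (expSum T (j w)).toAdd := by
    intro w
    have : (q.toAddMonoidHom.toMultiplicative).comp (expSum B) = (expSum T).comp j := by
      refine FreeGroup.ext_hom _ _ fun s => ?_
      refine Multiplicative.toAdd.injective ?_
      simp [expSum, q]
    exact congrArg Multiplicative.toAdd (DFunLike.congr_fun this w)
  have hpi : Function.Injective p := by
    have : q.comp p = Finsupp.linearCombination ℤ fun s =>
        (expSum T (φ (FreeGroup.of s))).toAdd := by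
      refine Finsupp.lhom_ext' fun s => LinearMap.ext_ring ?_
      simp only [LinearMap.comp_apply, Finsupp.lsingle_apply, p, Finsupp.linearCombination_single,
        one_smul, hq, hj]
    have h2 : Function.Injective (q.comp p) := this ▸ h
    exact Function.Injective.of_comp (f := q) h2
  have hps : Function.Surjective p := by
    rw [← LinearMap.range_eq_top, ← top_le_iff, ← (Finsupp.basisSingleOne (R := ℤ) (ι := B)).span_eq]
    rw [Submodule.span_le]
    rintro _ ⟨b, rfl⟩
    obtain ⟨w, hw⟩ := hψ (FreeGroup.of b)
    refine ⟨(expSum S w).toAdd, ?_⟩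
    rw [hp, hw]
    simp [expSum]
  let ε : (S →₀ ℤ) ≃ₗ[ℤ] (B →₀ ℤ) := LinearEquiv.ofBijective p ⟨hpi, hps⟩
  have : Module.Finite ℤ (B →₀ ℤ) := Module.Finite.equiv ε
  have hB : Finite B := by
    exact Module.Finite.finite_basis (Finsupp.basisSingleOne (R := ℤ) (ι := B))
  have : Fintype S := Fintype.ofFinite S
  have : Fintype B := Fintype.ofFinite B
  have hc : Fintype.card B = Fintype.card S := by
    have := ε.finrank_eq
    simpa using this.symm
  let r : FreeGroup B ≃* FreeGroup S := FreeGroup.freeGroupCongr (Fintype.equivOfCardEq hc)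
  have h3 : Function.Injective (r.toMonoidHom.comp ψ) :=
    freeGroup_injective_of_surjective _ (r.surjective.comp hψ)
  intro a b hab
  apply h3
  have : φ.rangeRestrict a = φ.rangeRestrict b := Subtype.ext hab
  simp [ψ, this]

/-- The first letter of the word of a central element would have to be every letter that does not cancel it. -/
theorem freeGroup_eq_one_of_commute {B : Type} (hB : Nontrivial B) (w : FreeGroup B)
    (hw : ∀ g, Commute w g) : w = 1 := by
  classical
  by_contra h
  cases hL : w.toWord with
  | nil => exact h (FreeGroup.toWord_eq_nil_iff.1 hL)
  | cons x L =>
    obtain ⟨z, hz⟩ := exists_ne x.1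
    have h1 : (FreeGroup.of z * w).toWord = (z, true) :: x :: L := by
      rw [FreeGroup.toWord_mul, FreeGroup.toWord_of, hL]
      have : FreeGroup.IsReduced ((z, true) :: x :: L) := by
        have h2 : FreeGroup.IsReduced (x :: L) := hL ▸ FreeGroup.isReduced_toWord
        rw [FreeGroup.isReduced_cons_cons]
        exact ⟨fun h => absurd h hz, h2⟩
      exact this.reduce_eq
    have h2 : (FreeGroup.reduce (w.toWord ++ [(z, true)])) = (z, true) :: x :: L := by
      rw [← h1, ← (hw (FreeGroup.of z)).eq, FreeGroup.toWord_mul, FreeGroup.toWord_of]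
    have h3 := (FreeGroup.reduce.red (L := w.toWord ++ [(z, true)])).sublist
    rw [h2, hL] at h3
    have h4 := h3.eq_of_length (by simp)
    simp at h4
    exact hz (by rw [← h4.1])

/-- In a free group, the cyclic group generated by an element `m ≠ 1` has finite index in the centralizer of `m`: the
centralizer is a free group with a nontrivial centre, hence infinite cyclic. -/
theorem finite_centralizer_quotient {G : Type} [Group G] [IsFreeGroup G] (m : G) (hm : m ≠ 1) :
    Finite (Subgroup.centralizer {m} ⧸
      (Subgroup.zpowers m).subgroupOf (Subgroup.centralizer {m})) := by
  let C := Subgroup.centralizer {m}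
  let e := (IsFreeGroup.basis C).repr
  let m' : C := ⟨m, Subgroup.mem_centralizer_singleton_iff.2 rfl⟩
  have hm' : e m' ≠ 1 := by
    intro h
    exact hm (congrArg Subtype.val ((map_eq_one_iff e e.injective).1 h))
  have hc : ∀ g, Commute (e m') g := by
    intro g
    obtain ⟨c, rfl⟩ := e.surjective g
    refine Commute.map (f := e) ?_
    exact Subtype.ext (Subgroup.mem_centralizer_singleton_iff.1 c.2).symm
  rcases subsingleton_or_nontrivial (IsFreeGroup.Generators C) with hB | hB
  swap
  · exact absurd (freeGroup_eq_one_of_commute hB _ hc) hm'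
  rcases isEmpty_or_nonempty (IsFreeGroup.Generators C) with hE | ⟨⟨b⟩⟩
  · exact absurd (Subsingleton.elim _ _) hm'
  -- every element is a power of the single generator
  have hz : ∀ c : C, ∃ j : ℤ, c = e.symm (FreeGroup.of b) ^ j := by
    intro c
    suffices h : e c ∈ Subgroup.zpowers (FreeGroup.of b) by
      obtain ⟨j, hj⟩ := h
      refine ⟨j, e.injective ?_⟩
      rw [← hj]
      simp
    have : (⊤ : Subgroup (FreeGroup (IsFreeGroup.Generators C))) ≤
        Subgroup.zpowers (FreeGroup.of b) := by
      rw [← FreeGroup.closure_range_of, Subgroup.closure_le]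
      rintro _ ⟨b', rfl⟩
      rw [Subsingleton.elim b' b]
      exact Subgroup.mem_zpowers _
    exact this trivial
  obtain ⟨k, hk⟩ := hz m'
  have hk0 : k ≠ 0 := by
    rintro rfl
    rw [zpow_zero] at hk
    exact hm' (by rw [hk, map_one])
  have hpos : 0 < k.natAbs := Int.natAbs_pos.2 hk0
  refine Finite.of_surjective
    (fun j : Fin k.natAbs => (QuotientGroup.mk (e.symm (FreeGroup.of b) ^ (j : ℕ)) :
      C ⧸ (Subgroup.zpowers m).subgroupOf C)) fun q => ?_
  obtain ⟨c, rfl⟩ := QuotientGroup.mk_surjective q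
  obtain ⟨j, rfl⟩ := hz c
  refine ⟨⟨(j % k).toNat, ?_⟩, ?_⟩
  · have := Int.emod_nonneg j hk0
    have := Int.emod_lt_abs j hk0
    rw [Int.abs_eq_natAbs] at this
    omega
  · refine QuotientGroup.eq.2 ?_
    rw [Subgroup.mem_subgroupOf]
    refine ⟨j / k, ?_⟩
    have h1 : (((j % k).toNat : ℕ) : ℤ) = j % k := Int.toNat_of_nonneg (Int.emod_nonneg j hk0)
    have h2 : m' ^ (j / k) =
        (e.symm (FreeGroup.of b) ^ ((j % k).toNat))⁻¹ * e.symm (FreeGroup.of b) ^ j := by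
      rw [hk, ← zpow_natCast, h1, ← zpow_neg, ← zpow_mul, ← zpow_add]
      congr 1
      have := Int.emod_add_mul_ediv j k
      linarith
    exact congrArg Subtype.val h2

section Fox
variable {G : Type} [Group G]

/-- Right multiplication on the second entry of a bar chain of degree `2`. -/
def mulSnd (h : G) : (G × G →₀ ℤ) →+ (G × G →₀ ℤ) :=
  Finsupp.mapDomain.addMonoidHom fun x => (x.1, x.2 * h)

theorem mulSnd_single (h : G) (x : G × G) (n : ℤ) :
    mulSnd h (Finsupp.single x n) = Finsupp.single (x.1, x.2 * h) n := by
  simp [mulSnd]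

theorem mulSnd_one (c : G × G →₀ ℤ) : mulSnd 1 c = c := by
  have : mulSnd (1 : G) = AddMonoidHom.id _ :=
    Finsupp.addHom_ext fun x n => by simp [mulSnd_single]
  exact DFunLike.congr_fun this c

theorem mulSnd_mulSnd (h k : G) (c : G × G →₀ ℤ) : mulSnd k (mulSnd h c) = mulSnd (h * k) c := by
  have : (mulSnd k).comp (mulSnd h) = mulSnd (h * k) :=
    Finsupp.addHom_ext fun x n => by simp [mulSnd_single, mul_assoc]
  exact DFunLike.congr_fun this c

/-- The difference of the two faces of a bar chain of degree `2` that contain the second entry. -/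
def outerFaces : (G × G →₀ ℤ) →+ (G →₀ ℤ) :=
  Finsupp.mapDomain.addMonoidHom Prod.snd - Finsupp.mapDomain.addMonoidHom fun x => x.1 * x.2

theorem outerFaces_single (x : G × G) (n : ℤ) :
    outerFaces (Finsupp.single x n) = Finsupp.single x.2 n - Finsupp.single (x.1 * x.2) n := by
  simp [outerFaces]

/-- Right multiplication on bar chains of degree `1`. -/
def mulRight (h : G) : (G →₀ ℤ) →+ (G →₀ ℤ) := Finsupp.mapDomain.addMonoidHom (· * h)

theorem mulRight_single (h x : G) (n : ℤ) :
    mulRight h (Finsupp.single x n) = Finsupp.single (x * h) n := by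
  simp [mulRight]

theorem outerFaces_mulSnd (h : G) (c : G × G →₀ ℤ) :
    outerFaces (mulSnd h c) = mulRight h (outerFaces c) := by
  have : outerFaces.comp (mulSnd h) = (mulRight h).comp outerFaces :=
    Finsupp.addHom_ext fun x n => by
      simp [mulSnd_single, outerFaces_single, mulRight_single, mul_assoc]
  exact DFunLike.congr_fun this c

/-- A free group acts freely on a tree. The geodesic from `1` to `g` gives a chain `D g`, which is additive for the
concatenation of geodesics and has the difference of the end points as boundary. -/
theorem exists_geodesic_chain [IsFreeGroup G] :
    ∃ D : G → (G × G →₀ ℤ), (∀ g h, D (g * h) = mulSnd h (D g) + D h) ∧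
      ∀ g, outerFaces (D g) = Finsupp.single 1 1 - Finsupp.single g 1 := by
  let act : G →* MulAut (Multiplicative (G × G →₀ ℤ)) :=
    { toFun := fun g => AddEquiv.toMultiplicative
        { toFun := mulSnd g⁻¹
          invFun := mulSnd g
          left_inv := fun c => by
            rw [mulSnd_mulSnd, inv_mul_cancel]
            exact mulSnd_one c
          right_inv := fun c => by
            rw [mulSnd_mulSnd, mul_inv_cancel]
            exact mulSnd_one c
          map_add' := map_add _ }
      map_one' := by
        refine MulEquiv.ext fun c => ?_
        change Multiplicative.ofAdd (mulSnd (1 : G)⁻¹ c.toAdd) = c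
        rw [inv_one, mulSnd_one]
        rfl
      map_mul' := fun g h => by
        refine MulEquiv.ext fun c => ?_
        change Multiplicative.ofAdd (mulSnd (g * h)⁻¹ c.toAdd) =
          Multiplicative.ofAdd (mulSnd g⁻¹ (mulSnd h⁻¹ c.toAdd))
        rw [mulSnd_mulSnd, mul_inv_rev] }
  -- a crossed homomorphism is a section of the semidirect product
  let s : G →* SemidirectProduct (Multiplicative (G × G →₀ ℤ)) G act :=
    IsFreeGroup.lift fun a => ⟨Multiplicative.ofAdd
      (Finsupp.single (IsFreeGroup.of a, (IsFreeGroup.of a)⁻¹) 1), IsFreeGroup.of a⟩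
  have hs : ∀ g, (s g).right = g := by
    intro g
    have : SemidirectProduct.rightHom.comp s = MonoidHom.id G :=
      IsFreeGroup.ext_hom fun a => by simp [s]
    exact DFunLike.congr_fun this g
  let D : G → (G × G →₀ ℤ) := fun g => mulSnd g (s g).left.toAdd
  have hD : ∀ g h, D (g * h) = mulSnd h (D g) + D h := by
    intro g h
    have h1 : (s (g * h)).left.toAdd = (s g).left.toAdd + mulSnd g⁻¹ (s h).left.toAdd := by
      rw [map_mul, SemidirectProduct.mul_left, hs]
      rfl
    simp only [D]
    rw [h1, map_add, mulSnd_mulSnd, mulSnd_mulSnd, inv_mul_cancel_left]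
  refine ⟨D, hD, ?_⟩
  -- the elements for which the boundary formula holds form a subgroup that contains the basis
  let P : Subgroup G :=
    { carrier := {g | outerFaces (D g) = Finsupp.single 1 1 - Finsupp.single g 1}
      mul_mem' := fun {g h} hg hh => by
        change outerFaces (D _) = _
        rw [hD, map_add, outerFaces_mulSnd, show outerFaces (D g) = _ from hg,
          show outerFaces (D h) = _ from hh]
        simp [mulRight_single]
      one_mem' := by
        have : D 1 = 0 := by simp [D]
        simp [this]
      inv_mem' := fun {g} hg => by
        change outerFaces (D _) = _
        have h1 : D 1 = 0 := by simp [D]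
        have h2 := hD g g⁻¹
        rw [mul_inv_cancel, h1] at h2
        rw [← neg_eq_of_add_eq_zero_right h2.symm, map_neg, outerFaces_mulSnd,
          show outerFaces (D g) = _ from hg]
        simp [mulRight_single] }
  have hP : ∀ a, IsFreeGroup.of a ∈ P := by
    intro a
    change outerFaces (D _) = _
    simp [D, s, mulSnd_single, outerFaces_single]
  intro g
  have h1 : (P.subtype.comp (IsFreeGroup.lift fun a => ⟨IsFreeGroup.of a, hP a⟩)) =
      MonoidHom.id G := IsFreeGroup.ext_hom fun a => by simp
  have h2 := DFunLike.congr_fun h1 g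
  have h3 : g ∈ P := by
    rw [← show _ = g from h2]
    exact (IsFreeGroup.lift (fun a => (⟨IsFreeGroup.of a, hP a⟩ : P)) g).2
  exact h3

end Fox

end FreeGroups

/-! ### First quadrant bicomplexes -/

namespace Bicomplex
variable {R : Type} [CommRing R] (K : Bicomplex R)

theorem dv_dv (p q : ℕ) (c : (K.X q).X (p + 2)) : K.dv p q (K.dv (p + 1) q c) = 0 :=
  ConcreteCategory.congr_hom ((K.X q).d_comp_d (p + 2) (p + 1) p) c

theorem dh_dh (p q : ℕ) (c : (K.X (q + 2)).X p) : K.dh p q (K.dh p (q + 1) c) = 0 :=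
  ConcreteCategory.congr_hom (congrArg (fun f => f.f p) (K.d_comp_d (q + 2) (q + 1) q)) c

theorem dv_dh (p q : ℕ) (c : (K.X (q + 1)).X (p + 1)) :
    K.dv p q (K.dh (p + 1) q c) = K.dh p q (K.dv p (q + 1) c) :=
  ConcreteCategory.congr_hom ((K.d (q + 1) q).comm (p + 1) p) c

theorem totD_totD (t : K.Tot) : K.totD (K.totD t) = 0 := by
  funext p q
  simp only [totD_apply, map_add, dv_dv, dh_dh, map_smul, dv_dh, pow_succ, smul_zero,
    add_zero, zero_add, mul_neg, mul_one, neg_smul, map_neg, neg_add_cancel, Pi.zero_apply]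

theorem totD_mem_homog {n : ℕ} {t : K.Tot} (ht : t ∈ K.homog (n + 1)) : K.totD t ∈ K.homog n := by
  intro p q h
  rw [totD_apply, ht _ _ (by omega), ht _ _ (by omega)]
  simp

/-- The element of the total complex with a single component. -/
def single (p q : ℕ) (c : (K.X q).X p) : K.Tot := Pi.single p (Pi.single q c)

@[simp]
theorem single_same (p q : ℕ) (c : (K.X q).X p) : K.single p q c p q = c := by
  simp [single]

theorem single_ne {p q a b : ℕ} (c : (K.X q).X p) (h : a = p → b ≠ q) :
    K.single p q c a b = 0 := by
  by_cases ha : a = p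
  · subst ha
    simp [single, h rfl]
  · simp [single, ha]

theorem single_mem_homog {p q n : ℕ} (h : p + q = n) (c : (K.X q).X p) :
    K.single p q c ∈ K.homog n := by
  intro a b hab
  exact K.single_ne c (by omega)

theorem single_mem_filtLT {p q k : ℕ} (h : q < k) (c : (K.X q).X p) :
    K.single p q c ∈ K.filtLT k := by
  intro a b hab
  exact K.single_ne c (by omega)

theorem totD_single_dv (p q : ℕ) (c : (K.X q).X (p + 1)) :
    K.totD (K.single (p + 1) q c) p q = K.dv p q c := by
  rw [totD_apply, single_same, K.single_ne c (by omega)]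
  simp

theorem totD_single_dh (p q : ℕ) (c : (K.X (q + 1)).X p) :
    K.totD (K.single p (q + 1) c) p q = (-1 : R) ^ p • K.dh p q c := by
  rw [totD_apply, single_same, K.single_ne c (by omega)]
  simp

theorem totD_single_ne {p q a b : ℕ} (c : (K.X q).X p) (h1 : a + 1 = p → b ≠ q)
    (h2 : a = p → b + 1 ≠ q) : K.totD (K.single p q c) a b = 0 := by
  rw [totD_apply, K.single_ne c h1, K.single_ne c h2]
  simp

/-- If the columns are exact in internal degrees `≥ 2`, then a cycle of total degree `n` whose components all have
internal degree `≥ 2` is a boundary: its components are removed by descending simplicial degree. -/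
theorem exists_totD_eq
    (hK : ∀ p q (c : (K.X q).X (p + 2)), K.dv (p + 1) q c = 0 → ∃ b, K.dv (p + 2) q b = c)
    (k n : ℕ) (hn : k + 1 ≤ n) (y : K.Tot) (h1 : y ∈ K.homog n) (h2 : y ∈ K.filtLT k)
    (h3 : K.totD y = 0) : ∃ w ∈ K.homog (n + 1), w ∈ K.filtLT k ∧ K.totD w = y := by
  induction k generalizing y with
  | zero =>
    refine ⟨0, zero_mem _, zero_mem _, ?_⟩
    rw [map_zero]
    funext p q
    exact (h2 p q (Nat.zero_le _)).symm
  | succ k ih =>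
    obtain ⟨p, rfl⟩ : ∃ p, n = p + 2 + k := ⟨n - k - 2, by omega⟩
    have h4 : K.dv (p + 1) k (y (p + 2) k) = 0 := by
      have := congrFun (congrFun h3 (p + 1)) k
      rw [totD_apply, h2 _ _ le_rfl] at this
      simpa using this
    obtain ⟨b, hb⟩ := hK p k _ h4
    have hs : K.single (p + 3) k b ∈ K.homog (p + 2 + k + 1) := K.single_mem_homog (by omega) b
    obtain ⟨w, hw1, hw2, hw3⟩ := ih (by omega) (y - K.totD (K.single (p + 3) k b))
      (sub_mem h1 (K.totD_mem_homog hs)) (by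
        intro a q hq
        change y a q - K.totD _ a q = 0
        by_cases hqk : q = k
        · subst hqk
          by_cases ha : a = p + 2
          · subst ha
            rw [totD_single_dv, hb, sub_self]
          · rw [h1 _ _ (by omega), K.totD_mem_homog hs _ _ (by omega), sub_zero]
        · rw [h2 _ _ (by omega), K.totD_single_ne b (by omega) (by omega), sub_zero])
      (by rw [map_sub, h3, totD_totD, sub_zero])
    refine ⟨w + K.single (p + 3) k b, add_mem hw1 hs, add_mem (fun a q hq => hw2 a q (by omega))
      (K.single_mem_filtLT (by omega) b), ?_⟩
    rw [map_add, hw3, sub_add_cancel]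

/-- The cochain with a single component. -/
def cosingle (p q : ℕ) (φ : (K.X q).X p →ₗ[R] R) : K.CoTot :=
  (Pi.single p (Pi.single q φ) : ∀ p q : ℕ, ((K.X q).X p →ₗ[R] R))

@[simp]
theorem cosingle_same (p q : ℕ) (φ : (K.X q).X p →ₗ[R] R) : K.cosingle p q φ p q = φ := by
  simp [cosingle]

theorem cosingle_ne {p q a b : ℕ} (φ : (K.X q).X p →ₗ[R] R) (h : a = p → b ≠ q) :
    K.cosingle p q φ a b = 0 := by
  by_cases ha : a = p
  · subst ha
    simp [cosingle, h rfl]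
  · simp [cosingle, ha]

theorem cosingle_mem_filtGE (p q : ℕ) (φ : (K.X q).X p →ₗ[R] R) :
    K.cosingle p q φ ∈ K.filtGE q := fun _ _ h => K.cosingle_ne φ (by omega)

theorem totCoD_apply (F : K.CoTot) (p q : ℕ) :
    K.totCoD F p q = K.codv p q F + (-1 : R) ^ p • K.codh p q F := rfl

theorem codv_succ (F : K.CoTot) (p q : ℕ) : K.codv (p + 1) q F = F p q ∘ₗ K.dv p q := rfl

theorem codh_succ (F : K.CoTot) (p q : ℕ) : K.codh p (q + 1) F = F p q ∘ₗ K.dh p q := rfl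

theorem codv_eq_zero {F : K.CoTot} {p q : ℕ} (h : ∀ a, a + 1 = p → F a q ∘ₗ K.dv a q = 0) :
    K.codv p q F = 0 := by
  cases p with
  | zero => rfl
  | succ p => exact h p rfl

theorem codh_eq_zero {F : K.CoTot} {p q : ℕ} (h : ∀ b, b + 1 = q → F p b ∘ₗ K.dh p b = 0) :
    K.codh p q F = 0 := by
  cases q with
  | zero => rfl
  | succ q => exact h q rfl

theorem totCoD_cosingle_ne {p q a b : ℕ} (φ : (K.X q).X p →ₗ[R] R) (h1 : a = p + 1 → b ≠ q)
    (h2 : a = p → b ≠ q + 1) : K.totCoD (K.cosingle p q φ) a b = 0 := by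
  rw [totCoD_apply, codv_eq_zero, codh_eq_zero, smul_zero, add_zero]
  · rintro b' rfl
    rw [K.cosingle_ne φ (by omega), LinearMap.zero_comp]
  · rintro a' rfl
    rw [K.cosingle_ne φ (by omega), LinearMap.zero_comp]

theorem totCoD_cosingle_dv (p q : ℕ) (φ : (K.X q).X p →ₗ[R] R) :
    K.totCoD (K.cosingle p q φ) (p + 1) q = φ ∘ₗ K.dv p q := by
  rw [totCoD_apply, codv_succ, cosingle_same, codh_eq_zero, smul_zero, add_zero]
  rintro b' rfl
  rw [K.cosingle_ne φ (by omega), LinearMap.zero_comp]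

theorem totCoD_cosingle_dh (p q : ℕ) (φ : (K.X q).X p →ₗ[R] R) :
    K.totCoD (K.cosingle p q φ) p (q + 1) = (-1 : R) ^ p • (φ ∘ₗ K.dh p q) := by
  rw [totCoD_apply, codh_succ, cosingle_same, codv_eq_zero, zero_add]
  rintro a rfl
  rw [K.cosingle_ne φ (by omega), LinearMap.zero_comp]

theorem cosingle_mem_cocycles {p q n : ℕ} (hn : p + q = n) (φ : (K.X q).X p →ₗ[R] R)
    (hv : φ ∘ₗ K.dv p q = 0) (hh : φ ∘ₗ K.dh p q = 0) : K.cosingle p q φ ∈ K.cocycles n := by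
  refine ⟨fun a b h => K.cosingle_ne φ (by omega), ?_⟩
  refine LinearMap.mem_ker.2 ?_
  funext a b
  change _ = (0 : (K.X b).X a →ₗ[R] R)
  by_cases h1 : a = p + 1 ∧ b = q
  · obtain ⟨rfl, rfl⟩ := h1
    rw [totCoD_cosingle_dv, hv]
  by_cases h2 : a = p ∧ b = q + 1
  · obtain ⟨rfl, rfl⟩ := h2
    rw [totCoD_cosingle_dh, hh, smul_zero]
  exact K.totCoD_cosingle_ne φ (by tauto) (by tauto)

theorem pairTot_single (a b : ℕ) (F : K.CoTot) (c : (K.X b).X a) :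
    K.pairTot (a + b) F (K.single a b c) = F a b c := by
  rw [pairTot_apply, Finset.sum_eq_single (a, b)]
  · simp
  · rintro ⟨a', b'⟩ hab hne
    rw [K.single_ne c (by rintro rfl rfl; exact hne rfl), map_zero]
  · intro h
    exact absurd ((Finset.HasAntidiagonal.mem_antidiagonal (a := (a, b))).2 rfl) h

theorem totCoD_totCoD (F : K.CoTot) : K.totCoD (K.totCoD F) = 0 := by
  funext a b
  refine LinearMap.ext fun c => ?_
  rw [← K.pairTot_single a b]
  change _ = (0 : R)
  rcases h : a + b with _ | _ | n
  · obtain ⟨rfl, rfl⟩ : a = 0 ∧ b = 0 := by omega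
    rw [pairTot_apply]
    simp [totCoD_apply, codv, codh]
  · rw [pairTot_totCoD, pairTot_apply]
    simp [totCoD_apply, codv, codh]
  · rw [pairTot_totCoD, pairTot_totCoD, totD_totD, map_zero]

theorem totCoD_mem_cohomog {n : ℕ} {G : K.CoTot} (hG : G ∈ K.cohomogPred n) :
    K.totCoD G ∈ K.cohomog n := by
  intro p q h
  rw [totCoD_apply, codv_eq_zero, codh_eq_zero, smul_zero, add_zero]
  · rintro b rfl
    rw [hG _ _ (by omega), LinearMap.zero_comp]
  · rintro a rfl
    rw [hG _ _ (by omega), LinearMap.zero_comp]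

theorem cosingle_mem_cohomogPred {p q n : ℕ} (hn : p + q + 1 = n) (φ : (K.X q).X p →ₗ[R] R) :
    K.cosingle p q φ ∈ K.cohomogPred n := fun a b h => K.cosingle_ne φ (by omega)

theorem pairTot_cosingle {p q n : ℕ} (hn : p + q = n) (φ : (K.X q).X p →ₗ[R] R) (t : K.Tot) :
    K.pairTot n (K.cosingle p q φ) t = φ (t p q) := by
  rw [pairTot_apply, Finset.sum_eq_single (p, q)]
  · simp
  · rintro ⟨a, b⟩ hab hne
    rw [K.cosingle_ne φ (by rintro rfl rfl; exact hne rfl)]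
    rfl
  · intro h
    exact absurd (Finset.HasAntidiagonal.mem_antidiagonal.2 hn) h

theorem pairing_mk (n : ℕ) (F : K.cocycles n) (z : K.cycles n) :
    K.pairing n (Submodule.Quotient.mk F) (Submodule.Quotient.mk z) = K.pairTot n F.1 z.1 := rfl

theorem mem_ZInf_of_cycle {p q n : ℕ} (hn : p + q = n) (z : K.cycles n)
    (hz : z.1 ∈ K.filtLT (q + 1)) : z.1 p q ∈ K.ZInf p q := by
  subst hn
  refine Submodule.mem_iInf _ |>.2 fun r => ⟨z.1, ⟨⟨z.2.1, hz⟩, ?_⟩, rfl⟩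
  change K.totD z.1 ∈ K.filtLT _
  rw [LinearMap.mem_ker.1 z.2.2]
  exact zero_mem _

/-- A cocycle concentrated in one bidegree vanishes on every leading term of a boundary in that bidegree. -/
theorem eInf_mk_ne_zero {p q : ℕ} (φ : (K.X q).X p →ₗ[R] R) (hv : φ ∘ₗ K.dv p q = 0)
    (hh : φ ∘ₗ K.dh p q = 0) (c : (K.X q).X p) (hc : c ∈ K.ZInf p q) (hφ : φ c ≠ 0) :
    (Submodule.Quotient.mk ⟨c, hc⟩ : K.EInf p q) ≠ 0 := by
  intro h
  rw [Submodule.Quotient.mk_eq_zero] at h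
  have : K.BInf p q ≤ LinearMap.ker φ := by
    refine iSup_le fun r => ?_
    rintro _ ⟨_, ⟨_, t, _, rfl⟩, rfl⟩
    have h1 := K.pairTot_cosingle rfl φ (K.totD t)
    rw [← pairTot_totCoD, LinearMap.mem_ker.1 (K.cosingle_mem_cocycles rfl φ hv hh).2] at h1
    rw [LinearMap.mem_ker]
    refine h1.symm.trans ?_
    simp
  exact hφ (this h)

theorem mem_coZInf {p q : ℕ} (φ : (K.X q).X p →ₗ[R] R) (hv : φ ∘ₗ K.dv p q = 0)
    (hh : φ ∘ₗ K.dh p q = 0) : φ ∈ K.coZInf p q := by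
  refine Submodule.mem_iInf _ |>.2 fun r => ⟨K.cosingle p q φ,
    ⟨⟨(K.cosingle_mem_cocycles rfl φ hv hh).1, K.cosingle_mem_filtGE p q φ⟩, ?_⟩, ?_⟩
  · change K.totCoD _ ∈ K.filtGE _
    rw [LinearMap.mem_ker.1 (K.cosingle_mem_cocycles rfl φ hv hh).2]
    exact zero_mem _
  · exact K.cosingle_same p q φ

theorem pairTot_totCoD_cycle {n : ℕ} {G : K.CoTot} (hG : G ∈ K.cohomogPred n) (z : K.cycles n) :
    K.pairTot n (K.totCoD G) z.1 = 0 := by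
  cases n with
  | zero =>
    rw [K.totCoD_cohomogPred_zero hG]
    simp
  | succ n => rw [pairTot_totCoD, LinearMap.mem_ker.1 z.2.2, map_zero]

set_option maxSynthPendingDepth 3 in
/-- Evaluation at the leading term of a cycle vanishes on every leading term of a coboundary in that bidegree. -/
theorem coEInf_mk_ne_zero {p q n : ℕ} (hn : p + q = n) (φ : (K.X q).X p →ₗ[R] R)
    (h : φ ∈ K.coZInf p q) (z : K.cycles n) (hz : z.1 ∈ K.filtLT (q + 1))
    (hφ : φ (z.1 p q) ≠ 0) : (Submodule.Quotient.mk ⟨φ, h⟩ : K.coEInf p q) ≠ 0 := by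
  subst hn
  intro h0
  rw [Submodule.Quotient.mk_eq_zero] at h0
  have : K.coBInf p q ≤ LinearMap.ker (LinearMap.applyₗ (R := R) (M₂ := R) (z.1 p q)) := by
    refine iSup_le fun r => ?_
    rintro _ ⟨_, ⟨hG, G, hG2, rfl⟩, rfl⟩
    rw [LinearMap.mem_ker]
    change K.totCoD G p q (z.1 p q) = 0
    have h1 : K.pairTot (p + q) (K.totCoD G) z.1 = K.totCoD G p q (z.1 p q) := by
      rw [pairTot_apply, Finset.sum_eq_single (p, q)]
      · rintro ⟨a, b⟩ hab hne
        rw [Finset.HasAntidiagonal.mem_antidiagonal] at hab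
        rcases lt_trichotomy b q with hb | rfl | hb
        · rw [hG a b hb]
          rfl
        · exact absurd (by simpa using hab) hne
        · rw [hz a b hb, map_zero]
      · intro h
        exact absurd ((Finset.HasAntidiagonal.mem_antidiagonal (a := (p, q))).2 rfl) h
    rw [← h1]
    exact K.pairTot_totCoD_cycle hG2.1 z
  exact hφ (this h0)

/-- If the dual columns are exact in internal degrees `≥ 2`, then a cocycle of total degree `n` is cohomologous to one
without components of internal degree `≥ 2` in simplicial degrees `< k`. -/
theorem exists_sub_totCoD_mem_filtGE
    (hK : ∀ p q (φ : (K.X q).X (p + 2) →ₗ[R] R), φ ∘ₗ K.dv (p + 2) q = 0 →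
      ∃ ψ : (K.X q).X (p + 1) →ₗ[R] R, ψ ∘ₗ K.dv (p + 1) q = φ)
    (k n : ℕ) (hn : k + 1 ≤ n) (F : K.CoTot) (h1 : F ∈ K.cohomog n) (h2 : K.totCoD F = 0) :
    ∃ G ∈ K.cohomogPred n, F - K.totCoD G ∈ K.filtGE k := by
  induction k with
  | zero => exact ⟨0, zero_mem _, fun _ _ h => absurd h (Nat.not_lt_zero _)⟩
  | succ k ih =>
    obtain ⟨G, hG1, hG2⟩ := ih (by omega)
    obtain ⟨p, rfl⟩ : ∃ p, n = p + 2 + k := ⟨n - k - 2, by omega⟩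
    have h3 : (F - K.totCoD G) (p + 2) k ∘ₗ K.dv (p + 2) k = 0 := by
      have h4 : K.totCoD (F - K.totCoD G) = 0 := by rw [map_sub, h2, totCoD_totCoD, sub_zero]
      have h5 : K.totCoD (F - K.totCoD G) (p + 3) k = 0 := congrFun (congrFun h4 (p + 3)) k
      rw [totCoD_apply, codv_succ, codh_eq_zero, smul_zero, add_zero] at h5
      · exact h5
      · rintro b rfl
        rw [hG2 _ _ (by omega), LinearMap.zero_comp]
    obtain ⟨ψ, hψ⟩ := hK _ _ _ h3
    refine ⟨G + K.cosingle (p + 1) k ψ, add_mem hG1 (K.cosingle_mem_cohomogPred (by omega) ψ),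
      fun a b hb => ?_⟩
    have e : (F - K.totCoD (G + K.cosingle (p + 1) k ψ)) a b =
        (F - K.totCoD G) a b - K.totCoD (K.cosingle (p + 1) k ψ) a b := by
      rw [map_add, ← sub_sub]
      rfl
    rw [e]
    by_cases hbk : b = k
    · subst hbk
      by_cases ha : a = p + 2
      · subst ha
        rw [totCoD_cosingle_dv, hψ, sub_self]
      · have h4 : (F - K.totCoD G) a b = F a b - K.totCoD G a b := rfl
        rw [h4, h1 _ _ (by omega), K.totCoD_mem_cohomog hG1 _ _ (by omega),
          K.totCoD_cosingle_ne ψ (by omega) (by omega), sub_zero, sub_zero]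
    · rw [hG2 _ _ (by omega), K.totCoD_cosingle_ne ψ (by omega) (by omega), sub_zero]

end Bicomplex

/-! ### The bar complex of a free group -/

section Bar
variable (R : Type) [CommRing R] (G : GrpCat.{0})

/-- The differential of the bar complex. -/
def barD (p : ℕ) : ((Fin (p + 1) → G) →₀ R) →ₗ[R] ((Fin p → G) →₀ R) :=
  (((Cyclic.bar R).obj G).d (p + 1) p).hom

theorem barD_single (p : ℕ) (g : Fin (p + 1) → G) (a : R) :
    barD R G p (Finsupp.single g a) = Finsupp.single (fun i => g i.succ) a +
      ∑ j : Fin (p + 1), (-1 : R) ^ ((j : ℕ) + 1) •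
        Finsupp.single (Fin.contractNth j (· * ·) g) a :=
  Cyclic.bar_d_single R p g a

theorem barD_zero : barD R G 0 = 0 := by
  refine Finsupp.lhom_ext fun g a => ?_
  rw [barD_single]
  simp [Subsingleton.elim (fun i : Fin 0 => g i.succ) (Fin.contractNth 0 (· * ·) g)]

/-- Prepend two entries to a bar chain. -/
def prependTwo {p : ℕ} (v : Fin p → G) (a : R) : (G × G →₀ ℤ) →+ ((Fin (p + 2) → G) →₀ R) :=
  Finsupp.liftAddHom fun x => zmultiplesHom _
    (Finsupp.single (Fin.cons x.1 (Fin.cons x.2 v) : Fin (p + 2) → G) a)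

/-- Prepend one entry to a bar chain. -/
def prependOne {p : ℕ} (v : Fin p → G) (a : R) : (G →₀ ℤ) →+ ((Fin (p + 1) → G) →₀ R) :=
  Finsupp.liftAddHom fun x => zmultiplesHom _
    (Finsupp.single (Fin.cons x v : Fin (p + 1) → G) a)

variable {G}

theorem prependTwo_single {p : ℕ} (v : Fin p → G) (a : R) (x : G × G) (n : ℤ) :
    prependTwo R G v a (Finsupp.single x n) =
      n • Finsupp.single (Fin.cons x.1 (Fin.cons x.2 v) : Fin (p + 2) → G) a := by
  simp only [prependTwo, Finsupp.liftAddHom_apply_single, zmultiplesHom_apply]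

theorem prependOne_single {p : ℕ} (v : Fin p → G) (a : R) (x : G) (n : ℤ) :
    prependOne R G v a (Finsupp.single x n) =
      n • Finsupp.single (Fin.cons x v : Fin (p + 1) → G) a := by
  simp only [prependOne, Finsupp.liftAddHom_apply_single, zmultiplesHom_apply]

theorem contractNth_cons_zero {p : ℕ} (x : G) (v : Fin (p + 1) → G) :
    Fin.contractNth 0 (· * ·) (Fin.cons x v : Fin (p + 2) → G) =
      Fin.cons (x * v 0) (Fin.tail v) := by
  funext k
  cases k using Fin.cases <;> simp [Fin.contractNth, Fin.tail]

theorem contractNth_cons_succ {p : ℕ} (j : Fin (p + 1)) (x : G) (v : Fin (p + 1) → G) :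
    Fin.contractNth j.succ (· * ·) (Fin.cons x v : Fin (p + 2) → G) =
      Fin.cons x (Fin.contractNth j (· * ·) v) := by
  funext k
  cases k using Fin.cases <;> simp [Fin.contractNth]

theorem barD_cons (p : ℕ) (x : G) (v : Fin (p + 1) → G) (a : R) :
    barD R G (p + 1) (Finsupp.single (Fin.cons x v : Fin (p + 2) → G) a) =
      Finsupp.single v a - Finsupp.single (Fin.cons (x * v 0) (Fin.tail v) : Fin (p + 1) → G) a +
      ∑ k : Fin (p + 1), (-1 : R) ^ (k : ℕ) •
        Finsupp.single (Fin.cons x (Fin.contractNth k (· * ·) v) : Fin (p + 1) → G) a := by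
  rw [barD_single, Fin.sum_univ_succ]
  simp only [contractNth_cons_zero, contractNth_cons_succ, Fin.cons_succ, Fin.val_zero,
    Fin.val_succ, pow_succ, pow_zero, neg_smul, one_smul, mul_neg, mul_one, neg_neg]
  rw [sub_eq_add_neg, add_assoc]

theorem barD_prependTwo (p : ℕ) (v : Fin (p + 1) → G) (a : R) (c : G × G →₀ ℤ) :
    barD R G (p + 2) (prependTwo R G v a c) = prependOne R G v a (outerFaces c) +
      prependTwo R G (Fin.tail v) a (mulSnd (v 0) c) -
      ∑ k : Fin (p + 1), (-1 : R) ^ (k : ℕ) •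
        prependTwo R G (Fin.contractNth k (· * ·) v) a c := by
  induction c using Finsupp.induction_linear with
  | zero => simp
  | add c d hc hd =>
    simp only [map_add, hc, hd, smul_add, Finset.sum_add_distrib]
    abel
  | single x n =>
    rw [prependTwo_single, map_zsmul, barD_cons, Fin.sum_univ_succ]
    simp only [contractNth_cons_zero, contractNth_cons_succ, Fin.cons_zero, Fin.tail_cons,
      outerFaces_single, mulSnd_single, map_sub, prependTwo_single, prependOne_single]
    simp only [Fin.val_zero, Fin.val_succ, pow_zero, one_smul, pow_succ, mul_neg, mul_one, neg_smul,
      Finset.sum_neg_distrib, smul_add, smul_sub, smul_neg, Finset.smul_sum]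
    simp only [smul_comm (_ ^ _ : R) n]
    abel

/-- The bar complex of a free group is contracted in degrees `≥ 2`, by a homotopy that inserts the geodesic from `1` to
the first entry. -/
theorem exists_contraction [IsFreeGroup G] :
    ∃ h : ∀ p, ((Fin (p + 1) → G) →₀ R) →ₗ[R] ((Fin (p + 2) → G) →₀ R),
      ∀ p c, barD R G (p + 2) (h (p + 1) c) + h p (barD R G (p + 1) c) = c := by
  obtain ⟨D, hD, hO⟩ := exists_geodesic_chain (G := G)
  let E : G → (G × G →₀ ℤ) := fun g => Finsupp.single (1, 1) 1 - D g
  let h : ∀ p, ((Fin (p + 1) → G) →₀ R) →ₗ[R] ((Fin (p + 2) → G) →₀ R) := fun p =>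
    Finsupp.linearCombination R fun g => prependTwo R G (Fin.tail g) 1 (E (g 0))
  have hs : ∀ p x (v : Fin p → G), h p (Finsupp.single (Fin.cons x v : Fin (p + 1) → G) 1) =
      prependTwo R G v 1 (E x) := by
    intro p x v
    simp [h]
  refine ⟨h, fun p c => ?_⟩
  suffices H : barD R G (p + 2) ∘ₗ h (p + 1) + h p ∘ₗ barD R G (p + 1) = LinearMap.id from
    LinearMap.congr_fun H c
  refine Finsupp.lhom_ext' fun g => LinearMap.ext_ring ?_
  obtain ⟨x, v, rfl⟩ : ∃ x v, g = Fin.cons x v := ⟨g 0, Fin.tail g, (Fin.cons_self_tail g).symm⟩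
  have h1 : Finsupp.single v (1 : R) =
      Finsupp.single (Fin.cons (v 0) (Fin.tail v) : Fin (p + 1) → G) 1 := by
    rw [Fin.cons_self_tail]
  simp only [LinearMap.comp_apply, LinearMap.add_apply, Finsupp.lsingle_apply, LinearMap.id_apply]
  rw [barD_cons, hs, barD_prependTwo, map_add, map_sum, h1, map_sub (h p)]
  simp only [map_smul (h p), hs]
  have h2 : outerFaces (E x) = Finsupp.single x 1 - Finsupp.single 1 1 := by
    simp [E, outerFaces_single, hO]
  have h3 : mulSnd (v 0) (E x) + E (v 0) - E (x * v 0) = Finsupp.single (1, v 0) 1 := by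
    simp only [E, map_sub, hD, mulSnd_single]
    simp
    abel
  have h4 := congrArg (prependTwo R G (Fin.tail v) 1) h3
  rw [map_sub, map_add, prependTwo_single, one_smul] at h4
  rw [h2, map_sub, prependOne_single, prependOne_single, one_smul, one_smul]
  simp only at h4
  rw [Fin.cons_self_tail] at h4
  have h5 : prependTwo R G (Fin.tail v) 1 (mulSnd (v 0) (E x)) =
      Finsupp.single (Fin.cons 1 v : Fin (p + 2) → G) 1 -
      prependTwo R G (Fin.tail v) 1 (E (v 0)) + prependTwo R G (Fin.tail v) 1 (E (x * v 0)) := by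
    rw [← h4]; abel
  rw [h5]
  abel

theorem exists_barD_eq [IsFreeGroup G] (p : ℕ) (c : (Fin (p + 2) → G) →₀ R)
    (hc : barD R G (p + 1) c = 0) : ∃ b, barD R G (p + 2) b = c := by
  obtain ⟨h, hh⟩ := exists_contraction R (G := G)
  refine ⟨h (p + 1) c, ?_⟩
  have := hh p c
  rwa [hc, map_zero, add_zero] at this

theorem exists_comp_barD_eq [IsFreeGroup G] (p : ℕ) (φ : ((Fin (p + 2) → G) →₀ R) →ₗ[R] R)
    (hφ : φ ∘ₗ barD R G (p + 2) = 0) :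
    ∃ ψ : ((Fin (p + 1) → G) →₀ R) →ₗ[R] R, ψ ∘ₗ barD R G (p + 1) = φ := by
  obtain ⟨h, hh⟩ := exists_contraction R (G := G)
  refine ⟨φ ∘ₗ h p, LinearMap.ext fun c => ?_⟩
  have h1 := congrArg φ (hh p c)
  have h2 : φ (barD R G (p + 2) (h (p + 1) c)) = 0 := LinearMap.congr_fun hφ _
  rwa [map_add, h2, zero_add] at h1

theorem barD_pair (g h : G) (a : R) :
    barD R G 1 (Finsupp.single ![g, h] a) = Finsupp.single (fun _ => h) a -
      Finsupp.single (fun _ => g * h) a + Finsupp.single (fun _ => g) a := by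
  have h0 : (![g, h] : Fin 2 → G) = Fin.cons g (fun _ => h) := by
    funext k; fin_cases k <;> rfl
  rw [h0, barD_cons, Fin.sum_univ_one, Fin.val_zero, pow_zero, one_smul]
  congr 3 <;> funext k <;> fin_cases k <;> simp

/-- The class of a bar chain of degree `1` in the abelianization. -/
def abClass (G : GrpCat.{0}) : ((Fin 1 → G) →₀ ℤ) →+ Additive (Abelianization G) :=
  Finsupp.liftAddHom fun g => zmultiplesHom _
    (Additive.ofMul (Abelianization.of (g 0)))

theorem abClass_single (g : Fin 1 → G) (n : ℤ) :
    abClass G (Finsupp.single g n) = n • Additive.ofMul (Abelianization.of (g 0)) := by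
  simp only [abClass, Finsupp.liftAddHom_apply_single, zmultiplesHom_apply]

theorem abClass_surjective : Function.Surjective (abClass G) := by
  intro x
  obtain ⟨g, hg⟩ := QuotientGroup.mk_surjective x.toMul
  refine ⟨Finsupp.single (fun _ => g) 1, ?_⟩
  rw [abClass_single, one_smul]
  exact congrArg Additive.ofMul hg

/-- `H_1(G; ℤ)` is the abelianization of `G`. -/
theorem abClass_eq_zero_iff (c : (Fin 1 → G) →₀ ℤ) :
    abClass G c = 0 ↔ ∃ b, barD ℤ G 1 b = c := by
  constructor
  · intro hc
    let Q := ((Fin 1 → G) →₀ ℤ) ⧸ LinearMap.range (barD ℤ G 1)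
    let u : G →* Multiplicative Q :=
      MonoidHom.mk' (fun g => Multiplicative.ofAdd
        (Submodule.Quotient.mk (Finsupp.single (fun _ => g) 1))) fun g h => by
        refine Multiplicative.toAdd.injective ?_
        change (Submodule.Quotient.mk _ : Q) = Submodule.Quotient.mk _ + Submodule.Quotient.mk _
        rw [← Submodule.Quotient.mk_add, Submodule.Quotient.eq]
        refine ⟨-Finsupp.single ![g, h] 1, ?_⟩
        rw [map_neg, barD_pair]
        abel
    let w : Additive (Abelianization G) →+ Q := MonoidHom.toAdditiveLeft (Abelianization.lift u)
    have hw : w.comp (abClass G) = (Submodule.mkQ (LinearMap.range (barD ℤ G 1))).toAddMonoidHom := by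
      refine Finsupp.addHom_ext fun g n => ?_
      simp only [AddMonoidHom.comp_apply, abClass_single, map_zsmul]
      have h1 : w (Additive.ofMul (Abelianization.of (g 0))) =
          Submodule.Quotient.mk (Finsupp.single (fun _ => g 0) 1) := by
        change Multiplicative.toAdd (Abelianization.lift u (Abelianization.of (g 0))) = _
        rw [Abelianization.lift_apply_of]
        rfl
      have h2 : (fun _ => g 0 : Fin 1 → G) = g := by
        funext k; rw [Subsingleton.elim k 0]
      rw [h1, h2, ← Submodule.Quotient.mk_smul, Finsupp.smul_single]
      simp
    have h1 := DFunLike.congr_fun hw c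
    rw [AddMonoidHom.comp_apply, hc, map_zero] at h1
    exact (Submodule.Quotient.mk_eq_zero _).1 h1.symm
  · rintro ⟨b, rfl⟩
    suffices h : (abClass G).comp (barD ℤ G 1).toAddMonoidHom = 0 from DFunLike.congr_fun h b
    refine Finsupp.addHom_ext fun g n => ?_
    have h0 : g = ![g 0, g 1] := by funext k; fin_cases k <;> rfl
    rw [h0]
    change abClass G (barD ℤ G 1 (Finsupp.single _ n)) = 0
    rw [barD_pair, map_add, map_sub, abClass_single, abClass_single, abClass_single, map_mul,
      ofMul_mul, smul_add]
    abel

end Bar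

/-! ### Normalization of simplicial abelian groups -/

section Normalization

/-- Evaluation of homomorphisms of abelian groups at an element. -/
def evalHom {A B : AddCommGrpCat.{0}} (x : A) : (A ⟶ B) →+ B :=
  AddMonoidHom.mk' (fun φ => φ x) fun _ _ => rfl

/-- The alternating sum of the faces. -/
def altFace (X : SimplicialObject AddCommGrpCat.{0}) (n : ℕ) : X _⦋n + 1⦌ →+ X _⦋n⦌ :=
  ∑ i : Fin (n + 2), (-1 : ℤ) ^ (i : ℕ) • (X.δ i).hom

theorem altFace_apply (X : SimplicialObject AddCommGrpCat.{0}) (n : ℕ) (x : X _⦋n + 1⦌) :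
    altFace X n x = ∑ i : Fin (n + 2), (-1 : ℤ) ^ (i : ℕ) • X.δ i x := by
  simp [altFace, AddMonoidHom.finsetSum_apply]

theorem alternatingFaceMap_apply (X : SimplicialObject AddCommGrpCat.{0}) (n : ℕ)
    (x : X _⦋n + 1⦌) :
    ((AlgebraicTopology.AlternatingFaceMapComplex.obj X).d (n + 1) n).hom x = altFace X n x := by
  refine (congrArg (evalHom x) (AlgebraicTopology.AlternatingFaceMapComplex.obj_d_eq X n)).trans ?_
  rw [map_sum, altFace_apply]
  exact Finset.sum_congr rfl fun i _ => map_zsmul (evalHom x) _ _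

/-- The projection to the normalized complex is homotopic to the identity and vanishes on degenerate elements. -/
theorem exists_normalization (X : SimplicialObject AddCommGrpCat.{0}) (n : ℕ) :
    ∃ (P : X _⦋n + 1⦌ →+ X _⦋n + 1⦌) (H : X _⦋n + 1⦌ →+ X _⦋n + 2⦌)
      (H' : X _⦋n⦌ →+ X _⦋n + 1⦌),
      (∀ x, P x = H' (altFace X n x) + altFace X (n + 1) (H x) + x) ∧
      ∀ (i : Fin (n + 1)) y, P (X.σ i y) = 0 := by
  let K := AlgebraicTopology.AlternatingFaceMapComplex.obj X
  let p : K ⟶ K := AlgebraicTopology.DoldKan.PInfty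
  let h : Homotopy p (𝟙 K) := AlgebraicTopology.DoldKan.homotopyPInftyToId X
  refine ⟨(p.f (n + 1)).hom, (h.hom (n + 1) (n + 2)).hom, (h.hom n (n + 1)).hom,
    fun x => ?_, fun i y => ?_⟩
  · have h1 := h.comm (n + 1)
    rw [dNext_eq (i' := n) _ (by simp), prevD_eq (j' := n + 2) _ (by simp)] at h1
    refine (ConcreteCategory.congr_hom h1 x).trans ?_
    rw [← alternatingFaceMap_apply, ← alternatingFaceMap_apply]
    rfl
  · exact ConcreteCategory.congr_hom (AlgebraicTopology.DoldKan.σ_comp_PInfty X i) y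

/-- A cycle in the subgroup generated by the degenerate elements is a boundary. -/
theorem exists_altFace_eq (X : SimplicialObject AddCommGrpCat.{0}) (n : ℕ) (x : X _⦋n + 1⦌)
    (hx : altFace X n x = 0)
    (hd : x ∈ AddSubgroup.closure {y | ∃ (i : Fin (n + 1)) (z : X _⦋n⦌), X.σ i z = y}) :
    ∃ a, altFace X (n + 1) a = x := by
  obtain ⟨P, H, H', h1, h2⟩ := exists_normalization X n
  refine ⟨-H x, ?_⟩
  have h3 : P x = 0 := by
    suffices h : AddSubgroup.closure {y | ∃ (i : Fin (n + 1)) (z : X _⦋n⦌), X.σ i z = y} ≤ P.ker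
      from h hd
    rw [AddSubgroup.closure_le]
    rintro _ ⟨i, z, rfl⟩
    exact h2 i z
  rw [h1, hx, map_zero, zero_add] at h3
  rw [map_neg]
  exact neg_eq_of_add_eq_zero_right h3

/-- Let `s` be a cycle which together with the degenerate elements generates the group in degree `n + 1`. A cocycle of
this degree which vanishes on `s` is a coboundary. -/
theorem exists_comp_altFace_eq (X : SimplicialObject AddCommGrpCat.{0}) (n : ℕ) (s : X _⦋n + 1⦌)
    (hs : altFace X n s = 0)
    (htop : AddSubgroup.closure ({y | ∃ (i : Fin (n + 1)) (z : X _⦋n⦌), X.σ i z = y} ∪ {s}) = ⊤)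
    {B : Type} [AddCommGroup B] (φ : X _⦋n + 1⦌ →+ B) (hφ : ∀ x, φ (altFace X (n + 1) x) = 0)
    (hφs : φ s = 0) : ∃ ψ : X _⦋n⦌ →+ B, ∀ x, φ x = ψ (altFace X n x) := by
  obtain ⟨P, H, H', h1, h2⟩ := exists_normalization X n
  refine ⟨-(φ.comp H'), fun x => ?_⟩
  have h3 : φ (P x) = 0 := by
    suffices h : AddSubgroup.closure
      ({y | ∃ (i : Fin (n + 1)) (z : X _⦋n⦌), X.σ i z = y} ∪ {s}) ≤ (φ.comp P).ker by
      have hx : x ∈ (⊤ : AddSubgroup (X _⦋n + 1⦌)) := trivial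
      rw [← htop] at hx
      exact h hx
    rw [AddSubgroup.closure_le]
    rintro _ (⟨i, z, rfl⟩ | rfl)
    · change φ (P _) = 0
      rw [h2, map_zero]
    · change φ (P _) = 0
      rw [h1, hs, map_zero, zero_add, map_add, hφ, hφs, zero_add]
  rw [h1, map_add, map_add, hφ, add_zero] at h3
  exact (neg_eq_of_add_eq_zero_right h3).symm

end Normalization

/-! ### The bar bicomplex of a degreewise free simplicial group -/

section BarBicomplex

/-- The simplicial abelian group of the abelianizations. -/
def simplicialAb (Γ : SimplicialObject GrpCat.{0}) : SimplicialObject AddCommGrpCat.{0} where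
  obj m := AddCommGrpCat.of (Additive (Abelianization (Γ.obj m)))
  map θ := AddCommGrpCat.ofHom (Abelianization.map (Γ.map θ).hom).toAdditive
  map_id m := by
    refine AddCommGrpCat.hom_ext (AddMonoidHom.ext fun x => ?_)
    obtain ⟨g, rfl⟩ := QuotientGroup.mk_surjective x
    exact congrArg (fun f => Additive.ofMul (Abelianization.of (f.hom g))) (Γ.map_id m)
  map_comp θ η := by
    refine AddCommGrpCat.hom_ext (AddMonoidHom.ext fun x => ?_)
    obtain ⟨g, rfl⟩ := QuotientGroup.mk_surjective x
    exact congrArg (fun f => Additive.ofMul (Abelianization.of (f.hom g))) (Γ.map_comp θ η)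

variable (R : Type) [CommRing R] (Γ : SimplicialObject GrpCat.{0})

/-- The class of an element in the abelianization. -/
def abOf {m : SimplexCategoryᵒᵖ} (g : Γ.obj m) : (simplicialAb Γ).obj m :=
  Additive.ofMul (Abelianization.of g)

theorem abOf_mul {m : SimplexCategoryᵒᵖ} (g h : Γ.obj m) :
    abOf Γ (g * h) = abOf Γ g + abOf Γ h := rfl

/-- The simplicial differential of the bar bicomplex, on tuples. -/
def barFace (p q : ℕ) : ((Fin p → Γ _⦋q + 1⦌) →₀ R) →ₗ[R] ((Fin p → Γ _⦋q⦌) →₀ R) :=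
  (bic (Cyclic.bar R) Γ).dh p q

theorem barFace_single (p q : ℕ) (g : Fin p → Γ _⦋q + 1⦌) (a : R) :
    barFace R Γ p q (Finsupp.single g a) =
      ∑ i : Fin (q + 2), (-1 : ℤ) ^ (i : ℕ) • Finsupp.single (Γ.δ i ∘ g) a := by
  refine (bic_dh (Cyclic.bar R) Γ p q (Finsupp.single g a)).trans
    (Finset.sum_congr rfl fun i _ => congrArg _ ?_)
  exact Cyclic.barMap_single R (Γ.δ i).hom p g a

/-- The class of a bar chain of internal degree `1` in the abelianization. -/
def barClass (q : ℕ) : ((Fin 1 → Γ _⦋q⦌) →₀ ℤ) →+ (simplicialAb Γ) _⦋q⦌ := abClass (Γ _⦋q⦌)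

theorem barClass_single (q : ℕ) (g : Fin 1 → Γ _⦋q⦌) (n : ℤ) :
    barClass Γ q (Finsupp.single g n) = n • abOf Γ (g 0) := abClass_single g n

theorem barClass_surjective (q : ℕ) : Function.Surjective (barClass Γ q) := abClass_surjective

theorem barClass_eq_zero_iff (q : ℕ) (c : (Fin 1 → Γ _⦋q⦌) →₀ ℤ) :
    barClass Γ q c = 0 ↔ ∃ b, barD ℤ (Γ _⦋q⦌) 1 b = c := abClass_eq_zero_iff c

theorem barClass_barFace (q : ℕ) (c : (Fin 1 → Γ _⦋q + 1⦌) →₀ ℤ) :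
    barClass Γ q (barFace ℤ Γ 1 q c) = altFace (simplicialAb Γ) q (barClass Γ (q + 1) c) := by
  suffices h : (barClass Γ q).comp (barFace ℤ Γ 1 q).toAddMonoidHom =
      (altFace (simplicialAb Γ) q).comp (barClass Γ (q + 1)) from DFunLike.congr_fun h c
  refine Finsupp.addHom_ext fun g n => ?_
  refine (congrArg (barClass Γ q) (barFace_single ℤ Γ 1 q g n)).trans ?_
  rw [map_sum, AddMonoidHom.comp_apply, barClass_single, map_zsmul, altFace_apply,
    Finset.smul_sum]
  refine Finset.sum_congr rfl fun i _ => ?_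
  rw [map_zsmul, barClass_single, smul_comm]
  rfl

theorem barBicomplex_exact (hΓ : ∀ m, IsFreeGroup (Γ.obj m)) (p q : ℕ)
    (c : ((bic (Cyclic.bar R) Γ).X q).X (p + 2)) (hc : (bic (Cyclic.bar R) Γ).dv (p + 1) q c = 0) :
    ∃ b, (bic (Cyclic.bar R) Γ).dv (p + 2) q b = c :=
  have := hΓ (op ⦋q⦌)
  exists_barD_eq R p c hc

theorem barBicomplex_coexact (hΓ : ∀ m, IsFreeGroup (Γ.obj m)) (p q : ℕ)
    (φ : ((bic (Cyclic.bar R) Γ).X q).X (p + 2) →ₗ[R] R)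
    (hφ : φ ∘ₗ (bic (Cyclic.bar R) Γ).dv (p + 2) q = 0) :
    ∃ ψ : ((bic (Cyclic.bar R) Γ).X q).X (p + 1) →ₗ[R] R,
      ψ ∘ₗ (bic (Cyclic.bar R) Γ).dv (p + 1) q = φ :=
  have := hΓ (op ⦋q⦌)
  exists_comp_barD_eq R p φ hφ

end BarBicomplex

/-! ### Bicomplexes with columns of homological dimension one -/

namespace Bicomplex
variable {R : Type} [CommRing R] (K : Bicomplex R)

/-- The properties of the bar bicomplex of a simplicial group that is free in each degree: its columns have homology
only in internal degrees `0` and `1`, the differential between these degrees vanishes, and the row of internal degree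
`0` is that of a constant simplicial object. -/
structure BarLike : Prop where
  exact : ∀ p q (c : (K.X q).X (p + 2)), K.dv (p + 1) q c = 0 → ∃ b, K.dv (p + 2) q b = c
  coexact : ∀ p q (φ : (K.X q).X (p + 2) →ₗ[R] R), φ ∘ₗ K.dv (p + 2) q = 0 →
    ∃ ψ : (K.X q).X (p + 1) →ₗ[R] R, ψ ∘ₗ K.dv (p + 1) q = φ
  dv_zero : ∀ q, K.dv 0 q = 0
  row : ∀ q, ¬ Even q → Function.Bijective (K.dh 0 q)

variable {K}

theorem BarLike.totD_single_one (hK : K.BarLike) (q b : ℕ) (c : (K.X q).X 1) :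
    K.totD (K.single 1 q c) 0 b = 0 := by
  by_cases hb : b = q
  · subst hb
    rw [K.totD_single_dv, hK.dv_zero, LinearMap.zero_apply]
  · exact K.totD_single_ne _ (by omega) (by omega)

/-- A cycle of filtration `≤ N` whose leading class in `H_1(BΓ_N; ℤ)` is a boundary of the complex `H_1(BΓ_*; ℤ)` is
a boundary. -/
theorem BarLike.mem_boundaries_of_leading (hK : K.BarLike) {N : ℕ}
    (z : K.Tot) (h1 : z ∈ K.cycles (N + 1))
    (h2 : z ∈ K.filtLT (N + 1)) (e : (K.X (N + 1)).X 1)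
    (b : (K.X N).X 2) (hb : K.dv 1 N b = z 1 N - K.dh 1 N e) :
    z ∈ K.boundaries (N + 1) := by
  have he : K.single 1 (N + 1) e ∈ K.homog (N + 2) := K.single_mem_homog (by omega) e
  have hbm : K.single 2 N b ∈ K.homog (N + 2) := K.single_mem_homog (by omega) b
  obtain ⟨w, hw1, -, hw2⟩ := K.exists_totD_eq (hK.exact) N (N + 1) le_rfl
    (z + K.totD (K.single 1 (N + 1) e) - K.totD (K.single 2 N b))
    (sub_mem (add_mem h1.1 (K.totD_mem_homog he)) (K.totD_mem_homog hbm)) (by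
      intro p q hq
      change z p q + K.totD (K.single 1 (N + 1) e) p q - K.totD (K.single 2 N b) p q = 0
      by_cases hpq : p + q = N + 1
      · rcases (by omega : (p = 1 ∧ q = N) ∨ (p = 0 ∧ q = N + 1)) with ⟨rfl, rfl⟩ | ⟨rfl, rfl⟩
        · rw [K.totD_single_dh, K.totD_single_dv, pow_one, neg_smul, one_smul, ← sub_eq_add_neg,
            sub_eq_zero]
          exact hb.symm
        · rw [h2 _ _ le_rfl, K.totD_single_ne b (by omega) (by omega),
            hK.totD_single_one, zero_add, sub_zero]
      · rw [h1.1 _ _ hpq, K.totD_mem_homog he _ _ hpq, K.totD_mem_homog hbm _ _ hpq]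
        simp)
    (by rw [map_sub, map_add, LinearMap.mem_ker.1 h1.2, K.totD_totD, K.totD_totD, add_zero,
      sub_zero])
  refine ⟨w - K.single 1 (N + 1) e + K.single 2 N b, add_mem (sub_mem hw1 he) hbm, ?_⟩
  rw [map_add, map_sub, hw2]
  abel

/-- In simplicial degree `0` every chain of internal degree `1` is a cycle. -/
theorem BarLike.exists_cycle_zero (hK : K.BarLike) (c : (K.X 0).X 1) :
    ∃ z : K.cycles 1, z.1 ∈ K.filtLT 1 ∧
      z.1 1 0 = c := by
  refine ⟨⟨K.single 1 0 c, K.single_mem_homog rfl c, ?_⟩, K.single_mem_filtLT one_pos c,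
    K.single_same 1 0 c⟩
  refine LinearMap.mem_ker.2 (funext fun p => funext fun q => ?_)
  by_cases hp : p = 0
  · subst hp
    exact hK.totD_single_one 0 q c
  · exact K.totD_single_ne c (by omega) (by omega)

/-- A cycle of the complex `H_1(BΓ_*; ℤ)` is the leading class of a cycle of the bar bicomplex. -/
theorem BarLike.exists_cycle_succ (hK : K.BarLike) {M : ℕ}
    (c : (K.X (M + 1)).X 1)
    (b : (K.X M).X 2) (hb : K.dv 1 M b = K.dh 1 M c) :
    ∃ z : K.cycles (M + 2), z.1 ∈ K.filtLT (M + 2) ∧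
      z.1 1 (M + 1) = c := by
  have hcm : K.single 1 (M + 1) c ∈ K.homog (M + 2) := K.single_mem_homog (by omega) c
  have hbm : K.single 2 M b ∈ K.homog (M + 2) := K.single_mem_homog (by omega) b
  obtain ⟨w, hw1, hw2, hw3⟩ := K.exists_totD_eq (hK.exact) M (M + 1) le_rfl
    (K.totD (K.single 1 (M + 1) c + K.single 2 M b))
    (K.totD_mem_homog (add_mem hcm hbm)) (by
      intro p q hq
      rw [map_add]
      change K.totD (K.single 1 (M + 1) c) p q + K.totD (K.single 2 M b) p q = 0
      by_cases hpq : p + q = M + 1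
      · rcases (by omega : (p = 1 ∧ q = M) ∨ (p = 0 ∧ q = M + 1)) with ⟨rfl, rfl⟩ | ⟨rfl, rfl⟩
        · rw [K.totD_single_dh, K.totD_single_dv, pow_one, neg_smul, one_smul, neg_add_eq_zero]
          exact hb.symm
        · rw [K.totD_single_ne b (by omega) (by omega), add_zero]
          exact hK.totD_single_one (M + 1) (M + 1) c
      · rw [K.totD_mem_homog hcm _ _ hpq, K.totD_mem_homog hbm _ _ hpq, add_zero])
    (K.totD_totD _)
  refine ⟨⟨K.single 1 (M + 1) c + K.single 2 M b - w, sub_mem (add_mem hcm hbm) hw1, ?_⟩, ?_, ?_⟩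
  · refine LinearMap.mem_ker.2 ?_
    rw [map_sub, hw3, sub_self]
  · exact sub_mem (add_mem (K.single_mem_filtLT (by omega) c) (K.single_mem_filtLT (by omega) b))
      fun p q hq => hw2 p q (by omega)
  · change K.single 1 (M + 1) c 1 (M + 1) + K.single 2 M b 1 (M + 1) - w 1 (M + 1) = c
    rw [K.single_same, K.single_ne b (by omega), hw2 _ _ (by omega)]
    exact (sub_zero _).trans (add_zero _)

/-- The row of internal degree `0` contributes nothing in positive degrees. -/
theorem BarLike.exists_sub_totD_mem_filtLT (hK : K.BarLike) {N : ℕ} (z : K.Tot)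
    (hz : z ∈ K.cycles (N + 1)) :
    ∃ w ∈ K.homog (N + 2),
      z - K.totD w ∈ K.filtLT (N + 1) := by
  suffices h : ∃ w ∈ K.homog (N + 2), z 0 (N + 1) = K.totD w 0 (N + 1) by
    obtain ⟨w, hw, h⟩ := h
    refine ⟨w, hw, fun p q hq => ?_⟩
    change z p q - K.totD w p q = 0
    by_cases hpq : p + q = N + 1
    · obtain ⟨rfl, rfl⟩ : p = 0 ∧ q = N + 1 := by omega
      rw [h, sub_self]
    · rw [hz.1 _ _ hpq, K.totD_mem_homog hw _ _ hpq, sub_zero]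
  -- the row of internal degree `0` has differentials that are alternately zero and bijective
  by_cases hN : Even N
  · obtain ⟨b, hb⟩ := (hK.row (N + 1)
      (by rwa [Nat.even_add_one, not_not])).2 (z 0 (N + 1))
    refine ⟨K.single 0 (N + 2) b, K.single_mem_homog (by omega) _, ?_⟩
    rw [K.totD_single_dh, pow_zero, one_smul]
    exact hb.symm
  · refine ⟨0, zero_mem _, ?_⟩
    rw [map_zero]
    refine (hK.row N hN).1 ?_
    have h1 : K.dv 0 N (z 1 N) + (-1 : R) ^ 0 • K.dh 0 N (z 0 (N + 1)) = 0 :=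
      congrFun (congrFun (LinearMap.mem_ker.1 hz.2) 0) N
    have h2 : K.dv 0 N (z 1 N) = 0 := LinearMap.congr_fun (hK.dv_zero N) _
    rw [h2, zero_add, pow_zero, one_smul] at h1
    exact h1.trans (map_zero (K.dh 0 N)).symm

/-- Every cohomology class of degree `N + 1` is represented by a cochain on `H_1(BΓ_N)`. -/
theorem BarLike.exists_cosingle_representative (hK : K.BarLike) {N : ℕ}
    (F : K.CoTot) (hF : F ∈ K.cocycles (N + 1)) :
    ∃ φ : (K.X N).X 1 →ₗ[R] R,
      φ ∘ₗ K.dv 1 N = 0 ∧ φ ∘ₗ K.dh 1 N = 0 ∧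
      F - K.cosingle 1 N φ ∈ K.coboundaries (N + 1) := by
  obtain ⟨G, hG1, hG2⟩ := K.exists_sub_totCoD_mem_filtGE (hK.coexact) N (N + 1)
    le_rfl F hF.1 (LinearMap.mem_ker.1 hF.2)
  set F' := F - K.totCoD G with hF'
  have h1 : F' ∈ K.cohomog (N + 1) := sub_mem hF.1 (K.totCoD_mem_cohomog hG1)
  have h2 : K.totCoD F' = 0 := by
    rw [hF', map_sub, LinearMap.mem_ker.1 hF.2, K.totCoD_totCoD, sub_zero]
  have hv : F' 1 N ∘ₗ K.dv 1 N = 0 := by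
    have h5 : K.totCoD F' 2 N = 0 := congrFun (congrFun h2 2) N
    rw [K.totCoD_apply, K.codv_succ, K.codh_eq_zero, smul_zero, add_zero] at h5
    · exact h5
    · rintro b rfl
      rw [hG2 _ _ (by omega), LinearMap.zero_comp]
  have hh : F' 1 N ∘ₗ K.dh 1 N = 0 := by
    have h5 : K.totCoD F' 1 (N + 1) = 0 := congrFun (congrFun h2 1) (N + 1)
    rw [K.totCoD_apply, K.codv_succ, K.codh_succ, hK.dv_zero, LinearMap.comp_zero, zero_add, pow_one] at h5
    exact neg_eq_zero.1 ((neg_one_smul R (F' 1 N ∘ₗ K.dh 1 N)).symm.trans h5)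
  refine ⟨F' 1 N, hv, hh, ?_⟩
  suffices h : ∃ G' ∈ K.cohomogPred (N + 1), F' - K.cosingle 1 N (F' 1 N) = K.totCoD G' by
    obtain ⟨G', hG', h⟩ := h
    refine ⟨G + G', add_mem hG1 hG', ?_⟩
    rw [map_add, ← h, hF']
    abel
  have key : ∀ G' ∈ K.cohomogPred (N + 1), F' 0 (N + 1) = K.totCoD G' 0 (N + 1) →
      (∀ a, K.totCoD G' (a + 1) N = 0) → K.totCoD G' ∈ K.filtGE N →
      F' - K.cosingle 1 N (F' 1 N) = K.totCoD G' := by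
    intro G' hG' h3 h4 h5
    funext a b
    change F' a b - K.cosingle 1 N (F' 1 N) a b = K.totCoD G' a b
    by_cases hab : a + b = N + 1
    · rcases lt_trichotomy b N with hb | rfl | hb
      · rw [hG2 _ _ hb, h5 _ _ hb, K.cosingle_ne _ (by omega), sub_zero]
      · obtain rfl : a = 1 := by omega
        rw [K.cosingle_same, sub_self, h4]
      · obtain ⟨rfl, rfl⟩ : a = 0 ∧ b = N + 1 := by omega
        rw [K.cosingle_ne _ (by omega), sub_zero, h3]
    · rw [h1 _ _ hab, K.totCoD_mem_cohomog hG' _ _ hab, K.cosingle_ne _ (by omega), sub_zero]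
  by_cases hN : Even N
  · refine ⟨0, zero_mem _, key 0 (zero_mem _) ?_ (fun a => by rw [map_zero]; rfl)
      (by rw [map_zero]; exact zero_mem _)⟩
    have h5 : K.totCoD F' 0 (N + 2) = 0 := congrFun (congrFun h2 0) (N + 2)
    rw [K.totCoD_apply, K.codh_succ, K.codv_eq_zero (by simp), zero_add, pow_zero, one_smul] at h5
    rw [map_zero]
    refine LinearMap.ext fun c => ?_
    obtain ⟨b, rfl⟩ := (hK.row (N + 1)
      (by rwa [Nat.even_add_one, not_not])).2 c
    exact LinearMap.congr_fun h5 b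
  · let e := LinearEquiv.ofBijective _ (hK.row N hN)
    let ψ : (K.X N).X 0 →ₗ[R] R := F' 0 (N + 1) ∘ₗ e.symm.toLinearMap
    refine ⟨K.cosingle 0 N ψ, K.cosingle_mem_cohomogPred (by omega) ψ,
      key _ (K.cosingle_mem_cohomogPred (by omega) ψ) ?_ ?_ ?_⟩
    · rw [K.totCoD_cosingle_dh, pow_zero, one_smul]
      refine LinearMap.ext fun c => ?_
      exact congrArg (F' 0 (N + 1)) (e.symm_apply_apply c).symm
    · intro a
      by_cases ha : a = 0
      · subst ha
        rw [K.totCoD_cosingle_dv, hK.dv_zero, LinearMap.comp_zero]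
      · exact K.totCoD_cosingle_ne ψ (by omega) (by omega)
    · exact fun a b hb => K.totCoD_cosingle_ne ψ (by omega) (by omega)

end Bicomplex

/-! ### Homology of degreewise free simplicial groups -/

section FreeHomology
variable (R : Type) [CommRing R] {Γ : SimplicialObject GrpCat.{0}}

theorem barFace_zero_single (q : ℕ) (g : Fin 0 → Γ _⦋q + 1⦌) (a : R) :
    barFace R Γ 0 q (Finsupp.single g a) =
      (if Even q then (0 : ℤ) else 1) • Finsupp.single default a := by
  have h : ∀ i : Fin (q + 2), Finsupp.single (Γ.δ i ∘ g : Fin 0 → Γ _⦋q⦌) a =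
      Finsupp.single default a := fun i => by rw [Subsingleton.elim (_ ∘ _ : Fin 0 → _) default]
  rw [barFace_single]
  simp only [h]
  rw [← Finset.sum_smul, Fin.sum_univ_eq_sum_range fun i => (-1 : ℤ) ^ i, neg_one_geom_sum]
  simp only [Nat.even_add_one, not_not]

theorem barFace_zero_bijective {q : ℕ} (hq : ¬ Even q) : Function.Bijective (barFace R Γ 0 q) := by
  have h : (barFace R Γ 0 q) = (Finsupp.domLCongr (R := R) (M := R)
      (Equiv.ofUnique (Fin 0 → Γ _⦋q + 1⦌) (Fin 0 → Γ _⦋q⦌))).toLinearMap := by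
    refine Finsupp.lhom_ext fun g a => ?_
    rw [barFace_zero_single, if_neg hq, one_smul]
    simp only [LinearEquiv.coe_coe, Finsupp.domLCongr_single]
    rw [Subsingleton.elim default]
  rw [h]
  exact LinearEquiv.bijective _

/-- Bar bicomplexes of degreewise free simplicial groups have the properties on which the reduction to the row of internal
degree `1` rests. -/
theorem barLike (hΓ : ∀ m, IsFreeGroup (Γ.obj m)) : (bic (Cyclic.bar R) Γ).BarLike where
  exact := barBicomplex_exact R Γ hΓ
  coexact := barBicomplex_coexact R Γ hΓ
  dv_zero q := barD_zero R (Γ _⦋q⦌)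
  row _ hq := barFace_zero_bijective R hq

/-- A cycle of filtration `≤ N` whose leading class in `H_1(BΓ_N; ℤ)` is a boundary of the complex `H_1(BΓ_*; ℤ)` is
a boundary. -/
theorem mem_boundaries_of_class_eq (hΓ : ∀ m, IsFreeGroup (Γ.obj m)) {N : ℕ}
    (z : (bic (Cyclic.bar ℤ) Γ).Tot) (h1 : z ∈ (bic (Cyclic.bar ℤ) Γ).cycles (N + 1))
    (h2 : z ∈ (bic (Cyclic.bar ℤ) Γ).filtLT (N + 1)) (a : (simplicialAb Γ) _⦋N + 1⦌)
    (ha : altFace (simplicialAb Γ) N a = barClass Γ N (z 1 N)) :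
    z ∈ (bic (Cyclic.bar ℤ) Γ).boundaries (N + 1) := by
  obtain ⟨e, rfl⟩ := barClass_surjective Γ (N + 1) a
  let c : (Fin 1 → Γ _⦋N⦌) →₀ ℤ := z 1 N
  have h3 : barClass Γ N (c - barFace ℤ Γ 1 N e) = 0 := by
    rw [map_sub, barClass_barFace, ha, sub_self]
  obtain ⟨b, hb⟩ := (barClass_eq_zero_iff Γ N _).1 h3
  exact (barLike ℤ hΓ).mem_boundaries_of_leading z h1 h2 e b hb

/-- The leading class of a cycle is a cycle of the complex `H_1(BΓ_*; ℤ)`. -/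
theorem altFace_class_eq_zero {M : ℕ}
    (z : (bic (Cyclic.bar ℤ) Γ).Tot) (h1 : z ∈ (bic (Cyclic.bar ℤ) Γ).cycles (M + 2)) :
    altFace (simplicialAb Γ) M (barClass Γ (M + 1) (z 1 (M + 1))) = 0 := by
  have h3 : barD ℤ (Γ _⦋M⦌) 1 (z 2 M) + (-1 : ℤ) ^ 1 • barFace ℤ Γ 1 M (z 1 (M + 1)) = 0 :=
    congrFun (congrFun (LinearMap.mem_ker.1 h1.2) 1) M
  refine (barClass_barFace Γ M _).symm.trans ((barClass_eq_zero_iff Γ M _).2 ⟨z 2 M, ?_⟩)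
  rwa [pow_one, neg_smul, one_smul, add_neg_eq_zero] at h3

/-- A cycle of the complex `H_1(BΓ_*; ℤ)` is the leading class of a cycle of the bar bicomplex. -/
theorem exists_cycle_of_altFace (hΓ : ∀ m, IsFreeGroup (Γ.obj m)) {M : ℕ}
    (c : (Fin 1 → Γ _⦋M + 1⦌) →₀ ℤ)
    (hc : altFace (simplicialAb Γ) M (barClass Γ (M + 1) c) = 0) :
    ∃ z : (bic (Cyclic.bar ℤ) Γ).cycles (M + 2), z.1 ∈ (bic (Cyclic.bar ℤ) Γ).filtLT (M + 2) ∧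
      z.1 1 (M + 1) = c := by
  rw [← barClass_barFace] at hc
  obtain ⟨b, hb⟩ := (barClass_eq_zero_iff Γ M _).1 hc
  exact (barLike ℤ hΓ).exists_cycle_succ c b hb

/-- The cochain on the bar complex given by a homomorphism on the abelianization. -/
def cochainOf {q : ℕ} (ψ : (simplicialAb Γ) _⦋q⦌ →+ ℤ) :
    ((bic (Cyclic.bar ℤ) Γ).X q).X 1 →ₗ[ℤ] ℤ :=
  ((ψ.comp (barClass Γ q)).toIntLinearMap : ((Fin 1 → Γ _⦋q⦌) →₀ ℤ) →ₗ[ℤ] ℤ)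

theorem cochainOf_apply {q : ℕ} (ψ : (simplicialAb Γ) _⦋q⦌ →+ ℤ) (c : (Fin 1 → Γ _⦋q⦌) →₀ ℤ) :
    cochainOf ψ c = ψ (barClass Γ q c) := rfl

theorem cochainOf_barSymbol {q : ℕ} (ψ : (simplicialAb Γ) _⦋q⦌ →+ ℤ) (g : Γ _⦋q⦌) :
    cochainOf ψ (barSymbol ℤ Γ g) = ψ (abOf Γ g) := by
  refine (cochainOf_apply ψ _).trans (congrArg ψ ?_)
  exact (barClass_single Γ q _ 1).trans (one_smul _ _)

theorem cochainOf_dv {q : ℕ} (ψ : (simplicialAb Γ) _⦋q⦌ →+ ℤ) :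
    cochainOf ψ ∘ₗ (bic (Cyclic.bar ℤ) Γ).dv 1 q = 0 := by
  refine LinearMap.ext fun c => ?_
  change ψ (barClass Γ q (barD ℤ (Γ _⦋q⦌) 1 c)) = 0
  rw [(barClass_eq_zero_iff Γ q _).2 ⟨c, rfl⟩, map_zero]

theorem cochainOf_dh {q : ℕ} (ψ : (simplicialAb Γ) _⦋q⦌ →+ ℤ) :
    cochainOf ψ ∘ₗ (bic (Cyclic.bar ℤ) Γ).dh 1 q =
      cochainOf (ψ.comp (altFace (simplicialAb Γ) q)) := by
  refine LinearMap.ext fun c => ?_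
  change ψ (barClass Γ q (barFace ℤ Γ 1 q c)) = ψ (altFace _ q (barClass Γ (q + 1) c))
  exact congrArg ψ (barClass_barFace Γ q c)

theorem cochainOf_zero {q : ℕ} : cochainOf (0 : (simplicialAb Γ) _⦋q⦌ →+ ℤ) = 0 := rfl

/-- The cochains on `BΓ_q` of degree `1` that are cocycles are the homomorphisms. -/
theorem exists_eq_cochainOf {q : ℕ} (φ : ((bic (Cyclic.bar ℤ) Γ).X q).X 1 →ₗ[ℤ] ℤ)
    (hφ : φ ∘ₗ (bic (Cyclic.bar ℤ) Γ).dv 1 q = 0) :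
    ∃ ψ : (simplicialAb Γ) _⦋q⦌ →+ ℤ, φ = cochainOf ψ := by
  let f : ((Fin 1 → Γ _⦋q⦌) →₀ ℤ) →ₗ[ℤ] ℤ := φ
  have hf : ∀ b, f (barD ℤ (Γ _⦋q⦌) 1 b) = 0 := fun b => LinearMap.congr_fun hφ b
  let u : Γ _⦋q⦌ →* Multiplicative ℤ :=
    MonoidHom.mk' (fun g => Multiplicative.ofAdd (f (Finsupp.single (fun _ => g) 1))) fun g h => by
      refine Multiplicative.toAdd.injective ?_
      change f _ = f _ + f _
      have := hf (Finsupp.single ![g, h] 1)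
      rw [barD_pair, map_add, map_sub] at this
      linarith
  let ψ' : Additive (Abelianization (Γ _⦋q⦌)) →+ ℤ :=
    MonoidHom.toAdditiveLeft (Abelianization.lift u)
  let ψ : (simplicialAb Γ) _⦋q⦌ →+ ℤ := ψ'
  refine ⟨ψ, ?_⟩
  suffices h : f = (ψ.comp (barClass Γ q)).toIntLinearMap from h
  refine Finsupp.lhom_ext' fun g => LinearMap.ext_ring ?_
  change f (Finsupp.single g 1) = ψ (barClass Γ q (Finsupp.single g 1))
  rw [barClass_single, one_smul]
  have h1 : ψ (abOf Γ (g 0)) = f (Finsupp.single (fun _ => g 0) 1) := by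
    change Multiplicative.toAdd (Abelianization.lift u (Abelianization.of (g 0))) = _
    rw [Abelianization.lift_apply_of]
    rfl
  have h2 : (fun _ => g 0 : Fin 1 → Γ _⦋q⦌) = g := by
    funext k; rw [Subsingleton.elim k 0]
  rw [h1, h2]

/-- A coboundary of the complex `Hom(H_1(BΓ_*; ℤ), ℤ)` is a coboundary of the total complex. -/
theorem cosingle_cochainOf_mem_coboundaries {M : ℕ} (χ : (simplicialAb Γ) _⦋M⦌ →+ ℤ) :
    (bic (Cyclic.bar ℤ) Γ).cosingle 1 (M + 1) (cochainOf (χ.comp (altFace (simplicialAb Γ) M))) ∈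
      (bic (Cyclic.bar ℤ) Γ).coboundaries (M + 2) := by
  refine ⟨-(bic (Cyclic.bar ℤ) Γ).cosingle 1 M (cochainOf χ),
    neg_mem (Bicomplex.cosingle_mem_cohomogPred _ (by omega) _), ?_⟩
  rw [map_neg, ← cochainOf_dh]
  funext a b
  change -((bic (Cyclic.bar ℤ) Γ).totCoD ((bic (Cyclic.bar ℤ) Γ).cosingle 1 M (cochainOf χ)) a b) =
    _
  by_cases h1 : a = 1 ∧ b = M + 1
  · obtain ⟨rfl, rfl⟩ := h1
    rw [Bicomplex.totCoD_cosingle_dh, Bicomplex.cosingle_same, pow_one, neg_smul, one_smul, neg_neg]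
  · rw [Bicomplex.cosingle_ne _ _ (by tauto)]
    by_cases h2 : a = 2 ∧ b = M
    · obtain ⟨rfl, rfl⟩ := h2
      rw [Bicomplex.totCoD_cosingle_dv, cochainOf_dv, neg_zero]
    · rw [Bicomplex.totCoD_cosingle_ne _ _ (by tauto) (by tauto), neg_zero]

end FreeHomology

/-! ### Letters of reduced words -/

section Letters
variable {G H : Type} [Group G] [Group H] {X : Set G} {Y : Set H}

/-- The letters of the reduced word of an element occur in every word that represents it. -/
theorem Occurs.exists_mem (hX : Function.Injective (FreeGroup.lift (Subtype.val : X → G)))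
    {g y : G} (h : Occurs X g y) (L : List (X × Bool))
    (hL : FreeGroup.lift (Subtype.val : X → G) (FreeGroup.mk L) = g) :
    ∃ (hy : y ∈ X) (e : Bool), (⟨y, hy⟩, e) ∈ L := by
  classical
  obtain ⟨w, hw, hy, e, he⟩ := h
  obtain rfl : w = FreeGroup.mk L := hX (hw.trans hL.symm)
  refine ⟨hy, e, ?_⟩
  have h1 : (⟨y, hy⟩, e) ∈ FreeGroup.reduce L := by
    convert he using 1
    rw [FreeGroup.toWord_mk]
  exact (FreeGroup.reduce.red (L := L)).sublist.mem h1

theorem Occurs.mem {g y : G} (h : Occurs X g y) : y ∈ X := by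
  obtain ⟨_, _, h, _⟩ := h
  exact h

theorem occurs_self {y : G} (hy : y ∈ X) : Occurs X y y := by
  classical
  refine ⟨FreeGroup.of ⟨y, hy⟩, FreeGroup.lift_apply_of, hy, true, ?_⟩
  rw [FreeGroup.toWord_of]
  simp

theorem Occurs.eq_of_mem (hX : Function.Injective (FreeGroup.lift (Subtype.val : X → G)))
    {g y : G} (h : Occurs X g y) (hg : g ∈ X) : y = g := by
  obtain ⟨hy, e, he⟩ := h.exists_mem hX [(⟨g, hg⟩, true)] (FreeGroup.lift_apply_of)
  simp only [List.mem_singleton, Prod.mk.injEq, Subtype.mk.injEq] at he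
  exact he.1

theorem finite_occurs (hX : Function.Bijective (FreeGroup.lift (Subtype.val : X → G))) (g : G) :
    {y | Occurs X g y}.Finite := by
  classical
  obtain ⟨w, rfl⟩ := hX.2 g
  refine (w.toWord.map fun a => (a.1 : G)).toFinset.finite_toSet.subset fun y hy => ?_
  obtain ⟨h, e, he⟩ := hy.exists_mem hX.1 w.toWord (by rw [FreeGroup.mk_toWord])
  simp only [List.coe_toFinset, List.mem_map, Set.mem_ofPred_eq]
  exact ⟨_, he, rfl⟩

/-- The letters of the image of an element under a homomorphism which maps basis elements to basis elements are
images of its letters. -/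
theorem Occurs.exists_of_map (hX : Function.Surjective (FreeGroup.lift (Subtype.val : X → G)))
    (hY : Function.Injective (FreeGroup.lift (Subtype.val : Y → H)))
    (f : G →* H) (hf : ∀ y ∈ X, f y ∈ Y) {g : G} {z : H} (h : Occurs Y (f g) z) :
    ∃ y, Occurs X g y ∧ f y = z := by
  classical
  obtain ⟨w, rfl⟩ := hX g
  let f' : X → Y := fun y => ⟨f y.1, hf y.1 y.2⟩
  have h1 : FreeGroup.lift (Subtype.val : Y → H) (FreeGroup.map f' w) =
      f (FreeGroup.lift (Subtype.val : X → G) w) := by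
    have : (FreeGroup.lift (Subtype.val : Y → H)).comp (FreeGroup.map f') =
        f.comp (FreeGroup.lift (Subtype.val : X → G)) := by
      refine FreeGroup.ext_hom _ _ fun y => ?_
      simp [f']
    exact DFunLike.congr_fun this w
  obtain ⟨hz, e, he⟩ := h.exists_mem hY (w.toWord.map fun a => (f' a.1, a.2)) (by
    rw [← h1, ← FreeGroup.map.mk, FreeGroup.mk_toWord])
  obtain ⟨⟨y, e'⟩, hy, hy2⟩ := List.mem_map.1 he
  refine ⟨y.1, ⟨w, rfl, y.2, e', by convert hy⟩, ?_⟩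
  simp only [Prod.mk.injEq] at hy2
  exact congrArg Subtype.val hy2.1

/-- If a homomorphism to the free group on a set `S` retracts the inclusion of `S`, then the subgroup generated by `S`
is free on `S`. -/
theorem lift_bijective_of_retraction (S : Set G) (r : G →* FreeGroup S)
    (hr : ∀ s : S, r s = FreeGroup.of s) :
    Function.Bijective (FreeGroup.lift (Subtype.val :
      (Subtype.val ⁻¹' S : Set (Subgroup.closure S)) → Subgroup.closure S)) := by
  let j : S → (Subtype.val ⁻¹' S : Set (Subgroup.closure S)) := fun s =>
    ⟨⟨s.1, Subgroup.subset_closure s.2⟩, s.2⟩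
  let i : (Subtype.val ⁻¹' S : Set (Subgroup.closure S)) → S := fun s => ⟨s.1.1, s.2⟩
  constructor
  · refine Function.LeftInverse.injective
      (g := (FreeGroup.map j).toFun ∘ r ∘ Subtype.val) fun w => ?_
    have : ((FreeGroup.map j).comp (r.comp (Subgroup.subtype _))).comp
        (FreeGroup.lift (Subtype.val : (Subtype.val ⁻¹' S : Set (Subgroup.closure S)) → Subgroup.closure S)) =
        MonoidHom.id _ := by
      refine FreeGroup.ext_hom _ _ fun s => ?_
      simp only [MonoidHom.comp_apply, FreeGroup.lift_apply_of, Subgroup.coe_subtype,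
        MonoidHom.id_apply]
      rw [hr (i s), FreeGroup.map.of]
    exact DFunLike.congr_fun this w
  · rintro ⟨g, hg⟩
    have h1 : S ≤ ((Subgroup.subtype (Subgroup.closure S)).comp (FreeGroup.lift
        (Subtype.val : (Subtype.val ⁻¹' S : Set (Subgroup.closure S)) → Subgroup.closure S))).range :=
      fun s hs => ⟨FreeGroup.of (j ⟨s, hs⟩), by simp [j]⟩
    obtain ⟨w, hw⟩ := (Subgroup.closure_le _).2 h1 hg
    exact ⟨w, Subtype.ext hw⟩

end Letters

/-! ### Degenerate generators -/

section Simplex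

theorem exists_epi_mono_fac {m k : SimplexCategory} (θ : m ⟶ k) :
    ∃ (j : ℕ) (e : m ⟶ ⦋j⦌) (i : ⦋j⦌ ⟶ k), Epi e ∧ Mono i ∧ e ≫ i = θ :=
  ⟨(Limits.image θ).len, Limits.factorThruImage θ, Limits.image.ι θ, inferInstance,
    inferInstance, Limits.image.fac θ⟩

variable {Γ : SimplicialObject GrpCat.{0}} {X : ∀ m : SimplexCategoryᵒᵖ, Set (Γ.obj m)}

theorem map_comp_op {a b c : SimplexCategory} (f : a ⟶ b) (g : b ⟶ c) (x : Γ.obj (op c)) :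
    Γ.map (f ≫ g).op x = Γ.map f.op (Γ.map g.op x) := by
  rw [op_comp, Γ.map_comp]; rfl

theorem map_id_op {a : SimplexCategory} (x : Γ.obj (op a)) : Γ.map (𝟙 a : a ⟶ a).op x = x := by
  rw [op_id, Γ.map_id]; rfl

/-- A set of generators closed under degeneracies is closed under all surjective operators. -/
theorem IsFreeSimplicialBasis.map_epi_mem (hX : IsFreeSimplicialBasis Γ X) {m k : ℕ}
    (e : ⦋m⦌ ⟶ ⦋k⦌) [Epi e] (y : Γ _⦋k⦌) (hy : y ∈ X (op ⦋k⦌)) :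
    Γ.map e.op y ∈ X (op ⦋m⦌) := by
  induction m generalizing k with
  | zero =>
    obtain rfl : k = 0 := by have := SimplexCategory.le_of_epi e; omega
    obtain rfl := SimplexCategory.eq_id_of_epi e
    rwa [map_id_op]
  | succ m ih =>
    by_cases h : m + 1 = k
    · subst h
      obtain rfl := SimplexCategory.eq_id_of_epi e
      rwa [map_id_op]
    · obtain ⟨i, e', rfl⟩ := SimplexCategory.eq_σ_comp_of_not_injective e (by
        rw [← SimplexCategory.mono_iff_injective]
        intro hm
        have h1 := SimplexCategory.le_of_epi e
        have h2 := SimplexCategory.len_le_of_mono e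
        simp at h2
        omega)
      have : Epi e' := epi_of_epi (SimplexCategory.σ i) e'
      rw [map_comp_op]
      exact hX.2 m i _ (ih e' y hy)

end Simplex

/-! ### The generators of the local group -/

section LocalGenerators
variable (Γ : SimplicialObject GrpCat.{0}) (X : ∀ m : SimplexCategoryᵒᵖ, Set (Γ.obj m))
    (N : ℕ) (xt : Γ _⦋N⦌) (W : Set (Γ _⦋N - 1⦌))

/-- The elements from which the generators of the local group arise by simplicial operators, in their original
degrees. -/
inductive BaseGen : (d : ℕ) → Γ _⦋d⦌ → Prop where
  /-- The generators of degree `0`. -/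
  | zero (y : Γ _⦋0⦌) : y ∈ X (op ⦋0⦌) → BaseGen 0 y
  /-- The generators of degree `1`. -/
  | one (y : Γ _⦋1⦌) : y ∈ X (op ⦋1⦌) → BaseGen 1 y
  /-- The elements of `W`. -/
  | comm (y : Γ _⦋N - 1⦌) : 2 ≤ N → y ∈ W → BaseGen (N - 1) y
  /-- The letters of the proper faces of `xt`. -/
  | bdry {d : ℕ} (i : ⦋d⦌ ⟶ ⦋N⦌) (y : Γ _⦋d⦌) : 2 ≤ N → d < N →
      Occurs (X (op ⦋d⦌)) (Γ.map i.op xt) y → BaseGen d y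

/-- The closure of `BaseGen` under letters of proper faces. Every generator of the local group is a degeneracy of such
an element. -/
inductive CoreGen : (d : ℕ) → Γ _⦋d⦌ → Prop where
  /-- The elements of `BaseGen`. -/
  | base {d : ℕ} (y : Γ _⦋d⦌) : BaseGen Γ X N xt W d y → CoreGen d y
  /-- The letters of the proper faces of an element. -/
  | face {d k : ℕ} (i : ⦋d⦌ ⟶ ⦋k⦌) (z : Γ _⦋k⦌) (y : Γ _⦋d⦌) : d < k → CoreGen k z →
      Occurs (X (op ⦋d⦌)) (Γ.map i.op z) y → CoreGen d y

variable {Γ X N xt W}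

theorem CoreGen.le {d : ℕ} {y : Γ _⦋d⦌} (h : CoreGen Γ X N xt W d y) : d ≤ max 1 (N - 1) := by
  induction h with
  | base y h => cases h <;> omega
  | face i z y h _ _ ih => omega

theorem CoreGen.localGen {d : ℕ} {y : Γ _⦋d⦌} (h : CoreGen Γ X N xt W d y) :
    LocalGen Γ X N xt W (op ⦋d⦌) y := by
  induction h with
  | base y h =>
    cases h with
    | zero _ h => exact LocalGen.zero (X := X) _ h
    | one _ h => exact LocalGen.one (X := X) _ h
    | comm _ hN h => exact LocalGen.comm (X := X) _ hN h
    | bdry i _ hN hd h =>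
      refine LocalGen.bdry (k := op ⦋_⦌) i y hN ?_ h
      rw [← SimplexCategory.epi_iff_surjective]
      intro
      have := SimplexCategory.le_of_epi i
      omega
  | face i z y h _ hy ih => exact LocalGen.oper i.op z y ih hy

theorem LocalGen.mem (hW : 2 ≤ N → W ⊆ X (op ⦋N - 1⦌)) {m : SimplexCategoryᵒᵖ} {y : Γ.obj m}
    (h : LocalGen Γ X N xt W m y) : y ∈ X m := by
  cases h with
  | zero _ h => exact h
  | one _ h => exact h
  | comm _ hN h => exact hW hN h
  | bdry _ _ _ _ h => exact h.mem
  | oper _ _ _ _ h => exact h.mem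

theorem CoreGen.mem (hW : 2 ≤ N → W ⊆ X (op ⦋N - 1⦌)) {d : ℕ} {y : Γ _⦋d⦌}
    (h : CoreGen Γ X N xt W d y) : y ∈ X (op ⦋d⦌) := h.localGen.mem hW

theorem Occurs.exists_of_epi (hX : IsFreeSimplicialBasis Γ X) {m k : ℕ}
    (e : ⦋m⦌ ⟶ ⦋k⦌) [Epi e] {g : Γ _⦋k⦌} {z : Γ _⦋m⦌}
    (h : Occurs (X (op ⦋m⦌)) (Γ.map e.op g) z) :
    ∃ y, Occurs (X (op ⦋k⦌)) g y ∧ Γ.map e.op y = z :=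
  Occurs.exists_of_map (hX.1 _).2 (hX.1 _).1 (Γ.map e.op).hom (fun y hy => hX.map_epi_mem e y hy) h

/-- Every generator of the local group which comes from `Γ` is a degeneracy of a core generator. -/
theorem LocalGen.exists_core (hX : IsFreeSimplicialBasis Γ X) (hW : 2 ≤ N → W ⊆ X (op ⦋N - 1⦌))
    {m : SimplexCategoryᵒᵖ} {y : Γ.obj m} (h : LocalGen Γ X N xt W m y) :
    ∃ (d : ℕ) (e : m.unop ⟶ ⦋d⦌) (z : Γ _⦋d⦌), Epi e ∧ CoreGen Γ X N xt W d z ∧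
      Γ.map e.op z = y := by
  induction h with
  | zero y h => exact ⟨0, 𝟙 _, y, inferInstance, .base _ (.zero _ h), map_id_op y⟩
  | one y h => exact ⟨1, 𝟙 _, y, inferInstance, .base _ (.one _ h), map_id_op y⟩
  | comm y hN h => exact ⟨_, 𝟙 _, y, inferInstance, .base _ (.comm _ hN h), map_id_op y⟩
  | @bdry k θ y hN hθ h =>
    obtain ⟨m, rfl⟩ : ∃ m : ℕ, k = op ⦋m⦌ := ⟨k.unop.len, rfl⟩
    obtain ⟨j, e, i, he, hi, rfl⟩ := exists_epi_mono_fac θ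
    rw [map_comp_op] at h
    obtain ⟨z, hz, rfl⟩ := h.exists_of_epi hX e
    refine ⟨j, e, z, he, .base _ (.bdry i z hN ?_ hz), rfl⟩
    refine lt_of_le_of_ne (SimplexCategory.len_le_of_mono i) ?_
    rintro rfl
    obtain rfl := SimplexCategory.eq_id_of_mono i
    rw [← SimplexCategory.epi_iff_surjective] at hθ
    exact hθ (by rw [Category.comp_id]; exact he)
  | @oper m k θ z y hz hy ih =>
    obtain ⟨d, e, z, he, hc, rfl⟩ := ih
    obtain ⟨k, rfl⟩ : ∃ l : ℕ, k = op ⦋l⦌ := ⟨k.unop.len, rfl⟩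
    have h1 : Γ.map θ (Γ.map e.op z) = Γ.map (θ.unop ≫ e).op z := (map_comp_op θ.unop e z).symm
    rw [h1] at hy
    obtain ⟨j, e', i, he', hi, hfac⟩ := exists_epi_mono_fac (θ.unop ≫ e)
    rw [← hfac, map_comp_op] at hy
    obtain ⟨z', hz', rfl⟩ := hy.exists_of_epi hX e'
    refine ⟨j, e', z', he', ?_, rfl⟩
    rcases (SimplexCategory.len_le_of_mono i).lt_or_eq with h | h
    · exact .face i z z' h hc hz'
    · obtain rfl : j = d := h
      obtain rfl := SimplexCategory.eq_id_of_mono i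
      rw [map_id_op] at hz'
      rwa [hz'.eq_of_mem (hX.1 _).1 (hc.mem hW)]

theorem finite_baseGen (hX : IsFreeSimplicialBasis Γ X) (h0 : (X (op ⦋0⦌)).Finite)
    (h1 : (X (op ⦋1⦌)).Finite) (hW : 2 ≤ N → W.Finite) (d : ℕ) :
    {y | BaseGen Γ X N xt W d y}.Finite := by
  have h2 : {y : Γ _⦋d⦌ | ∃ (h : d = 0), h ▸ y ∈ X (op ⦋0⦌)}.Finite := by
    by_cases h : d = 0
    · subst h; simpa using h0
    · simp [h]
  have h3 : {y : Γ _⦋d⦌ | ∃ (h : d = 1), h ▸ y ∈ X (op ⦋1⦌)}.Finite := by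
    by_cases h : d = 1
    · subst h; simpa using h1
    · simp [h]
  have h4 : {y : Γ _⦋d⦌ | 2 ≤ N ∧ ∃ (h : d = N - 1), h ▸ y ∈ W}.Finite := by
    by_cases h : d = N - 1
    · subst h
      by_cases hN : 2 ≤ N
      · simpa [hN] using hW hN
      · simp [hN]
    · simp [h]
  have h5 : (⋃ i : ⦋d⦌ ⟶ ⦋N⦌, {y | Occurs (X (op ⦋d⦌)) (Γ.map i.op xt) y}).Finite :=
    Set.finite_iUnion fun i => finite_occurs (hX.1 _) _
  refine (((h2.union h3).union h4).union h5).subset fun y hy => ?_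
  cases hy with
  | zero _ h => exact Or.inl (Or.inl (Or.inl ⟨rfl, h⟩))
  | one _ h => exact Or.inl (Or.inl (Or.inr ⟨rfl, h⟩))
  | comm _ hN h => exact Or.inl (Or.inr ⟨hN, rfl, h⟩)
  | bdry i _ _ _ h => exact Or.inr (Set.mem_iUnion.2 ⟨i, h⟩)

theorem finite_coreGen (hX : IsFreeSimplicialBasis Γ X) (h0 : (X (op ⦋0⦌)).Finite)
    (h1 : (X (op ⦋1⦌)).Finite) (hW : 2 ≤ N → W.Finite) (d : ℕ) :
    {y | CoreGen Γ X N xt W d y}.Finite := by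
  induction hn : max 1 (N - 1) + 1 - d using Nat.strong_induction_on generalizing d with
  | _ n ih =>
    subst hn
    have h2 : (⋃ k : {k : Fin (max 1 (N - 1) + 1) // d < k}, ⋃ i : ⦋d⦌ ⟶ ⦋(k.1 : ℕ)⦌,
        ⋃ z ∈ {z | CoreGen Γ X N xt W k.1 z},
          {y | Occurs (X (op ⦋d⦌)) (Γ.map i.op z) y}).Finite := by
      refine Set.finite_iUnion fun k => Set.finite_iUnion fun i => Set.Finite.biUnion ?_
        fun z _ => finite_occurs (hX.1 _) _
      have := k.1.2
      have := k.2
      exact ih _ (by omega) k.1 rfl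
    refine ((finite_baseGen (xt := xt) hX h0 h1 hW d).union h2).subset fun y hy => ?_
    cases hy with
    | base _ h => exact Or.inl h
    | @face _ k i z _ hd hz h =>
      refine Or.inr ?_
      simp only [Set.mem_iUnion]
      exact ⟨⟨⟨k, Nat.lt_succ_of_le hz.le⟩, hd⟩, i, z, hz, h⟩

theorem finite_localGen (hX : IsFreeSimplicialBasis Γ X) (h0 : (X (op ⦋0⦌)).Finite)
    (h1 : (X (op ⦋1⦌)).Finite) (hW : 2 ≤ N → W.Finite) (hW2 : 2 ≤ N → W ⊆ X (op ⦋N - 1⦌))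
    (m : SimplexCategoryᵒᵖ) : {y | LocalGen Γ X N xt W m y}.Finite := by
  have h2 : (⋃ k : Fin (max 1 (N - 1) + 1), ⋃ e : m.unop ⟶ ⦋(k : ℕ)⦌,
      (Γ.map e.op) '' {z | CoreGen Γ X N xt W k z}).Finite :=
    Set.finite_iUnion fun k => Set.finite_iUnion fun e =>
      (finite_coreGen hX h0 h1 hW k).image _
  refine h2.subset fun y hy => ?_
  obtain ⟨d, e, z, -, hz, rfl⟩ := hy.exists_core hX hW2
  simp only [Set.mem_iUnion]
  exact ⟨⟨d, Nat.lt_succ_of_le hz.le⟩, e, z, hz, rfl⟩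

end LocalGenerators

/-! ### Structure of the local group -/

namespace FreeResolution
variable {A : SimplicialObject.Augmented GrpCat.{0}} (R : FreeResolution A) {N : ℕ}
  (xt : A.left _⦋N⦌) (W : Set (A.left _⦋N - 1⦌))

open Classical in
/-- The retraction of the free product onto the free group on the generators of the local group: generators of `Γ` which
do not belong to the local group go to `1`. -/
def attachRetraction (m : SimplexCategoryᵒᵖ) :
    AttachGroup A.left N m →* FreeGroup (localSet A.left R.gens N xt W m) :=
  Monoid.Coprod.lift
    ((FreeGroup.lift fun y : R.gens m =>
      if h : Monoid.Coprod.inl y.1 ∈ localSet A.left R.gens N xt W m then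
        FreeGroup.of ⟨_, h⟩ else 1).comp
      (MulEquiv.ofBijective _ (R.isBasis.1 m)).symm.toMonoidHom)
    (FreeGroup.lift fun σ =>
      if h : Monoid.Coprod.inr (FreeGroup.of σ) ∈ localSet A.left R.gens N xt W m then
        FreeGroup.of ⟨_, h⟩ else 1)

variable {W}

theorem attachRetraction_apply (hW : 2 ≤ N → R.IsCommutatorSupport xt W) (m : SimplexCategoryᵒᵖ)
    (s : localSet A.left R.gens N xt W m) : R.attachRetraction xt W m s = FreeGroup.of s := by
  obtain ⟨s, hs⟩ := s
  rcases id hs with (⟨y, hy, rfl⟩ | ⟨hN, σ, rfl⟩)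
  · have hy2 : y ∈ R.gens m := hy.mem fun hN => (hW hN).subset
    have h : (MulEquiv.ofBijective _ (R.isBasis.1 m)).symm y = FreeGroup.of ⟨y, hy2⟩ := by
      rw [MulEquiv.symm_apply_eq]
      exact (FreeGroup.lift_apply_of (f := (Subtype.val : R.gens m → A.left.obj m))
        (x := ⟨y, hy2⟩)).symm
    simp only [attachRetraction, Monoid.Coprod.lift_apply_inl, MonoidHom.comp_apply]
    refine (congrArg _ h).trans ?_
    rw [FreeGroup.lift_apply_of, dif_pos hs]
  · simp only [attachRetraction, Monoid.Coprod.lift_apply_inr, FreeGroup.lift_apply_of]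
    rw [dif_pos hs]

/-- The local group is free on its generators: they form part of a free basis of the group with the symbol attached, and
collapsing the rest of that basis is a retraction onto the free group on them. -/
theorem localGens_bijective (hW : 2 ≤ N → R.IsCommutatorSupport xt W) (m : SimplexCategoryᵒᵖ) :
    Function.Bijective (FreeGroup.lift
      (Subtype.val : R.localGens xt W m → (R.localGroup xt W).obj m)) :=
  lift_bijective_of_retraction (localSet A.left R.gens N xt W m) (R.attachRetraction xt W m)
    (R.attachRetraction_apply xt hW m)

theorem isFreeGroup_localGroup (hW : 2 ≤ N → R.IsCommutatorSupport xt W) (m : SimplexCategoryᵒᵖ) :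
    IsFreeGroup ((R.localGroup xt W).obj m) :=
  .ofMulEquiv (MulEquiv.ofBijective _ (R.localGens_bijective xt hW m))

theorem isFreeGroup {A : SimplicialObject.Augmented GrpCat.{0}} (R : FreeResolution A)
    (m : SimplexCategoryᵒᵖ) : IsFreeGroup (A.left.obj m) :=
  .ofMulEquiv (MulEquiv.ofBijective _ (R.isBasis.1 m))

theorem localGens_map_surj (hW : 2 ≤ N → R.IsCommutatorSupport xt W) {m k : SimplexCategoryᵒᵖ}
    (θ : m ⟶ k) (hθ : Function.Surjective θ.unop.toOrderHom)
    (hθ2 : ∀ y ∈ R.gens m, A.left.map θ y ∈ R.gens k)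
    (g : (R.localGroup xt W).obj m) (hg : g ∈ R.localGens xt W m) :
    (R.localGroup xt W).map θ g ∈ R.localGens xt W k := by
  obtain ⟨g, hg'⟩ := g
  rcases hg with (⟨y, hy, rfl⟩ | ⟨hN, σ, rfl⟩)
  · exact Or.inl ⟨A.left.map θ y, LocalGen.oper θ y _ hy
      (occurs_self (hθ2 y (hy.mem fun hN => (hW hN).subset))), rfl⟩
  · have h : Function.Surjective (θ.unop ≫ σ.1).toOrderHom := σ.2.comp hθ
    refine Or.inr ⟨hN, ⟨_, h⟩, ?_⟩
    change attachMap xt θ (Monoid.Coprod.inr (FreeGroup.of σ)) = _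
    simp only [attachMap, Monoid.Coprod.lift_apply_inr, FreeGroup.lift_apply_of]
    rw [attachGen, dif_pos h]

theorem isFreeSimplicialBasis_localGens (hW : 2 ≤ N → R.IsCommutatorSupport xt W) :
    IsFreeSimplicialBasis (R.localGroup xt W) (R.localGens xt W) :=
  ⟨R.localGens_bijective xt hW, fun m i => R.localGens_map_surj xt hW (SimplexCategory.σ i).op
    (SimplexCategory.epi_iff_surjective.1 (inferInstanceAs (Epi (SimplexCategory.σ i))))
    (R.isBasis.2 m i)⟩

theorem finite_localGens (hW : 2 ≤ N → R.IsCommutatorSupport xt W) (m : SimplexCategoryᵒᵖ) :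
    (R.localGens xt W m).Finite := by
  have h1 := finite_localGen (N := N) (xt := xt) (W := W) R.isBasis R.finite_zero R.finite_one
    (fun hN => (hW hN).finite) (fun hN => (hW hN).subset) m
  refine Set.Finite.preimage Subtype.val_injective.injOn
    (((h1.image Monoid.Coprod.inl).union (Set.finite_range fun σ : Surj N m =>
      (Monoid.Coprod.inr (FreeGroup.of σ) : AttachGroup A.left N m))).subset ?_)
  rintro _ (⟨y, hy, rfl⟩ | ⟨hN, σ, rfl⟩)
  · exact Or.inl ⟨y, hy, rfl⟩
  · exact Or.inr ⟨σ, rfl⟩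

variable (W)

/-- An element of `Γ` all of whose letters generate the local group, as an element of the local group. -/
def ofBase {m : SimplexCategoryᵒᵖ} (g : A.left.obj m)
    (hg : ∀ y, Occurs (R.gens m) g y → LocalGen A.left R.gens N xt W m y) :
    (R.localGroup xt W).obj m :=
  ⟨Monoid.Coprod.inl g, inl_mem_localSubgroup N xt W R.surj_gens g hg⟩

theorem incl_ofBase {m : SimplexCategoryᵒᵖ} (g : A.left.obj m)
    (hg : ∀ y, Occurs (R.gens m) g y → LocalGen A.left R.gens N xt W m y) :
    (R.incl xt W).app m (R.ofBase xt W g hg) = g :=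
  Monoid.Coprod.lift_apply_inl (MonoidHom.id (A.left.obj m))
    (FreeGroup.lift fun σ : Surj N m => A.left.map σ.1.op xt) g

theorem fund_val_of_le (hN : 2 ≤ N) : (R.fund xt W).1 = Monoid.Coprod.inr
    (FreeGroup.of (⟨𝟙 _, fun y => ⟨y, by simp⟩⟩ : Surj N (op ⦋N⦌))) :=
  congrArg Subtype.val (dif_pos hN)

theorem fund_val_of_lt (hN : ¬ 2 ≤ N) : (R.fund xt W).1 = Monoid.Coprod.inl xt :=
  congrArg Subtype.val (dif_neg hN)

theorem incl_fund : (R.incl xt W).app (op ⦋N⦌) (R.fund xt W) = xt := by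
  change Monoid.Coprod.lift (MonoidHom.id _) (FreeGroup.lift fun σ : Surj N (op ⦋N⦌) =>
    A.left.map σ.1.op xt) (R.fund xt W).1 = xt
  by_cases hN : 2 ≤ N
  · rw [R.fund_val_of_le xt W hN, Monoid.Coprod.lift_apply_inr, FreeGroup.lift_apply_of]
    exact map_id_op xt
  · rw [R.fund_val_of_lt xt W hN]
    exact Monoid.Coprod.lift_apply_inl _ _ xt

/-- Where the symbol and its degeneracies do not occur, the local group is a subgroup of `Γ` by definition. -/
theorem incl_injective_of_le {m : SimplexCategoryᵒᵖ} (h : 2 ≤ N → m.unop.len < N) :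
    Function.Injective ((R.incl xt W).app m) := by
  have h1 : localSubgroup A.left R.gens N xt W m ≤ (Monoid.Coprod.inl :
      A.left.obj m →* AttachGroup A.left N m).range := by
    rw [localSubgroup, Subgroup.closure_le]
    rintro _ (⟨y, hy, rfl⟩ | ⟨hN, σ, rfl⟩)
    · exact ⟨y, rfl⟩
    · have : Epi σ.1 := SimplexCategory.epi_iff_surjective.2 σ.2
      have h2 : N ≤ m.unop.len := SimplexCategory.len_le_of_epi σ.1
      exact absurd (h hN) (by omega)
  rintro ⟨g, hg⟩ ⟨g', hg'⟩ hgg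
  obtain ⟨y, rfl⟩ := h1 hg
  obtain ⟨y', rfl⟩ := h1 hg'
  have h2 : y = y' := hgg
  subst h2
  rfl

theorem incl_bijective_zero : Function.Bijective ((R.incl xt W).app (op ⦋0⦌)) :=
  ⟨R.incl_injective_of_le xt W fun hN => by simp; omega,
    fun g => ⟨_, R.incl_ofBase xt W g fun y hy => .zero y hy.mem⟩⟩

theorem incl_bijective_one : Function.Bijective ((R.incl xt W).app (op ⦋1⦌)) :=
  ⟨R.incl_injective_of_le xt W fun hN => by simp; omega,
    fun g => ⟨_, R.incl_ofBase xt W g fun y hy => .one y hy.mem⟩⟩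

/-- If `2 ≤ N`, the generators of the local group in degree `N` other than the symbol `s` are degenerate. -/
theorem eq_fund_or_degenerate {M : ℕ} {xt : A.left _⦋M + 1⦌} {W : Set (A.left _⦋M⦌)}
    (hW : 2 ≤ M + 1 → R.IsCommutatorSupport xt W)
    (hM : 1 ≤ M) (g : (R.localGroup xt W) _⦋M + 1⦌) (hg : g ∈ R.localGens xt W (op ⦋M + 1⦌)) :
    g = R.fund xt W ∨ ∃ (i : Fin (M + 1)) (z : (R.localGroup xt W) _⦋M⦌),
      (R.localGroup xt W).σ i z = g := by
  obtain ⟨g, hg'⟩ := g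
  rcases hg with (⟨y, hy, rfl⟩ | ⟨hN, σ, rfl⟩)
  · right
    obtain ⟨d, e, z, he, hz, rfl⟩ := hy.exists_core R.isBasis fun hN => (hW hN).subset
    have hd : d < M + 1 := by
      have := hz.le
      omega
    obtain ⟨i, e', rfl⟩ := SimplexCategory.eq_σ_comp_of_not_injective e (by
      rw [← SimplexCategory.mono_iff_injective]
      intro hm
      have h2 := SimplexCategory.len_le_of_mono e
      simp at h2
      omega)
    have : Epi e' := epi_of_epi (SimplexCategory.σ i) e'
    have hg2 : A.left.map e'.op z ∈ R.gens (op ⦋M⦌) :=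
      R.isBasis.map_epi_mem e' z (hz.mem fun hN => (hW hN).subset)
    refine ⟨i, R.ofBase xt W (A.left.map e'.op z) fun y hy => ?_, ?_⟩
    · rw [hy.eq_of_mem (R.isBasis.1 _).1 hg2]
      exact LocalGen.oper e'.op z _ hz.localGen (occurs_self hg2)
    · exact Subtype.ext (congrArg Monoid.Coprod.inl (map_comp_op (SimplexCategory.σ i) e' z).symm)
  · left
    have : Epi σ.1 := SimplexCategory.epi_iff_surjective.2 σ.2
    have h1 : σ.1 = 𝟙 _ := SimplexCategory.eq_id_of_epi σ.1
    exact Subtype.ext ((congrArg (fun a => Monoid.Coprod.inr (FreeGroup.of a))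
      (Subtype.ext h1)).trans (R.fund_val_of_le xt W hN).symm)

end FreeResolution

/-! ### Injectivity of the map from the local group -/

section Coordinates
variable {G H : Type} [Group G] [Group H] {X : Set G} {Y : Set H}

/-- The exponent sums of the basis elements in an element of a free group with basis `X`. -/
def basisCoord (hX : Function.Bijective (FreeGroup.lift (Subtype.val : X → G))) :
    G →* Multiplicative (X →₀ ℤ) :=
  (expSum X).comp (MulEquiv.ofBijective _ hX).symm.toMonoidHom

theorem basisCoord_lift (hX : Function.Bijective (FreeGroup.lift (Subtype.val : X → G)))
    (w : FreeGroup X) :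
    basisCoord hX (FreeGroup.lift (Subtype.val : X → G) w) = expSum X w :=
  congrArg (expSum X) ((MulEquiv.ofBijective _ hX).symm_apply_apply w)

theorem basisCoord_of_mem (hX : Function.Bijective (FreeGroup.lift (Subtype.val : X → G)))
    (y : X) : (basisCoord hX y.1).toAdd = Finsupp.single y 1 := by
  have h := basisCoord_lift hX (FreeGroup.of y)
  rw [FreeGroup.lift_apply_of] at h
  rw [h]
  simp [expSum]

theorem basis_hom_ext (hX : Function.Bijective (FreeGroup.lift (Subtype.val : X → G)))
    {K : Type} [Monoid K] {u v : G →* K} (h : ∀ y ∈ X, u y = v y) : u = v := by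
  have h1 : u.comp (FreeGroup.lift (Subtype.val : X → G)) =
      v.comp (FreeGroup.lift (Subtype.val : X → G)) := by
    refine FreeGroup.ext_hom _ _ fun y => ?_
    simpa using h y.1 y.2
  refine MonoidHom.ext fun g => ?_
  obtain ⟨w, rfl⟩ := hX.2 g
  exact DFunLike.congr_fun h1 w

theorem basisCoord_map (hX : Function.Bijective (FreeGroup.lift (Subtype.val : X → G)))
    (hY : Function.Bijective (FreeGroup.lift (Subtype.val : Y → H))) (f : G →* H)
    (hf : ∀ y ∈ X, f y ∈ Y) (g : G) :
    (basisCoord hY (f g)).toAdd =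
      Finsupp.mapDomain (fun y : X => ⟨f y.1, hf y.1 y.2⟩) (basisCoord hX g).toAdd := by
  let q : (X →₀ ℤ) →+ (Y →₀ ℤ) :=
    Finsupp.mapDomain.addMonoidHom (fun y : X => ⟨f y.1, hf y.1 y.2⟩)
  have h : (basisCoord hY).comp f = (q.toMultiplicative).comp (basisCoord hX) := by
    refine basis_hom_ext hX fun y hy => Multiplicative.toAdd.injective ?_
    change (basisCoord hY (f y)).toAdd = q (basisCoord hX y).toAdd
    rw [basisCoord_of_mem hY ⟨f y, hf y hy⟩, basisCoord_of_mem hX ⟨y, hy⟩]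
    simp [q]
  exact congrArg Multiplicative.toAdd (DFunLike.congr_fun h g)

theorem abOf_eq_sum {Γ : SimplicialObject GrpCat.{0}} {m : SimplexCategoryᵒᵖ} {X : Set (Γ.obj m)}
    (hX : Function.Bijective (FreeGroup.lift (Subtype.val : X → Γ.obj m))) (g : Γ.obj m) :
    abOf Γ g = (basisCoord hX g).toAdd.sum fun y n => n • abOf Γ y.1 := by
  let q : (X →₀ ℤ) →+ Additive (Abelianization (Γ.obj m)) :=
    Finsupp.liftAddHom fun y => (zmultiplesHom _) (abOf Γ y.1)
  have hq : ∀ c, q c = c.sum fun y n => n • abOf Γ y.1 := fun c =>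
    Finsupp.liftAddHom_apply _ _
  have h : (Abelianization.of : Γ.obj m →* _) = (q.toMultiplicativeLeft).comp (basisCoord hX) := by
    refine basis_hom_ext hX fun y hy => ?_
    change abOf Γ y = q (basisCoord hX y).toAdd
    rw [basisCoord_of_mem hX ⟨y, hy⟩, hq]
    simp
  rw [← hq]
  exact DFunLike.congr_fun h g

end Coordinates

section Nondegenerate
variable {Γ : SimplicialObject GrpCat.{0}}

/-- The elements which are not degenerate. -/
def IsNondeg {n : ℕ} (y : Γ _⦋n⦌) : Prop :=
  ∀ d < n, ∀ (θ : ⦋n⦌ ⟶ ⦋d⦌) (z : Γ _⦋d⦌), Γ.map θ.op z ≠ y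

theorem exists_σ_of_not_isNondeg {n : ℕ} {y : Γ _⦋n + 1⦌} (h : ¬ IsNondeg y) :
    ∃ (i : Fin (n + 1)) (z : Γ _⦋n⦌), Γ.σ i z = y := by
  simp only [IsNondeg, not_forall, not_not, ne_eq] at h
  obtain ⟨d, hd, θ, z, rfl⟩ := h
  obtain ⟨i, θ', rfl⟩ := SimplexCategory.eq_σ_comp_of_not_injective θ (by
    rw [← SimplexCategory.mono_iff_injective]
    intro hm
    have h2 := SimplexCategory.len_le_of_mono θ
    simp at h2
    omega)
  exact ⟨i, Γ.map θ'.op z, (map_comp_op _ _ _).symm⟩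

theorem IsNondeg.ne_map {n m d : ℕ} {y : Γ _⦋n⦌} (hy : IsNondeg y) (e : ⦋m⦌ ⟶ ⦋n⦌) [Epi e]
    (hd : d < n) (θ : ⦋m⦌ ⟶ ⦋d⦌) (z : Γ _⦋d⦌) : Γ.map θ.op z ≠ Γ.map e.op y := by
  intro h
  have := isSplitEpi_of_epi e
  refine hy d hd (section_ e ≫ θ) z ?_
  rw [map_comp_op, h, ← map_comp_op, IsSplitEpi.id, map_id_op]

/-- Uniqueness in the Eilenberg–Zilber lemma. -/
theorem IsNondeg.eq_of_map_eq {n m : ℕ} {y z : Γ _⦋n⦌} (hy : IsNondeg y) (e θ : ⦋m⦌ ⟶ ⦋n⦌)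
    [Epi e] (h : Γ.map θ.op z = Γ.map e.op y) : θ = e ∧ z = y := by
  have := isSplitEpi_of_epi e
  have h1 : Γ.map (section_ e ≫ θ).op z = y := by
    rw [map_comp_op, h, ← map_comp_op, IsSplitEpi.id, map_id_op]
  obtain ⟨j, f, i, hf, hi, hfac⟩ := exists_epi_mono_fac (section_ e ≫ θ)
  have hj : j ≤ n := SimplexCategory.len_le_of_mono i
  obtain rfl : j = n := by
    by_contra hne
    refine hy j (by omega) f (Γ.map i.op z) ?_
    rw [← map_comp_op, hfac, h1]
  obtain rfl := SimplexCategory.eq_id_of_epi f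
  obtain rfl := SimplexCategory.eq_id_of_mono i
  rw [← hfac, Category.comp_id, map_id_op] at h1
  subst h1
  let S : SSet := Γ ⋙ forget GrpCat
  have hS : (z : S _⦋j⦌) ∈ S.nonDegenerate j := by
    rintro ⟨d, hd, θ', z', hz⟩
    exact hy d hd θ' z' hz
  exact ⟨(S.unique_nonDegenerate_map (Γ.map e.op z) e ⟨z, hS⟩ rfl θ ⟨z, hS⟩ h.symm).symm, rfl⟩

end Nondegenerate

namespace FreeResolution
variable {A : SimplicialObject.Augmented GrpCat.{0}} (R : FreeResolution A)

/-- A nonzero class cannot be lifted to a product, up to commutators, of degenerate generators. -/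
theorem exists_nondeg_coord_ne_zero {M : ℕ}
    {x : groupHomology (Rep.trivial ℂ A.right ℂ) (M + 2)} (hx0 : x ≠ 0) {xt : A.left _⦋M + 1⦌}
    (hx : IsLift A x xt) : ∃ y : R.gens (op ⦋M + 1⦌), IsNondeg (y.1 : A.left _⦋M + 1⦌) ∧
      (basisCoord (R.isBasis.1 (op ⦋M + 1⦌)) xt).toAdd y ≠ 0 := by
  by_contra! hc
  refine hx0 ?_
  obtain ⟨ξ, ⟨z, hz1, hz2, rfl⟩, rfl⟩ := hx
  have h1 : barClass A.left (M + 1) (z.1 1 (M + 1)) = abOf A.left xt :=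
    (congrArg (barClass A.left (M + 1)) hz2).trans
      ((barClass_single A.left (M + 1) _ 1).trans (one_smul _ _))
  have h2 : altFace (simplicialAb A.left) M (abOf A.left xt) = 0 := by
    rw [← h1]
    exact altFace_class_eq_zero z.1 z.2
  obtain ⟨a, ha⟩ := exists_altFace_eq (simplicialAb A.left) M (abOf A.left xt) h2 (by
    rw [abOf_eq_sum (R.isBasis.1 (op ⦋M + 1⦌)) xt]
    refine AddSubgroup.sum_mem _ fun y hy => AddSubgroup.zsmul_mem _ (AddSubgroup.subset_closure ?_) _
    obtain ⟨i, z', hz'⟩ := exists_σ_of_not_isNondeg fun h =>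
      (Finsupp.mem_support_iff.1 hy) (hc y h)
    exact ⟨i, abOf A.left z', congrArg (abOf A.left) hz'⟩)
  have h3 := mem_boundaries_of_class_eq R.isFreeGroup z.1 z.2 hz1 a (ha.trans h1.symm)
  have h4 : (Submodule.Quotient.mk z : barHomology ℤ A.left (M + 2)) = 0 :=
    (Submodule.Quotient.mk_eq_zero _).2 h3
  rw [h4, map_zero, map_zero]

/-- If `x ≠ 0`, a nondegenerate generator `y0` occurs in `xt` with nonzero exponent sum. The coordinates at the degeneracies
of `y0` separate the images of the degeneracies of the symbol from the other generators and from each other. -/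
theorem incl_injective_of_ne_zero {N : ℕ} {x : groupHomology (Rep.trivial ℂ A.right ℂ) (N + 1)}
    (hx0 : x ≠ 0) {xt : A.left _⦋N⦌} (hx : IsLift A x xt) {W : Set (A.left _⦋N - 1⦌)}
    (hW : 2 ≤ N → R.IsCommutatorSupport xt W) (m : SimplexCategoryᵒᵖ) :
    Function.Injective ((R.incl xt W).app m) := by
  classical
  by_cases hN : 2 ≤ N
  swap
  · exact R.incl_injective_of_le xt W (by omega)
  obtain ⟨m, rfl⟩ : ∃ k : ℕ, m = op ⦋k⦌ := ⟨m.unop.len, rfl⟩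
  obtain ⟨y0, hy0, ha⟩ : ∃ y : R.gens (op ⦋N⦌), IsNondeg (y.1 : A.left _⦋N⦌) ∧
      (basisCoord (R.isBasis.1 (op ⦋N⦌)) xt).toAdd y ≠ 0 := by
    obtain ⟨M, rfl⟩ : ∃ M, N = M + 1 := ⟨N - 1, by omega⟩
    exact R.exists_nondeg_coord_ne_zero hx0 hx
  have := (R.finite_localGens xt hW (op ⦋m⦌)).to_subtype
  let eΛ := MulEquiv.ofBijective _ (R.localGens_bijective xt hW (op ⦋m⦌))
  let eΓ := MulEquiv.ofBijective _ (R.isBasis.1 (op ⦋m⦌))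
  let φ : FreeGroup (R.localGens xt W (op ⦋m⦌)) →* FreeGroup (R.gens (op ⦋m⦌)) :=
    eΓ.symm.toMonoidHom.comp (((R.incl xt W).app (op ⦋m⦌)).hom.comp eΛ.toMonoidHom)
  suffices h : Function.Injective φ by
    intro g g' hg
    obtain ⟨w, rfl⟩ := eΛ.surjective g
    obtain ⟨w', rfl⟩ := eΛ.surjective g'
    exact congrArg eΛ (h (congrArg eΓ.symm hg))
  refine freeGroup_injective_of_linearIndependent φ ?_
  let v : R.localGens xt W (op ⦋m⦌) → (R.gens (op ⦋m⦌) →₀ ℤ) := fun g =>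
    (basisCoord (R.isBasis.1 (op ⦋m⦌)) ((R.incl xt W).app (op ⦋m⦌) g.1)).toAdd
  have hv : (fun s => (expSum _ (φ (FreeGroup.of s))).toAdd) = v := by
    funext s
    have : eΛ (FreeGroup.of s) = s.1 :=
      FreeGroup.lift_apply_of (f := (Subtype.val : R.localGens xt W (op ⦋m⦌) → _))
    change (expSum _ (eΓ.symm ((R.incl xt W).app (op ⦋m⦌) (eΛ (FreeGroup.of s))))).toAdd = _
    rw [this]
    rfl
  rw [hv]
  have hepi : ∀ σ : Surj N (op ⦋m⦌), Epi σ.1 := fun σ => SimplexCategory.epi_iff_surjective.2 σ.2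
  -- the coordinates of the generators at a degeneracy of `y0`
  have hinl : ∀ (y : A.left _⦋m⦌) (hy : LocalGen A.left R.gens N xt W (op ⦋m⦌) y) (s),
      s.1.1 = Monoid.Coprod.inl y →
      v s = Finsupp.single ⟨y, hy.mem fun hN => (hW hN).subset⟩ 1 := by
    rintro y hy ⟨⟨_, _⟩, _⟩ rfl
    exact basisCoord_of_mem (R.isBasis.1 (op ⦋m⦌)) ⟨y, hy.mem fun hN => (hW hN).subset⟩
  have hinr : ∀ (σ : Surj N (op ⦋m⦌)) (s : R.localGens xt W (op ⦋m⦌)),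
      s.1.1 = Monoid.Coprod.inr (FreeGroup.of σ) →
      v s = Finsupp.mapDomain (fun y : R.gens (op ⦋N⦌) => ⟨A.left.map σ.1.op y.1,
        have := hepi σ; R.isBasis.map_epi_mem σ.1 y.1 y.2⟩)
        (basisCoord (R.isBasis.1 (op ⦋N⦌)) xt).toAdd := by
    rintro σ ⟨⟨_, _⟩, _⟩ rfl
    have := hepi σ
    refine Eq.trans ?_ (basisCoord_map (R.isBasis.1 (op ⦋N⦌)) (R.isBasis.1 (op ⦋m⦌))
      (A.left.map σ.1.op).hom (fun y hy => R.isBasis.map_epi_mem σ.1 y hy) xt)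
    refine congrArg (fun g => (basisCoord (R.isBasis.1 (op ⦋m⦌)) g).toAdd) ?_
    change Monoid.Coprod.lift (MonoidHom.id _) (FreeGroup.lift fun σ : Surj N (op ⦋m⦌) =>
      A.left.map σ.1.op xt) (Monoid.Coprod.inr (FreeGroup.of σ)) = _
    rw [Monoid.Coprod.lift_apply_inr, FreeGroup.lift_apply_of]
  rw [linearIndependent_iff]
  intro l hl
  have hl2 : ∀ p, ∑ s ∈ l.support, l s * v s p = 0 := by
    intro p
    have := DFunLike.congr_fun hl p
    rw [Finsupp.linearCombination_apply, Finsupp.sum, Finsupp.finsetSum_apply] at this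
    simpa using this
  have h1 : ∀ s : R.localGens xt W (op ⦋m⦌), ∀ σ : Surj N (op ⦋m⦌),
      s.1.1 = Monoid.Coprod.inr (FreeGroup.of σ) → l s = 0 := by
    intro s σ hs
    have := hepi σ
    let p : R.gens (op ⦋m⦌) := ⟨A.left.map σ.1.op y0.1, R.isBasis.map_epi_mem σ.1 y0.1 y0.2⟩
    have h2 := hl2 p
    rw [Finset.sum_eq_single s, hinr σ s hs] at h2
    · have h3 : Finsupp.mapDomain (fun y : R.gens (op ⦋N⦌) => (⟨A.left.map σ.1.op y.1,
          R.isBasis.map_epi_mem σ.1 y.1 y.2⟩ : R.gens (op ⦋m⦌)))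
          (basisCoord (R.isBasis.1 (op ⦋N⦌)) xt).toAdd p =
          (basisCoord (R.isBasis.1 (op ⦋N⦌)) xt).toAdd y0 := by
        refine Finsupp.mapDomain_apply (fun y y' hyy => ?_) _ y0
        have h4 : A.left.map σ.1.op y.1 = A.left.map σ.1.op y'.1 := congrArg Subtype.val hyy
        have := isSplitEpi_of_epi σ.1
        have h5 := congrArg (A.left.map (section_ σ.1).op) h4
        rw [← map_comp_op, ← map_comp_op, IsSplitEpi.id, map_id_op, map_id_op] at h5
        exact Subtype.ext h5
      rw [h3] at h2
      exact (mul_eq_zero.1 h2).resolve_right ha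
    · intro t _ hts
      rw [mul_eq_zero]
      right
      rcases t.2 with (⟨y, hy, ht⟩ | ⟨_, τ, ht⟩)
      · rw [hinl y hy t ht, Finsupp.single_apply_eq_zero]
        intro hp
        exfalso
        obtain ⟨d, e, z, he, hz, hze⟩ := hy.exists_core R.isBasis fun hN => (hW hN).subset
        have hd := hz.le
        exact hy0.ne_map σ.1 (by omega) e z (hze.trans (congrArg Subtype.val hp).symm)
      · rw [hinr τ t ht]
        refine Finsupp.mapDomain_of_notMem_range _ _ ?_
        rintro ⟨y, hy⟩
        have h3 := (hy0.eq_of_map_eq σ.1 τ.1 (congrArg Subtype.val hy)).1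
        refine hts (Subtype.ext (Subtype.ext ?_))
        rw [hs, ht, Subtype.ext h3]
    · intro h
      rw [Finsupp.notMem_support_iff.1 h, zero_mul]
  ext s
  rcases s.2 with (⟨y, hy, hs⟩ | ⟨_, σ, hs⟩)
  · have h2 := hl2 ⟨y, hy.mem fun hN => (hW hN).subset⟩
    rw [Finset.sum_eq_single s, hinl y hy s hs] at h2
    · simpa using h2
    · intro t _ hts
      rcases t.2 with (⟨y', hy', ht⟩ | ⟨_, τ, ht⟩)
      · rw [hinl y' hy' t ht, Finsupp.single_apply_eq_zero.2, mul_zero]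
        intro hp
        exfalso
        refine hts (Subtype.ext (Subtype.ext ?_))
        rw [hs, ht]
        exact congrArg Monoid.Coprod.inl (congrArg Subtype.val hp).symm
      · rw [h1 t τ ht, zero_mul]
    · intro h
      rw [Finsupp.notMem_support_iff.1 h, zero_mul]
  · exact h1 s σ hs

end FreeResolution

/-! ### Fundamental classes -/

section Fundamental
variable {Γ Γ' : SimplicialObject GrpCat.{0}}

theorem barClass_barSymbol {q : ℕ} (g : Γ _⦋q⦌) : barClass Γ q (barSymbol ℤ Γ g) = abOf Γ g :=
  (barClass_single Γ q _ 1).trans (one_smul _ _)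

/-- A cycle whose leading class is a sum of degenerate classes is a boundary. -/
theorem mem_boundaries_of_degenerate (hΓ : ∀ m, IsFreeGroup (Γ.obj m)) {M : ℕ}
    (z : (bic (Cyclic.bar ℤ) Γ).Tot) (h1 : z ∈ (bic (Cyclic.bar ℤ) Γ).cycles (M + 2))
    (h2 : z ∈ (bic (Cyclic.bar ℤ) Γ).filtLT (M + 2))
    (h3 : barClass Γ (M + 1) (z 1 (M + 1)) ∈ AddSubgroup.closure
      {y | ∃ (i : Fin (M + 1)) (z : (simplicialAb Γ) _⦋M⦌), (simplicialAb Γ).σ i z = y}) :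
    z ∈ (bic (Cyclic.bar ℤ) Γ).boundaries (M + 2) := by
  obtain ⟨a, ha⟩ := exists_altFace_eq (simplicialAb Γ) M _ (altFace_class_eq_zero z h1) h3
  exact mem_boundaries_of_class_eq hΓ z h1 h2 a ha

/-- A homomorphism which vanishes on degenerate elements of degree `n + 1` vanishes on the boundaries of
degenerate elements. -/
theorem comp_altFace_σ (X : SimplicialObject AddCommGrpCat.{0}) {n : ℕ} {B : Type}
    [AddCommGroup B] (f : X _⦋n + 1⦌ →+ B) (hf : ∀ (i : Fin (n + 1)) y, f (X.σ i y) = 0)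
    (j : Fin (n + 2)) (y : X _⦋n + 1⦌) : f (altFace X (n + 1) (X.σ j y)) = 0 := by
  rw [altFace_apply, map_sum]
  have h1 : ∀ i : Fin (n + 3), i ≠ j.castSucc → i ≠ j.succ → f (X.δ i (X.σ j y)) = 0 := by
    intro i hi hi'
    rcases lt_or_gt_of_ne hi with h | h
    · obtain ⟨j, rfl⟩ : ∃ k, j = Fin.succ k := Fin.exists_succ_eq.2 (by rintro rfl; simp at h) |>.imp
        fun _ h => h.symm
      obtain ⟨i, rfl⟩ : ∃ k, i = Fin.castSucc k := Fin.exists_castSucc_eq.2 (by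
        rintro rfl; exact absurd h (Fin.le_last _).not_gt) |>.imp fun _ h => h.symm
      have h2 := ConcreteCategory.congr_hom (X.δ_comp_σ_of_le (i := i) (j := j) (by
        rw [Fin.lt_def] at h; rw [Fin.le_def]; simp at h ⊢; omega)) y
      exact (congrArg f h2).trans (hf _ _)
    · obtain ⟨i, rfl⟩ : ∃ k, i = Fin.succ k := Fin.exists_succ_eq.2 (by rintro rfl; simp at h) |>.imp
        fun _ h => h.symm
      have hlt : j < i := by
        rw [Fin.lt_def] at h ⊢
        simp [Fin.ext_iff] at h hi'
        omega
      obtain ⟨j, rfl⟩ : ∃ k, j = Fin.castSucc k := Fin.exists_castSucc_eq.2 (by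
        rintro rfl; exact absurd hlt (Fin.le_last _).not_gt) |>.imp fun _ h => h.symm
      have h2 := ConcreteCategory.congr_hom (X.δ_comp_σ_of_gt (i := i) (j := j) hlt) y
      exact (congrArg f h2).trans (hf _ _)
  rw [Finset.sum_eq_add j.castSucc j.succ (by simp [Fin.ext_iff])]
  · have h2 : X.δ j.castSucc (X.σ j y) = y :=
      ConcreteCategory.congr_hom (X.δ_comp_σ_self (i := j)) y
    have h3 : X.δ j.succ (X.σ j y) = y :=
      ConcreteCategory.congr_hom (X.δ_comp_σ_succ (i := j)) y
    rw [h2, h3]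
    simp [pow_succ]
  · rintro i - ⟨hi, hi'⟩
    rw [map_zsmul, h1 i hi hi', smul_zero]
  · simp
  · simp

variable (hΓ : ∀ m, IsFreeGroup (Γ.obj m)) {M : ℕ} (s : Γ _⦋M + 1⦌)
  (htop : AddSubgroup.closure ({y | ∃ (i : Fin (M + 1)) (z : (simplicialAb Γ) _⦋M⦌),
    (simplicialAb Γ).σ i z = y} ∪ {abOf Γ s}) = ⊤)
  (f : (simplicialAb Γ) _⦋M + 1⦌ →+ ℤ) (hfs : f (abOf Γ s) = 1)
  (hf : ∀ x, f (altFace (simplicialAb Γ) (M + 1) x) = 0)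

theorem cochainOf_dh_eq_zero {q : ℕ} {f : (simplicialAb Γ) _⦋q⦌ →+ ℤ}
    (hf : ∀ x, f (altFace (simplicialAb Γ) q x) = 0) :
    cochainOf f ∘ₗ (bic (Cyclic.bar ℤ) Γ).dh 1 q = 0 := by
  rw [cochainOf_dh]
  have : f.comp (altFace (simplicialAb Γ) q) = 0 := AddMonoidHom.ext hf
  rw [this, cochainOf_zero]

/-- The cohomology class of a homomorphism to `ℤ` which vanishes on boundaries. -/
def dualClass {q : ℕ} (f : (simplicialAb Γ) _⦋q⦌ →+ ℤ)
    (hf : ∀ x, f (altFace (simplicialAb Γ) q x) = 0) : barCohomology ℤ Γ (q + 1) :=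
  Submodule.Quotient.mk ⟨(bic (Cyclic.bar ℤ) Γ).cosingle 1 q (cochainOf f),
    (bic (Cyclic.bar ℤ) Γ).cosingle_mem_cocycles (Nat.add_comm 1 q) _ (cochainOf_dv f)
      (cochainOf_dh_eq_zero hf)⟩

theorem coDetects_dualClass {q : ℕ} (f : (simplicialAb Γ) _⦋q⦌ →+ ℤ)
    (hf : ∀ x, f (altFace (simplicialAb Γ) q x) = 0) :
    (bic (Cyclic.bar ℤ) Γ).CoDetects (q + 1) (cochainOf f) (dualClass f hf) :=
  ⟨_, (bic (Cyclic.bar ℤ) Γ).cosingle_mem_filtGE 1 q _,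
    (bic (Cyclic.bar ℤ) Γ).cosingle_same 1 q _, rfl⟩

theorem pairing_dualClass {q : ℕ} (f : (simplicialAb Γ) _⦋q⦌ →+ ℤ)
    (hf : ∀ x, f (altFace (simplicialAb Γ) q x) = 0) (s : Γ _⦋q⦌)
    (z : (bic (Cyclic.bar ℤ) Γ).cycles (q + 1)) (hz : z.1 1 q = barSymbol ℤ Γ s) :
    (bic (Cyclic.bar ℤ) Γ).pairing (q + 1) (dualClass f hf) (Submodule.Quotient.mk z) =
      f (abOf Γ s) := by
  refine ((bic (Cyclic.bar ℤ) Γ).pairing_mk _ _ _).trans ?_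
  refine ((bic (Cyclic.bar ℤ) Γ).pairTot_cosingle (Nat.add_comm 1 q) _ _).trans ?_
  rw [hz, cochainOf_barSymbol]

include hΓ htop hfs hf in
/-- If the symbol `s` and the degenerate elements generate `H_1(BΓ_N; ℤ)` and `f` is a cocycle with `f(s) = 1`, then
`H_{N+1}(BΓ; ℤ)` is infinite cyclic, generated by the class led by `s`. -/
theorem bijective_zsmul_of_generates (z : (bic (Cyclic.bar ℤ) Γ).cycles (M + 2))
    (hz : z.1 ∈ (bic (Cyclic.bar ℤ) Γ).filtLT (M + 2)) (hzs : z.1 1 (M + 1) = barSymbol ℤ Γ s) :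
    Function.Bijective fun k : ℤ =>
      k • (Submodule.Quotient.mk z : barHomology ℤ Γ (M + 2)) := by
  constructor
  · intro k k' h
    have h1 : ∀ k : ℤ, (bic (Cyclic.bar ℤ) Γ).pairing (M + 2) (dualClass f hf)
        (k • (Submodule.Quotient.mk z : barHomology ℤ Γ (M + 2))) = k := fun k =>
      (map_zsmul _ k _).trans ((congrArg (k • ·)
        ((pairing_dualClass f hf s z hzs).trans hfs)).trans (by simp))
    exact (h1 k).symm.trans ((congrArg _ h).trans (h1 k'))
  · intro ξ
    obtain ⟨y, rfl⟩ := Submodule.Quotient.mk_surjective _ ξ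
    obtain ⟨w, hw, hyw⟩ := (barLike ℤ hΓ).exists_sub_totD_mem_filtLT y.1 y.2
    have hb : (bic (Cyclic.bar ℤ) Γ).totD w ∈ (bic (Cyclic.bar ℤ) Γ).cycles (M + 2) :=
      ⟨Bicomplex.totD_mem_homog _ hw, LinearMap.mem_ker.2 (Bicomplex.totD_totD _ w)⟩
    have hy' : y.1 - (bic (Cyclic.bar ℤ) Γ).totD w ∈ (bic (Cyclic.bar ℤ) Γ).cycles (M + 2) :=
      Submodule.sub_mem _ y.2 hb
    have h1 : barClass Γ (M + 1) ((y.1 - (bic (Cyclic.bar ℤ) Γ).totD w) 1 (M + 1)) ∈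
        AddSubgroup.closure ({y | ∃ (i : Fin (M + 1)) (z : (simplicialAb Γ) _⦋M⦌),
          (simplicialAb Γ).σ i z = y} ∪ {abOf Γ s}) := by rw [htop]; exact AddSubgroup.mem_top _
    rw [AddSubgroup.closure_union, AddSubgroup.mem_sup] at h1
    obtain ⟨d, hd, c, hc, hdc⟩ := h1
    obtain ⟨k, rfl⟩ := AddSubgroup.mem_closure_singleton.1 hc
    refine ⟨k, ?_⟩
    have h2 := mem_boundaries_of_degenerate hΓ (y.1 - (bic (Cyclic.bar ℤ) Γ).totD w - k • z.1)
      (Submodule.sub_mem _ hy' (Submodule.smul_mem _ k z.2))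
      (Submodule.sub_mem _ hyw (Submodule.smul_mem _ k hz)) (by
        have h3 : barClass Γ (M + 1) (((y.1 - (bic (Cyclic.bar ℤ) Γ).totD w) 1 (M + 1)) -
            k • z.1 1 (M + 1)) = d := by
          refine (map_sub (barClass Γ (M + 1)) _ _).trans ?_
          refine (congrArg₂ (· - ·) hdc.symm ((map_zsmul (barClass Γ (M + 1)) k _).trans
            (congrArg (k • ·) ((congrArg _ hzs).trans (barClass_barSymbol s))))).trans ?_
          exact add_sub_cancel_right d _
        exact h3 ▸ hd)
    refine ((Submodule.Quotient.eq _).2 ?_).symm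
    change y.1 - k • z.1 ∈ (bic (Cyclic.bar ℤ) Γ).boundaries (M + 2)
    have h3 := Submodule.add_mem _ h2 (⟨w, hw, rfl⟩ :
      (bic (Cyclic.bar ℤ) Γ).totD w ∈ (bic (Cyclic.bar ℤ) Γ).boundaries (M + 2))
    convert h3 using 1
    abel

include hΓ htop hfs in
/-- The dual statement in cohomology. -/
theorem bijective_zsmul_dualClass (hs : altFace (simplicialAb Γ) M (abOf Γ s) = 0)
    (z : (bic (Cyclic.bar ℤ) Γ).cycles (M + 2)) (hzs : z.1 1 (M + 1) = barSymbol ℤ Γ s) :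
    Function.Bijective fun k : ℤ => k • dualClass f hf := by
  constructor
  · intro k k' h
    have h1 : ∀ k : ℤ, (bic (Cyclic.bar ℤ) Γ).pairing (M + 2) (k • dualClass f hf)
        (Submodule.Quotient.mk z) = k := fun k =>
      (LinearMap.congr_fun (map_zsmul _ k _) _).trans ((congrArg (k • ·)
        ((pairing_dualClass f hf s z hzs).trans hfs)).trans (by simp))
    exact (h1 k).symm.trans ((congrArg (fun η => (bic (Cyclic.bar ℤ) Γ).pairing (M + 2) η _)
      h).trans (h1 k'))
  · intro η
    obtain ⟨F, rfl⟩ := Submodule.Quotient.mk_surjective _ η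
    obtain ⟨φ, hφv, hφh, hφ⟩ := (barLike ℤ hΓ).exists_cosingle_representative F.1 F.2
    obtain ⟨ψ, rfl⟩ := exists_eq_cochainOf φ hφv
    have hψ : ∀ x, ψ (altFace (simplicialAb Γ) (M + 1) x) = 0 := by
      intro x
      obtain ⟨c, rfl⟩ := barClass_surjective Γ (M + 2) x
      rw [cochainOf_dh] at hφh
      exact LinearMap.congr_fun hφh c
    obtain ⟨χ, hχ⟩ := exists_comp_altFace_eq (simplicialAb Γ) M (abOf Γ s) hs htop
      (ψ - (ψ (abOf Γ s)) • f) (fun x => by simp [hψ, hf]) (by simp [hfs])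
    refine ⟨ψ (abOf Γ s), ((Submodule.Quotient.eq _).2 ?_).symm⟩
    have h1 : (bic (Cyclic.bar ℤ) Γ).cosingle 1 (M + 1) (cochainOf ψ) =
        ψ (abOf Γ s) • (bic (Cyclic.bar ℤ) Γ).cosingle 1 (M + 1) (cochainOf f) +
        (bic (Cyclic.bar ℤ) Γ).cosingle 1 (M + 1)
          (cochainOf (χ.comp (altFace (simplicialAb Γ) M))) := by
      have h2 : cochainOf ψ = ψ (abOf Γ s) • cochainOf f +
          cochainOf (χ.comp (altFace (simplicialAb Γ) M)) := by
        refine LinearMap.ext fun c => ?_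
        have h3 := hχ (barClass Γ (M + 1) c)
        change ψ (barClass Γ (M + 1) c) = ψ (abOf Γ s) • f (barClass Γ (M + 1) c) +
          χ (altFace _ M (barClass Γ (M + 1) c))
        rw [← h3]
        simp
      rw [h2]
      funext a b
      change _ = ψ (abOf Γ s) • (bic (Cyclic.bar ℤ) Γ).cosingle 1 (M + 1) (cochainOf f) a b +
        (bic (Cyclic.bar ℤ) Γ).cosingle 1 (M + 1)
          (cochainOf (χ.comp (altFace (simplicialAb Γ) M))) a b
      by_cases hab : a = 1 ∧ b = M + 1
      · obtain ⟨rfl, rfl⟩ := hab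
        simp only [Bicomplex.cosingle_same]
      · simp only [Bicomplex.cosingle_ne _ _ (show a = 1 → b ≠ M + 1 by tauto)]
        simp
    change F.1 - ψ (abOf Γ s) • (bic (Cyclic.bar ℤ) Γ).cosingle 1 (M + 1) (cochainOf f) ∈
      (bic (Cyclic.bar ℤ) Γ).coboundaries (M + 2)
    have h3 := Submodule.add_mem _ hφ (cosingle_cochainOf_mem_coboundaries χ)
    rw [h1] at h3
    convert h3 using 1
    abel

/-- The image of a class led by `s` is determined by the image of `s`. -/
theorem barHomologyMap_mk_eq (hΓ' : ∀ m, IsFreeGroup (Γ'.obj m)) (ι : Γ ⟶ Γ') {N : ℕ} (s : Γ _⦋N⦌)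
    (z : (bic (Cyclic.bar ℤ) Γ).cycles (N + 1))
    (hz : z.1 ∈ (bic (Cyclic.bar ℤ) Γ).filtLT (N + 1)) (hzs : z.1 1 N = barSymbol ℤ Γ s)
    (ξ : barHomology ℤ Γ' (N + 1)) (hξ : (bic (Cyclic.bar ℤ) Γ').Detects (N + 1)
      (barSymbol ℤ Γ' (ι.app (op ⦋N⦌) s)) ξ) :
    barHomologyMap ℤ ι (N + 1) (Submodule.Quotient.mk z) = ξ := by
  obtain ⟨y, hy, hys, rfl⟩ := hξ
  change (Submodule.Quotient.mk ((bicMap (Cyclic.bar ℤ) ι).cyclesMap (N + 1) z) :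
    barHomology ℤ Γ' (N + 1)) = _
  refine (Submodule.Quotient.eq _).2 ?_
  change (bicMap (Cyclic.bar ℤ) ι).tot z.1 - y.1 ∈ (bic (Cyclic.bar ℤ) Γ').boundaries (N + 1)
  refine mem_boundaries_of_class_eq hΓ' _
    (Submodule.sub_mem _ ((bicMap (Cyclic.bar ℤ) ι).cyclesMap (N + 1) z).2 y.2)
    (Submodule.sub_mem _ (fun p q h => ?_) hy) 0 ?_
  · change (bicMap (Cyclic.bar ℤ) ι).toFun p q (z.1 p q) = 0
    rw [hz p q h, map_zero]
  · rw [map_zero]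
    have h1 : (bicMap (Cyclic.bar ℤ) ι).toFun 1 N (z.1 1 N) = y.1 1 N := by
      rw [hzs, hys]
      exact Cyclic.barMap_single ℤ (ι.app (op ⦋N⦌)).hom 1 (fun _ => s) 1
    refine (map_zero (barClass Γ' N)).symm.trans (congrArg (barClass Γ' N) ?_)
    exact (sub_eq_zero.2 h1).symm

theorem barHomologyMap_complexifyH (ι : Γ ⟶ Γ') (n : ℕ) (ξ : barHomology ℤ Γ n) :
    barHomologyMap ℂ ι n (complexifyH Γ n ξ) = complexifyH Γ' n (barHomologyMap ℤ ι n ξ) := by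
  obtain ⟨z, rfl⟩ := Submodule.Quotient.mk_surjective _ ξ
  refine congrArg (Submodule.Quotient.mk (p :=
    ((bic (Cyclic.bar ℂ) Γ').boundaries n).submoduleOf ((bic (Cyclic.bar ℂ) Γ').cycles n)))
    (Subtype.ext ?_)
  funext p q
  exact (complexify_map (ι.app (op ⦋q⦌)) p (z.1 p q)).symm

end Fundamental

/-! ### The fundamental class of the local group -/

section Abelianization
variable {Γ Γ' : SimplicialObject GrpCat.{0}}

/-- The homomorphism on the abelianization induced by a homomorphism to an abelian group. -/
def abLift {m : SimplexCategoryᵒᵖ} {B : Type} [AddCommGroup B] (u : Γ.obj m →* Multiplicative B) :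
    (simplicialAb Γ).obj m →+ B :=
  let ψ : Additive (Abelianization (Γ.obj m)) →+ B :=
    MonoidHom.toAdditiveLeft (Abelianization.lift u)
  ψ

theorem abLift_abOf {m : SimplexCategoryᵒᵖ} {B : Type} [AddCommGroup B]
    (u : Γ.obj m →* Multiplicative B) (g : Γ.obj m) : abLift u (abOf Γ g) = (u g).toAdd := by
  change Multiplicative.toAdd (Abelianization.lift u (Abelianization.of g)) = _
  rw [Abelianization.lift_apply_of]

theorem abOf_surjective {m : SimplexCategoryᵒᵖ} (x : (simplicialAb Γ).obj m) :
    ∃ g, abOf Γ g = x :=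
  QuotientGroup.mk_surjective x

theorem abOf_list_prod {m : SimplexCategoryᵒᵖ} (L : List (Γ.obj m)) :
    abOf Γ L.prod = (L.map (abOf Γ)).sum := by
  induction L with
  | nil => rfl
  | cons a L ih => rw [List.prod_cons, List.map_cons, List.sum_cons, abOf_mul, ih]

theorem altFace_abOf {M : ℕ} (s : Γ _⦋M + 1⦌) :
    altFace (simplicialAb Γ) M (abOf Γ s) = abOf Γ (altFaceProd Γ (M + 1) s) := by
  rw [altFaceProd, abOf_list_prod, List.map_ofFn, List.sum_ofFn, altFace_apply]
  rfl

theorem abOf_eq_zero_iff {m : SimplexCategoryᵒᵖ} (g : Γ.obj m) :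
    abOf Γ g = 0 ↔ g ∈ commutator (Γ.obj m) :=
  QuotientGroup.eq_one_iff g

/-- Elements that agree on the abelianization of the source of a bijective homomorphism. -/
theorem abOf_eq_zero_of_bijective (ι : Γ ⟶ Γ') {m : SimplexCategoryᵒᵖ}
    (h : Function.Bijective (ι.app m)) (g : Γ.obj m) (hg : abOf Γ' (ι.app m g) = 0) :
    abOf Γ g = 0 := by
  let e : Γ.obj m ≃* Γ'.obj m := MulEquiv.ofBijective (ι.app m).hom h
  have h1 := (abOf_eq_zero_iff _).1 hg
  rw [abOf_eq_zero_iff]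
  have h2 : (commutator (Γ'.obj m)).map e.symm.toMonoidHom ≤ commutator (Γ.obj m) := by
    rw [commutator_def, commutator_def, Subgroup.map_commutator]
    exact Subgroup.commutator_mono le_top le_top
  have h3 := h2 ⟨_, h1, rfl⟩
  have h4 : e.symm.toMonoidHom (ι.app m g) = g := e.symm_apply_apply g
  rwa [h4] at h3

theorem closure_abOf_eq_top {m : SimplexCategoryᵒᵖ} {X : Set (Γ.obj m)}
    (hX : Function.Bijective (FreeGroup.lift (Subtype.val : X → Γ.obj m)))
    (S : Set ((simplicialAb Γ).obj m)) (hS : ∀ y ∈ X, abOf Γ y ∈ S) :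
    AddSubgroup.closure S = ⊤ := by
  rw [eq_top_iff]
  rintro x -
  obtain ⟨g, rfl⟩ := abOf_surjective x
  rw [abOf_eq_sum hX]
  exact AddSubgroup.sum_mem _ fun y _ => AddSubgroup.zsmul_mem _
    (AddSubgroup.subset_closure (hS _ y.2)) _

end Abelianization

namespace FreeResolution
variable {A : SimplicialObject.Augmented GrpCat.{0}} (R : FreeResolution A)

/-- The alternating face product of the symbol `s` is a product of commutators in the local group. -/
theorem altFace_fund {M : ℕ} {x : groupHomology (Rep.trivial ℂ A.right ℂ) (M + 2)}
    {xt : A.left _⦋M + 1⦌} (hx : IsLift A x xt) {W : Set (A.left _⦋M⦌)}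
    (hW : 2 ≤ M + 1 → R.IsCommutatorSupport xt W) :
    altFace (simplicialAb (R.localGroup xt W)) M (abOf _ (R.fund xt W)) = 0 := by
  rw [altFace_abOf]
  by_cases hM : 2 ≤ M + 1
  · have hWm : ∀ y ∈ W, LocalGen A.left R.gens (M + 1) xt W (op ⦋M⦌) y :=
      fun y hy => LocalGen.comm (N := M + 1) y hM hy
    have h1 : ∀ g ∈ Subgroup.closure W, (Monoid.Coprod.inl g : AttachGroup A.left (M + 1) (op ⦋M⦌)) ∈
        localSubgroup A.left R.gens (M + 1) xt W (op ⦋M⦌) := by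
      suffices h : Subgroup.closure W ≤ (localSubgroup A.left R.gens (M + 1) xt W (op ⦋M⦌)).comap
        Monoid.Coprod.inl from h
      rw [Subgroup.closure_le]
      exact fun y hy => Subgroup.subset_closure (Or.inl ⟨y, hWm y hy, rfl⟩)
    have h2 : ⁅Subgroup.closure W, Subgroup.closure W⁆ ≤
        ((commutator (localSubgroup A.left R.gens (M + 1) xt W (op ⦋M⦌))).map
          (Subgroup.subtype _)).comap Monoid.Coprod.inl := by
      rw [Subgroup.map_subtype_commutator, ← Subgroup.map_le_iff_le_comap, Subgroup.map_commutator]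
      exact Subgroup.commutator_mono (Subgroup.map_le_iff_le_comap.2 h1)
        (Subgroup.map_le_iff_le_comap.2 h1)
    obtain ⟨c, hc, hc2⟩ := h2 (hW hM).mem
    refine (abOf_eq_zero_iff _).2 ?_
    suffices h : altFaceProd (R.localGroup xt W) (M + 1) (R.fund xt W) = c from h ▸ hc
    refine Subtype.ext (Eq.trans ?_ hc2.symm)
    let j : (R.localGroup xt W) _⦋M⦌ →*
      AttachGroup A.left (M + 1) (op ⦋M⦌) := Subgroup.subtype _
    let i : A.left _⦋M⦌ →* AttachGroup A.left (M + 1) (op ⦋M⦌) := Monoid.Coprod.inl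
    have hface : ∀ k : Fin (M + 2), j ((R.localGroup xt W).δ k (R.fund xt W)) =
        i (A.left.δ k xt) := by
      intro k
      change attachMap xt (SimplexCategory.δ k).op (R.fund xt W).1 = _
      rw [R.fund_val_of_le xt W hM]
      simp only [attachMap, Monoid.Coprod.lift_apply_inr, FreeGroup.lift_apply_of]
      rw [attachGen, dif_neg]
      · rw [Category.comp_id]
        rfl
      · rw [Category.comp_id, ← SimplexCategory.epi_iff_surjective]
        intro h
        have := @SimplexCategory.len_le_of_epi _ _ (SimplexCategory.δ k) h
        simp at this
    change j (altFaceProd (R.localGroup xt W) (M + 1) (R.fund xt W)) =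
      i (altFaceProd A.left (M + 1) xt)
    refine (map_list_prod j _).trans (Eq.trans ?_ (map_list_prod i _).symm)
    rw [List.map_ofFn, List.map_ofFn]
    refine congrArg (fun l => (List.ofFn l).prod) (funext fun k => ?_)
    exact (map_zpow j _ _).trans ((congrArg (· ^ _) (hface k)).trans (map_zpow i _ _).symm)
  · obtain rfl : M = 0 := by omega
    refine abOf_eq_zero_of_bijective (R.incl xt W) (R.incl_bijective_zero xt W) _ ?_
    obtain ⟨ξ, ⟨z, hz1, hz2, rfl⟩, rfl⟩ := hx
    have h1 : altFace (simplicialAb A.left) 0 (abOf A.left xt) = 0 := by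
      have h3 := altFace_class_eq_zero z.1 z.2
      have h4 : barClass A.left 1 (z.1 1 1) = abOf A.left xt :=
        (congrArg _ hz2).trans (barClass_barSymbol xt)
      rwa [h4] at h3
    rw [altFace_abOf] at h1
    refine Eq.trans (congrArg (abOf A.left) ?_) h1
    have hface : ∀ k : Fin 2, (R.incl xt W).app (op ⦋0⦌) ((R.localGroup xt W).δ k (R.fund xt W)) =
        A.left.δ k xt := fun k =>
      (ConcreteCategory.congr_hom ((R.incl xt W).naturality (SimplexCategory.δ k).op)
        (R.fund xt W)).trans (congrArg (A.left.δ k) (R.incl_fund xt W))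
    refine (map_list_prod ((R.incl xt W).app (op ⦋0⦌)).hom _).trans ?_
    rw [List.map_ofFn]
    refine congrArg (fun l => (List.ofFn l).prod) (funext fun k => ?_)
    exact (map_zpow ((R.incl xt W).app (op ⦋0⦌)).hom _ _).trans (congrArg (· ^ _) (hface k))

/-- The class of the symbol `s` is the leading term of a cycle. -/
theorem exists_cycle_fund {N : ℕ} {x : groupHomology (Rep.trivial ℂ A.right ℂ) (N + 1)}
    {xt : A.left _⦋N⦌} (hx : IsLift A x xt) {W : Set (A.left _⦋N - 1⦌)}
    (hW : 2 ≤ N → R.IsCommutatorSupport xt W) :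
    ∃ z : (bic (Cyclic.bar ℤ) (R.localGroup xt W)).cycles (N + 1),
      z.1 ∈ (bic (Cyclic.bar ℤ) (R.localGroup xt W)).filtLT (N + 1) ∧
      z.1 1 N = barSymbol ℤ (R.localGroup xt W) (R.fund xt W) := by
  cases N with
  | zero => exact (barLike ℤ (R.isFreeGroup_localGroup xt hW)).exists_cycle_zero _
  | succ M =>
    refine exists_cycle_of_altFace (R.isFreeGroup_localGroup xt hW)
      (barSymbol ℤ (R.localGroup xt W) (R.fund xt W)) ?_
    rw [barClass_barSymbol]
    exact R.altFace_fund hx hW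

theorem augH_of_cycle_fund {N : ℕ} {x : groupHomology (Rep.trivial ℂ A.right ℂ) (N + 1)}
    {xt : A.left _⦋N⦌} (hx : IsLift A x xt) (W : Set (A.left _⦋N - 1⦌))
    (z : (bic (Cyclic.bar ℤ) (R.localGroup xt W)).cycles (N + 1))
    (hz : z.1 ∈ (bic (Cyclic.bar ℤ) (R.localGroup xt W)).filtLT (N + 1))
    (hzs : z.1 1 N = barSymbol ℤ (R.localGroup xt W) (R.fund xt W)) :
    augH ℂ A N (barHomologyMap ℂ (R.incl xt W) (N + 1)
      (complexifyH (R.localGroup xt W) (N + 1) (Submodule.Quotient.mk z))) = x := by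
  obtain ⟨ξ, hξ, rfl⟩ := hx
  rw [barHomologyMap_complexifyH, barHomologyMap_mk_eq R.isFreeGroup (R.incl xt W) (R.fund xt W) z
    hz hzs ξ (by rwa [R.incl_fund xt W])]

variable {M : ℕ} {xt : A.left _⦋M + 1⦌} {W : Set (A.left _⦋M⦌)}
    (hW : 2 ≤ M + 1 → R.IsCommutatorSupport xt W) (hM : 1 ≤ M)

/-- If `2 ≤ N`, all generators of the local group in degree `N + 1` are degenerate. -/
theorem exists_σ_eq_of_mem_localGens (g : (R.localGroup xt W) _⦋M + 2⦌)
    (hW : 2 ≤ M + 1 → R.IsCommutatorSupport xt W) (hM : 1 ≤ M)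
    (hg : g ∈ R.localGens xt W (op ⦋M + 2⦌)) :
    ∃ (i : Fin (M + 2)) (z : (R.localGroup xt W) _⦋M + 1⦌), (R.localGroup xt W).σ i z = g := by
  obtain ⟨g, hg'⟩ := g
  have key : ∀ {d : ℕ} (e : ⦋M + 2⦌ ⟶ ⦋d⦌), d < M + 2 → ∃ (i : Fin (M + 2)) (e' : ⦋M + 1⦌ ⟶ ⦋d⦌),
      e = SimplexCategory.σ i ≫ e' := fun {d} e hd =>
    SimplexCategory.eq_σ_comp_of_not_injective e (by
      rw [← SimplexCategory.mono_iff_injective]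
      intro hm
      have h2 := SimplexCategory.len_le_of_mono e
      simp at h2
      omega)
  rcases hg with (⟨y, hy, rfl⟩ | ⟨hN, σ, rfl⟩)
  · obtain ⟨d, e, z, he, hz, rfl⟩ := hy.exists_core R.isBasis fun hN => (hW hN).subset
    have hd : d < M + 2 := by
      have := hz.le
      omega
    obtain ⟨i, e', rfl⟩ := key e hd
    have : Epi e' := epi_of_epi (SimplexCategory.σ i) e'
    have hg2 : A.left.map e'.op z ∈ R.gens (op ⦋M + 1⦌) :=
      R.isBasis.map_epi_mem e' z (hz.mem fun hN => (hW hN).subset)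
    refine ⟨i, R.ofBase xt W (A.left.map e'.op z) fun y hy => ?_, ?_⟩
    · rw [hy.eq_of_mem (R.isBasis.1 _).1 hg2]
      exact LocalGen.oper e'.op z _ hz.localGen (occurs_self hg2)
    · exact Subtype.ext (congrArg Monoid.Coprod.inl (map_comp_op (SimplexCategory.σ i) e' z).symm)
  · obtain ⟨σ, hσ⟩ := σ
    obtain ⟨i, e', rfl⟩ := key σ (by omega)
    have : Epi (SimplexCategory.σ i ≫ e') := SimplexCategory.epi_iff_surjective.2 hσ
    have : Epi e' := epi_of_epi (SimplexCategory.σ i) e'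
    refine ⟨i, ⟨Monoid.Coprod.inr (FreeGroup.of ⟨e', SimplexCategory.epi_iff_surjective.1 this⟩),
      Subgroup.subset_closure (Or.inr ⟨hN, _, rfl⟩)⟩, Subtype.ext ?_⟩
    change attachMap xt (SimplexCategory.σ i).op (Monoid.Coprod.inr (FreeGroup.of _)) = _
    simp only [attachMap, Monoid.Coprod.lift_apply_inr, FreeGroup.lift_apply_of]
    exact dif_pos hσ

include hW hM in
theorem closure_degenerate_fund : AddSubgroup.closure ({y | ∃ (i : Fin (M + 1))
    (z : (simplicialAb (R.localGroup xt W)) _⦋M⦌), (simplicialAb (R.localGroup xt W)).σ i z = y} ∪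
      {abOf (R.localGroup xt W) (R.fund xt W)}) = ⊤ := by
  refine closure_abOf_eq_top (R.localGens_bijective xt hW (op ⦋M + 1⦌)) _ fun y hy => ?_
  rcases R.eq_fund_or_degenerate hW hM y hy with rfl | ⟨i, z, rfl⟩
  · exact Or.inr rfl
  · exact Or.inl ⟨i, abOf _ z, rfl⟩

theorem fund_mem_localGens (hM : 1 ≤ M) : R.fund xt W ∈ R.localGens xt W (op ⦋M + 1⦌) :=
  Or.inr ⟨by omega, _, R.fund_val_of_le xt W (by omega)⟩

open Classical in
/-- The exponent sum of the symbol `s` in an element of the local group. -/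
def symbolExp : (simplicialAb (R.localGroup xt W)) _⦋M + 1⦌ →+ ℤ :=
  abLift ((AddMonoidHom.toMultiplicative (Finsupp.applyAddHom ⟨_, R.fund_mem_localGens hM⟩)).comp
    (basisCoord (R.localGens_bijective xt hW (op ⦋M + 1⦌))))

theorem symbolExp_abOf (y : (R.localGroup xt W) _⦋M + 1⦌)
    (hy : y ∈ R.localGens xt W (op ⦋M + 1⦌)) [Decidable (y = R.fund xt W)] :
    R.symbolExp hW hM (abOf _ y) = if y = R.fund xt W then 1 else 0 := by
  classical
  refine (abLift_abOf _ _).trans ?_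
  change (basisCoord (R.localGens_bijective xt hW (op ⦋M + 1⦌)) y).toAdd ⟨_, _⟩ = _
  rw [basisCoord_of_mem (R.localGens_bijective xt hW (op ⦋M + 1⦌)) ⟨y, hy⟩, Finsupp.single_apply]
  simp only [Subtype.mk.injEq]

theorem symbolExp_fund : R.symbolExp hW hM (abOf _ (R.fund xt W)) = 1 := by
  classical
  rw [R.symbolExp_abOf hW hM _ (R.fund_mem_localGens hM), if_pos rfl]

theorem symbolExp_σ (i : Fin (M + 1)) (y : (simplicialAb (R.localGroup xt W)) _⦋M⦌) :
    R.symbolExp hW hM ((simplicialAb (R.localGroup xt W)).σ i y) = 0 := by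
  classical
  obtain ⟨g, rfl⟩ := abOf_surjective y
  rw [abOf_eq_sum (R.localGens_bijective xt hW (op ⦋M⦌)) g]
  simp only [Finsupp.sum, map_sum, map_zsmul]
  refine Finset.sum_eq_zero fun y _ => ?_
  have h1 : (simplicialAb (R.localGroup xt W)).σ i (abOf _ y.1) =
      abOf _ ((R.localGroup xt W).σ i y.1) := rfl
  have h2 := (R.isFreeSimplicialBasis_localGens xt hW).2 M i y.1 y.2
  rw [h1, R.symbolExp_abOf hW hM _ h2, if_neg, smul_zero]
  intro h3
  have h4 := congrArg Subtype.val h3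
  rw [R.fund_val_of_le xt W (by omega)] at h4
  rcases y.2 with (⟨z, hz, hy⟩ | ⟨hN, σ, hy⟩)
  · have h5 : ((R.localGroup xt W).σ i y.1).1 =
        Monoid.Coprod.inl (A.left.map (SimplexCategory.σ i).op z) :=
      congrArg (attachMap xt (SimplexCategory.σ i).op) hy
    rw [h5] at h4
    have h6 := congrArg (Monoid.Coprod.lift 1 (expSum _)) h4
    rw [Monoid.Coprod.lift_apply_inl, Monoid.Coprod.lift_apply_inr] at h6
    have h7 := congrArg Multiplicative.toAdd h6.symm
    simp [expSum] at h7
  · have : Epi σ.1 := SimplexCategory.epi_iff_surjective.2 σ.2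
    have := SimplexCategory.len_le_of_epi σ.1
    simp at this

theorem symbolExp_altFace (x : (simplicialAb (R.localGroup xt W)) _⦋M + 2⦌) :
    R.symbolExp hW hM (altFace _ (M + 1) x) = 0 := by
  obtain ⟨g, rfl⟩ := abOf_surjective x
  rw [abOf_eq_sum (R.localGens_bijective xt hW (op ⦋M + 2⦌)) g]
  simp only [Finsupp.sum, map_sum, map_zsmul]
  refine Finset.sum_eq_zero fun y _ => ?_
  obtain ⟨i, z, hz⟩ := R.exists_σ_eq_of_mem_localGens y.1 hW hM y.2
  have h1 : (simplicialAb (R.localGroup xt W)).σ i (abOf _ z) = abOf _ y.1 :=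
    congrArg (abOf _) hz
  rw [← h1, comp_altFace_σ _ _ (R.symbolExp_σ hW hM), smul_zero]

end FreeResolution

/-! ### Homogeneous cyclic cochains of a group -/

section ConjCochains

/-- The quotients of consecutive entries of a tuple: the inhomogeneous coordinates of a homogeneous simplex. -/
def ratios {G : Type} [Group G] {p : ℕ} (x : Fin (p + 1) → G) : Fin p → G :=
  fun i => (x i.castSucc)⁻¹ * x i.succ

section Ratios
variable {G : Type} [Group G]

theorem ratios_mul {p : ℕ} (y : G) (x : Fin (p + 1) → G) :
    ratios (fun i => y * x i) = ratios x := by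
  funext i
  simp [ratios, mul_assoc]

theorem ratios_partialProd {p : ℕ} (g : Fin p → G) : ratios (Fin.partialProd g) = g :=
  funext fun i => Fin.partialProd_right_inv g i

theorem mul_partialProd_ratios {p : ℕ} (x : Fin (p + 1) → G) :
    (fun i => x 0 * Fin.partialProd (ratios x) i) = x := Fin.partialProd_left_inv x

theorem comp_partialProd {H : Type} [Group H] (f : G →* H) {p : ℕ} (g : Fin p → G) :
    f ∘ Fin.partialProd g = Fin.partialProd (f ∘ g) := by
  funext i
  induction i using Fin.induction with
  | zero => simp
  | succ i ih =>
    rw [Function.comp_apply, Fin.partialProd_succ, Fin.partialProd_succ, map_mul]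
    exact congrArg (· * f (g i)) ih

end Ratios

theorem barD_ratios (R : Type) [CommRing R] (G : GrpCat.{0}) {p : ℕ} (x : Fin (p + 2) → G) :
    barD R G p (Finsupp.single (ratios x) 1) =
      ∑ i : Fin (p + 2), (-1 : R) ^ (i : ℕ) • Finsupp.single (ratios (x ∘ i.succAbove)) 1 := by
  have hx : ∀ i : Fin (p + 2), ratios (x ∘ i.succAbove) =
      ratios (Fin.partialProd (ratios x) ∘ i.succAbove) := by
    intro i
    conv_lhs => rw [← mul_partialProd_ratios x]
    exact ratios_mul (x 0) _
  rw [barD_single, Fin.sum_univ_succ (n := p + 1)]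
  congr 1
  · rw [hx]
    have : Fin.partialProd (ratios x) ∘ (0 : Fin (p + 2)).succAbove =
        fun i => ratios x 0 * Fin.partialProd (Fin.tail (ratios x)) i := by
      funext i
      simp only [Function.comp_apply, Fin.zero_succAbove]
      exact Fin.partialProd_succ' _ i
    rw [this, ratios_mul, ratios_partialProd]
    simp only [Fin.val_zero, pow_zero, one_smul]
    rfl
  · refine Finset.sum_congr rfl fun j _ => ?_
    rw [hx, ← Fin.partialProd_contractNth, ratios_partialProd, Fin.val_succ]

/-- Homogeneous cochains of degree `p` on all centralizers of `G` at once: functions `u(m; x_0, …, x_p)` which are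
invariant under simultaneous conjugation of `m` and translation of the `x_i`, and under multiplication of a single `x_i`
by `m`. In degree `1` the cocycles `u` give cyclic cocycles `g_0 ⊗ g_1 ↦ u(g_1 g_0; 1, g_1)` on the group algebra. -/
def conjCochains (G : Type) [Group G] (p : ℕ) : Submodule ℂ (G → (Fin (p + 1) → G) → ℂ) where
  carrier := {u | (∀ y m x, u (y * m * y⁻¹) (fun i => y * x i) = u m x) ∧
    ∀ m x i, u m (Function.update x i (m * x i)) = u m x}
  add_mem' hu hv := ⟨fun y m x => congrArg₂ (· + ·) (hu.1 y m x) (hv.1 y m x),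
    fun m x i => congrArg₂ (· + ·) (hu.2 m x i) (hv.2 m x i)⟩
  zero_mem' := ⟨fun _ _ _ => rfl, fun _ _ _ => rfl⟩
  smul_mem' c _ hu := ⟨fun y m x => congrArg (c * ·) (hu.1 y m x),
    fun m x i => congrArg (c * ·) (hu.2 m x i)⟩

/-- The coboundary of homogeneous cochains. -/
def homogDiff (G : Type) (p : ℕ) :
    (G → (Fin (p + 1) → G) → ℂ) →ₗ[ℂ] (G → (Fin (p + 2) → G) → ℂ) where
  toFun u m x := ∑ i : Fin (p + 2), (-1 : ℂ) ^ (i : ℕ) * u m (x ∘ i.succAbove)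
  map_add' u v := by
    funext m x
    simp [mul_add, Finset.sum_add_distrib]
  map_smul' c u := by
    funext m x
    simp [Finset.mul_sum, mul_left_comm]

theorem homogDiff_apply {G : Type} {p : ℕ} (u : G → (Fin (p + 1) → G) → ℂ) (m : G)
    (x : Fin (p + 2) → G) : homogDiff G p u m x =
      ∑ i : Fin (p + 2), (-1 : ℂ) ^ (i : ℕ) * u m (x ∘ i.succAbove) := rfl

theorem homogDiff_cons {G : Type} {p : ℕ} (u : G → (Fin (p + 2) → G) → ℂ) (m t : G)
    (x : Fin (p + 2) → G) : homogDiff G (p + 1) u m (Fin.cons t x) =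
      u m x - ∑ i : Fin (p + 2), (-1 : ℂ) ^ (i : ℕ) * u m (Fin.cons t (x ∘ i.succAbove)) := by
  rw [homogDiff_apply, Fin.sum_univ_succ, sub_eq_add_neg, ← Finset.sum_neg_distrib]
  congr 1
  · simp only [Fin.val_zero, pow_zero, one_mul]
    congr 1
  · refine Finset.sum_congr rfl fun i _ => ?_
    have : (Fin.cons t x : Fin (p + 3) → G) ∘ i.succ.succAbove =
        (Fin.cons t (x ∘ i.succAbove) : Fin (p + 2) → G) := by
      funext k
      cases k using Fin.cases <;> simp
    rw [this, Fin.val_succ, pow_succ]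
    ring

section Transport
variable {G : Type} [Group G]

/-- A chosen representative of the conjugacy class of `m`. -/
def classRep (m : G) : G := (ConjClasses.mk m).out

/-- A chosen element which conjugates the representative of the class of `m` to `m`. -/
def toRep (m : G) : G :=
  (isConj_iff.1 (ConjClasses.mk_eq_mk_iff_isConj.1 (Quotient.out_eq (ConjClasses.mk m)))).choose

theorem toRep_spec (m : G) : toRep m * classRep m * (toRep m)⁻¹ = m :=
  (isConj_iff.1 (ConjClasses.mk_eq_mk_iff_isConj.1 (Quotient.out_eq (ConjClasses.mk m)))).choose_spec

theorem classRep_conj (y m : G) : classRep (y * m * y⁻¹) = classRep m := by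
  have : ConjClasses.mk (y * m * y⁻¹) = ConjClasses.mk m :=
    ConjClasses.mk_eq_mk_iff_isConj.2 (isConj_iff.2 ⟨y⁻¹, by group⟩)
  rw [classRep, this, classRep]

theorem classRep_ne_one {m : G} (hm : m ≠ 1) : classRep m ≠ 1 := by
  intro h
  have := toRep_spec m
  rw [h] at this
  exact hm (by rw [← this]; group)

/-- The quotient of the centralizer of `r` by the subgroup generated by `r`. -/
abbrev CentralizerQuotient (r : G) : Type :=
  Subgroup.centralizer {r} ⧸ (Subgroup.zpowers r).subgroupOf (Subgroup.centralizer {r})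

variable {p : ℕ} {u : G → (Fin (p + 2) → G) → ℂ}

theorem conjCochains_cons_zpow (hu : u ∈ conjCochains G (p + 1)) (m t : G) (x : Fin (p + 1) → G)
    (k : ℤ) : u m (Fin.cons (m ^ k * t) x) = u m (Fin.cons t x) := by
  have h1 : ∀ t, u m (Fin.cons (m * t) x) = u m (Fin.cons t x) := by
    intro t
    have := hu.2 m (Fin.cons t x) 0
    rwa [Fin.update_cons_zero, Fin.cons_zero] at this
  induction k using Int.induction_on with
  | zero => simp
  | succ k ih =>
    have h2 : m ^ ((k : ℤ) + 1) * t = m * (m ^ (k : ℤ) * t) := by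
      rw [← mul_assoc, ← zpow_one_add]; ring_nf
    rw [h2, h1, ih]
  | pred k ih =>
    have h2 : m * (m ^ (-(k : ℤ) - 1) * t) = m ^ (-(k : ℤ)) * t := by
      rw [← mul_assoc, ← zpow_one_add]; ring_nf
    rw [← h1, h2, ih]

theorem conjCochains_cons_toRep (hu : u ∈ conjCochains G (p + 1)) (m : G) (x : Fin (p + 1) → G)
    {a b : G} (ha : a ∈ Subgroup.centralizer {classRep m})
    (hab : a⁻¹ * b ∈ Subgroup.zpowers (classRep m)) :
    u m (Fin.cons (toRep m * a) x) = u m (Fin.cons (toRep m * b) x) := by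
  obtain ⟨k, hk⟩ := Subgroup.mem_zpowers_iff.1 hab
  have h1 : b = a * classRep m ^ k := by rw [hk]; group
  have h2 : a * classRep m ^ k = classRep m ^ k * a :=
    (show Commute a (classRep m) from (Subgroup.mem_centralizer_singleton_iff.1 ha)).zpow_right k
  have h3 : toRep m * classRep m ^ k * (toRep m)⁻¹ = m ^ k := by
    rw [← conj_zpow, toRep_spec]
  have h4 : toRep m * b = m ^ k * (toRep m * a) := by
    rw [h1, h2, ← h3]
    simp only [mul_assoc, inv_mul_cancel_left]
  rw [h4, conjCochains_cons_zpow hu]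

/-- The value of a cochain at `t, x`, as a function of `t` in the set of elements which conjugate the representative of
the class of `m` to `m`, modulo powers of `m`. -/
def cosetValue (hu : u ∈ conjCochains G (p + 1)) (m : G) (x : Fin (p + 1) → G) :
    CentralizerQuotient (classRep m) → ℂ :=
  Quotient.lift (fun ζ : Subgroup.centralizer {classRep m} =>
    u m (Fin.cons (toRep m * (ζ : G)) x)) fun a b hab =>
      conjCochains_cons_toRep hu m x a.2 (by
        have h : a⁻¹ * b ∈ (Subgroup.zpowers (classRep m)).subgroupOf
          (Subgroup.centralizer {classRep m}) := QuotientGroup.leftRel_apply.1 hab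
        exact h)

/-- The sum of the values of a cochain over all `t` which conjugate the representative of the class of `m` to `m`, modulo
powers of `m`. -/
def cosetSum (hu : u ∈ conjCochains G (p + 1)) (m : G) (x : Fin (p + 1) → G) : ℂ :=
  ∑ᶠ ζ, cosetValue hu m x ζ

theorem cosetSum_conj (hu : u ∈ conjCochains G (p + 1)) (y m : G) (x : Fin (p + 1) → G) :
    cosetSum hu (y * m * y⁻¹) (fun i => y * x i) = cosetSum hu m x := by
  -- the two chosen conjugating elements differ by an element of the centralizer
  have key : ∀ (r t t' m : G) (_ : t * r * t⁻¹ = m) (_ : t' * r * t'⁻¹ = m),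
      t⁻¹ * t' ∈ Subgroup.centralizer {r} := by
    intro r t t' m h h'
    rw [Subgroup.mem_centralizer_singleton_iff]
    have h1 : t * r * t⁻¹ = t' * r * t'⁻¹ := h.trans h'.symm
    have h2 : r = t⁻¹ * (t' * r * t'⁻¹) * t := by rw [← h1]; group
    calc t⁻¹ * t' * r = (t⁻¹ * (t' * r * t'⁻¹) * t) * (t⁻¹ * t') := by group
      _ = r * (t⁻¹ * t') := by rw [← h2]
  have h1 : (y⁻¹ * toRep (y * m * y⁻¹)) * classRep m * (y⁻¹ * toRep (y * m * y⁻¹))⁻¹ = m := by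
    have h2 := toRep_spec (y * m * y⁻¹)
    rw [classRep_conj] at h2
    calc _ = y⁻¹ * (toRep (y * m * y⁻¹) * classRep m * (toRep (y * m * y⁻¹))⁻¹) * y := by group
      _ = m := by rw [h2]; group
  let ζ₀ : Subgroup.centralizer {classRep m} := ⟨_, key _ _ _ m (toRep_spec m) h1⟩
  have hζ₀ : toRep m * (ζ₀ : G) = y⁻¹ * toRep (y * m * y⁻¹) := by simp [ζ₀]
  have aux : ∀ r (hr : classRep (y * m * y⁻¹) = r) (F : CentralizerQuotient r → ℂ),
      (∀ ζ : Subgroup.centralizer {r}, F (QuotientGroup.mk ζ) =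
        u (y * m * y⁻¹) (Fin.cons (toRep (y * m * y⁻¹) * ζ) fun i => y * x i)) →
      ∑ᶠ ζ, F ζ = cosetSum hu (y * m * y⁻¹) (fun i => y * x i) := by
    rintro r rfl F hF
    refine finsum_congr fun ζ => ?_
    obtain ⟨ζ, rfl⟩ := QuotientGroup.mk_surjective ζ
    exact hF ζ
  refine (aux _ (classRep_conj y m) (fun ζ => cosetValue hu m x (ζ₀ • ζ)) fun ζ => ?_).symm.trans ?_
  · change u m (Fin.cons (toRep m * ((ζ₀ : G) * ζ)) x) = _
    rw [← hu.1 y m]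
    refine congrArg _ (funext fun i => ?_)
    cases i using Fin.cases with
    | zero =>
      simp only [Fin.cons_zero]
      rw [← mul_assoc (toRep m), hζ₀]
      group
    | succ i => simp
  · exact finsum_comp_equiv (MulAction.toPerm ζ₀)

theorem cosetSum_update (hu : u ∈ conjCochains G (p + 1)) (m : G) (x : Fin (p + 1) → G)
    (i : Fin (p + 1)) : cosetSum hu m (Function.update x i (m * x i)) = cosetSum hu m x := by
  refine finsum_congr fun ζ => ?_
  obtain ⟨ζ, rfl⟩ := QuotientGroup.mk_surjective ζ
  change u m (Fin.cons _ _) = u m (Fin.cons _ _)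
  rw [Fin.cons_update]
  exact hu.2 m _ i.succ

theorem homogDiff_cosetSum (hu : u ∈ conjCochains G (p + 1)) (hd : homogDiff G (p + 1) u = 0)
    (m : G) [Finite (CentralizerQuotient (classRep m))] (x : Fin (p + 2) → G) :
    ∑ i : Fin (p + 2), (-1 : ℂ) ^ (i : ℕ) * cosetSum hu m (x ∘ i.succAbove) =
      Nat.card (CentralizerQuotient (classRep m)) * u m x := by
  have := Fintype.ofFinite (CentralizerQuotient (classRep m))
  simp only [cosetSum, finsum_eq_sum_of_fintype, Finset.mul_sum]
  rw [Finset.sum_comm]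
  have : ∀ ζ, ∑ i : Fin (p + 2), (-1 : ℂ) ^ (i : ℕ) * cosetValue hu m (x ∘ i.succAbove) ζ =
      u m x := by
    intro ζ
    obtain ⟨ζ, rfl⟩ := QuotientGroup.mk_surjective ζ
    have h1 := homogDiff_cons u m (toRep m * ζ) x
    rw [hd] at h1
    exact (sub_eq_zero.1 h1.symm).symm
  simp only [this, Finset.sum_const, Finset.card_univ, nsmul_eq_mul, Nat.card_eq_fintype_card]

end Transport

/-- The cochain on the bar complex which is the part of a homogeneous cochain at `m = 1`. -/
def barPart {G : Type} [Group G] {p : ℕ} (u : G → (Fin (p + 1) → G) → ℂ) :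
    ((Fin p → G) →₀ ℂ) →ₗ[ℂ] ℂ :=
  Finsupp.linearCombination ℂ fun g => u 1 (Fin.partialProd g)

theorem barPart_single {G : Type} [Group G] {p : ℕ} (u : G → (Fin (p + 1) → G) → ℂ)
    (g : Fin p → G) (a : ℂ) : barPart u (Finsupp.single g a) = a * u 1 (Fin.partialProd g) :=
  Finsupp.linearCombination_single ..

theorem barPart_zero {G : Type} [Group G] {p : ℕ} (c : (Fin p → G) →₀ ℂ) :
    barPart (0 : G → (Fin (p + 1) → G) → ℂ) c = 0 := by
  induction c using Finsupp.induction_linear with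
  | zero => exact map_zero _
  | add c d hc hd => rw [map_add, hc, hd, add_zero]
  | single g a => rw [barPart_single]; simp

theorem barPart_ratios {G : Type} [Group G] {p : ℕ} {u : G → (Fin (p + 1) → G) → ℂ}
    (hu : u ∈ conjCochains G p) (x : Fin (p + 1) → G) :
    barPart u (Finsupp.single (ratios x) 1) = u 1 x := by
  rw [barPart_single, one_mul, ← hu.1 (x 0), mul_partialProd_ratios]
  simp

theorem barPart_homogDiff {G : GrpCat.{0}} {p : ℕ} {u : G → (Fin (p + 1) → G) → ℂ}
    (hu : u ∈ conjCochains G p) (c : (Fin (p + 1) → G) →₀ ℂ) :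
    barPart (homogDiff G p u) c = barPart u (barD ℂ G p c) := by
  suffices h : barPart (homogDiff G p u) = barPart u ∘ₗ barD ℂ G p from LinearMap.congr_fun h c
  refine Finsupp.lhom_ext' fun g => LinearMap.ext_ring ?_
  simp only [LinearMap.comp_apply, Finsupp.lsingle_apply]
  have h := barD_ratios ℂ G (Fin.partialProd g)
  rw [ratios_partialProd] at h
  rw [h, map_sum, barPart_single, one_mul, homogDiff_apply]
  simp only [map_smul, barPart_ratios hu, smul_eq_mul]

/-- For a free group, the complex of homogeneous cochains is exact in degrees `≥ 2`: at `m = 1` this is the contraction of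
the bar complex, and elsewhere it follows by averaging over the finite group `Z(m)/⟨m⟩`. -/
theorem exists_homogDiff_eq {G : GrpCat.{0}} [IsFreeGroup G] {p : ℕ}
    {u : G → (Fin (p + 3) → G) → ℂ} (hu : u ∈ conjCochains G (p + 2))
    (hd : homogDiff G (p + 2) u = 0) :
    ∃ w ∈ conjCochains G (p + 1), homogDiff G (p + 1) w = u := by
  classical
  obtain ⟨ψ, hψ⟩ := exists_comp_barD_eq ℂ p (barPart u) (LinearMap.ext fun c => by
    have h := barPart_homogDiff hu c
    rw [hd] at h
    exact h.symm.trans (barPart_zero c))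
  let w : G → (Fin (p + 2) → G) → ℂ := fun m x =>
    if m = 1 then ψ (Finsupp.single (ratios x) 1)
    else (Nat.card (CentralizerQuotient (classRep m)) : ℂ)⁻¹ * cosetSum hu m x
  refine ⟨w, ⟨fun y m x => ?_, fun m x i => ?_⟩, ?_⟩
  · by_cases hm : m = 1
    · subst hm
      simp only [w, mul_one, mul_inv_cancel, if_true, ratios_mul]
    · have hm2 : y * m * y⁻¹ ≠ 1 := by
        intro h
        exact hm (conj_eq_one_iff.1 h)
      simp only [w, if_neg hm, if_neg hm2, cosetSum_conj, classRep_conj]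
  · by_cases hm : m = 1
    · subst hm
      simp
    · simp only [w, if_neg hm, cosetSum_update]
  · funext m x
    rw [homogDiff_apply]
    by_cases hm : m = 1
    · subst hm
      simp only [w, if_true]
      rw [← barPart_ratios hu, ← hψ, LinearMap.comp_apply, barD_ratios, map_sum]
      simp only [map_smul, smul_eq_mul]
    · have := finite_centralizer_quotient (classRep m) (classRep_ne_one hm)
      simp only [w, if_neg hm]
      have h1 := homogDiff_cosetSum hu hd m x
      have h2 : (Nat.card (CentralizerQuotient (classRep m)) : ℂ) ≠ 0 :=
        Nat.cast_ne_zero.2 Nat.card_pos.ne'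
      rw [← mul_right_inj' h2, ← h1, Finset.mul_sum]
      refine Finset.sum_congr rfl fun i _ => ?_
      field_simp

end ConjCochains

/-! ### Descent along the simplicial direction -/

section Descent

/-- The restriction of homogeneous cochains along a homomorphism. -/
def pullCochain {G H : Type} [Group G] [Group H] (f : G →* H) (p : ℕ) :
    (H → (Fin (p + 1) → H) → ℂ) →ₗ[ℂ] (G → (Fin (p + 1) → G) → ℂ) where
  toFun u m x := u (f m) (f ∘ x)
  map_add' _ _ := rfl
  map_smul' _ _ := rfl

theorem pullCochain_mem {G H : Type} [Group G] [Group H] (f : G →* H) {p : ℕ}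
    {u : H → (Fin (p + 1) → H) → ℂ} (hu : u ∈ conjCochains H p) :
    pullCochain f p u ∈ conjCochains G p := by
  refine ⟨fun y m x => ?_, fun m x i => ?_⟩
  · have h := hu.1 (f y) (f m) (f ∘ x)
    rw [← map_mul, ← map_inv, ← map_mul] at h
    refine Eq.trans (congrArg (u _) (funext fun i => ?_)) h
    exact map_mul f y (x i)
  · refine Eq.trans (congrArg (u (f m)) ?_) (hu.2 (f m) (f ∘ x) i)
    rw [Function.comp_update, map_mul]
    rfl

variable (Γ : SimplicialObject GrpCat.{0})

/-- The simplicial coboundary of homogeneous cochains. -/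
def simpDiff (p q : ℕ) : (Γ _⦋q⦌ → (Fin (p + 1) → Γ _⦋q⦌) → ℂ) →ₗ[ℂ]
    (Γ _⦋q + 1⦌ → (Fin (p + 1) → Γ _⦋q + 1⦌) → ℂ) :=
  ∑ i : Fin (q + 2), (-1 : ℂ) ^ (i : ℕ) • pullCochain (Γ.δ i).hom p

variable {Γ}

theorem simpDiff_apply {p q : ℕ} (u : Γ _⦋q⦌ → (Fin (p + 1) → Γ _⦋q⦌) → ℂ) (m : Γ _⦋q + 1⦌)
    (x : Fin (p + 1) → Γ _⦋q + 1⦌) : simpDiff Γ p q u m x =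
      ∑ i : Fin (q + 2), (-1 : ℂ) ^ (i : ℕ) * u (Γ.δ i m) (Γ.δ i ∘ x) := by
  simp only [simpDiff, LinearMap.sum_apply, LinearMap.smul_apply, Finset.sum_apply, Pi.smul_apply,
    smul_eq_mul]
  rfl

theorem simpDiff_mem {p q : ℕ} {u : Γ _⦋q⦌ → (Fin (p + 1) → Γ _⦋q⦌) → ℂ}
    (hu : u ∈ conjCochains (Γ _⦋q⦌) p) : simpDiff Γ p q u ∈ conjCochains (Γ _⦋q + 1⦌) p := by
  rw [simpDiff, LinearMap.sum_apply]
  exact Submodule.sum_mem _ fun i _ => Submodule.smul_mem _ _ (pullCochain_mem _ hu)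

theorem homogDiff_simpDiff {p q : ℕ} (u : Γ _⦋q⦌ → (Fin (p + 1) → Γ _⦋q⦌) → ℂ) :
    homogDiff _ p (simpDiff Γ p q u) = simpDiff Γ (p + 1) q (homogDiff _ p u) := by
  funext m x
  simp only [homogDiff_apply, simpDiff_apply, Finset.mul_sum]
  rw [Finset.sum_comm]
  refine Finset.sum_congr rfl fun i _ => Finset.sum_congr rfl fun j _ => ?_
  exact mul_left_comm _ _ _

/-- A homogeneous cochain as a functional on the tuples `(m, x_0, …, x_p)`. -/
def asFunctional {G : Type} {p : ℕ} (u : G → (Fin (p + 1) → G) → ℂ) :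
    ((Fin (p + 2) → G) →₀ ℂ) →ₗ[ℂ] ℂ :=
  Finsupp.linearCombination ℂ fun t => u (t 0) (Fin.tail t)

theorem asFunctional_single {G : Type} {p : ℕ} (u : G → (Fin (p + 1) → G) → ℂ)
    (t : Fin (p + 2) → G) (a : ℂ) :
    asFunctional u (Finsupp.single t a) = a * u (t 0) (Fin.tail t) :=
  Finsupp.linearCombination_single ..

theorem asFunctional_simpDiff {p q : ℕ} (u : Γ _⦋q⦌ → (Fin (p + 1) → Γ _⦋q⦌) → ℂ)
    (c : (Fin (p + 2) → Γ _⦋q + 1⦌) →₀ ℂ) :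
    asFunctional (simpDiff Γ p q u) c = asFunctional u (barFace ℂ Γ (p + 2) q c) := by
  suffices h : asFunctional (simpDiff Γ p q u) = asFunctional u ∘ₗ barFace ℂ Γ (p + 2) q from
    LinearMap.congr_fun h c
  refine Finsupp.lhom_ext' fun t => LinearMap.ext_ring ?_
  simp only [LinearMap.comp_apply, Finsupp.lsingle_apply]
  rw [barFace_single, map_sum, asFunctional_single, one_mul, simpDiff_apply]
  refine Finset.sum_congr rfl fun i _ => ?_
  rw [map_zsmul, asFunctional_single, one_mul, zsmul_eq_mul]
  push_cast
  rfl

theorem simpDiff_simpDiff {p q : ℕ} (u : Γ _⦋q⦌ → (Fin (p + 1) → Γ _⦋q⦌) → ℂ) :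
    simpDiff Γ p (q + 1) (simpDiff Γ p q u) = 0 := by
  funext m x
  have h : asFunctional (simpDiff Γ p (q + 1) (simpDiff Γ p q u)) (Finsupp.single (Fin.cons m x) 1) =
      simpDiff Γ p (q + 1) (simpDiff Γ p q u) m x := by
    rw [asFunctional_single, one_mul, Fin.tail_cons, Fin.cons_zero]
  have h2 : barFace ℂ Γ (p + 2) q (barFace ℂ Γ (p + 2) (q + 1)
      (Finsupp.single (Fin.cons m x) 1)) = 0 :=
    Bicomplex.dh_dh (bic (Cyclic.bar ℂ) Γ) (p + 2) q _
  rw [← h, asFunctional_simpDiff, asFunctional_simpDiff, h2, map_zero]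
  rfl

theorem barPart_smul {G : Type} [Group G] {p : ℕ} (a : ℂ) (u : G → (Fin (p + 1) → G) → ℂ)
    (c : (Fin p → G) →₀ ℂ) : barPart (a • u) c = a * barPart u c := by
  induction c using Finsupp.induction_linear with
  | zero => simp
  | add c d hc hd => rw [map_add, map_add, hc, hd, mul_add]
  | single g b => rw [barPart_single, barPart_single]; exact mul_left_comm _ _ _

theorem barPart_simpDiff {p q : ℕ} (u : Γ _⦋q⦌ → (Fin (p + 1) → Γ _⦋q⦌) → ℂ)
    (c : (Fin p → Γ _⦋q + 1⦌) →₀ ℂ) :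
    barPart (simpDiff Γ p q u) c = barPart u (barFace ℂ Γ p q c) := by
  suffices h : barPart (simpDiff Γ p q u) = barPart u ∘ₗ barFace ℂ Γ p q from
    LinearMap.congr_fun h c
  refine Finsupp.lhom_ext' fun g => LinearMap.ext_ring ?_
  simp only [LinearMap.comp_apply, Finsupp.lsingle_apply]
  rw [barFace_single, map_sum, barPart_single, one_mul, simpDiff_apply]
  refine Finset.sum_congr rfl fun i _ => ?_
  rw [map_zsmul, barPart_single, one_mul, zsmul_eq_mul]
  have h1 : Γ.δ i ∘ Fin.partialProd g = Fin.partialProd (Γ.δ i ∘ g) :=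
    comp_partialProd (Γ.δ i).hom g
  have h2 : Γ.δ i 1 = 1 := map_one (Γ.δ i).hom
  rw [h1, h2]
  push_cast
  rfl

/-- Zigzag in the double complex of homogeneous cochains: as the columns are exact in degrees `≥ 2`, a cocycle in
simplicial degree `0` can be pushed to a cocycle concentrated in any bidegree `(p + 1, q)` of the same total degree,
without changing its values on the cycles of the bar bicomplex. -/
theorem exists_zigzag (hΓ : ∀ m, IsFreeGroup (Γ.obj m)) {n : ℕ}
    {e₀ : Γ _⦋0⦌ → (Fin (n + 1) → Γ _⦋0⦌) → ℂ} (h1 : e₀ ∈ conjCochains (Γ _⦋0⦌) n)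
    (h2 : homogDiff _ n e₀ = 0) (h3 : simpDiff Γ n 0 e₀ = 0) (p q : ℕ) (hpq : p + 1 + q = n) :
    ∃ e ∈ conjCochains (Γ _⦋q⦌) (p + 1), homogDiff _ (p + 1) e = 0 ∧ simpDiff Γ (p + 1) q e = 0 ∧
      ∀ z ∈ (bic (Cyclic.bar ℂ) Γ).cycles n, barPart e (z (p + 1) q) = barPart e₀ (z n 0) := by
  induction q generalizing p with
  | zero =>
    obtain rfl : p + 1 = n := hpq
    exact ⟨e₀, h1, h2, h3, fun z _ => rfl⟩
  | succ q ih =>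
    obtain ⟨e, he1, he2, he3, he4⟩ := ih (p + 1) (by omega)
    have := hΓ (op ⦋q⦌)
    obtain ⟨w, hw, rfl⟩ := exists_homogDiff_eq he1 he2
    refine ⟨(-(-1 : ℂ) ^ (p + 1)) • simpDiff Γ (p + 1) q w,
      Submodule.smul_mem _ _ (simpDiff_mem hw), ?_, ?_, fun z hz => ?_⟩
    · rw [map_smul, homogDiff_simpDiff, he3, smul_zero]
    · rw [map_smul, simpDiff_simpDiff, smul_zero]
    · rw [← he4 z hz]
      have h : barD ℂ (Γ _⦋q⦌) (p + 1) (z (p + 2) q) +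
          (-1 : ℂ) ^ (p + 1) • barFace ℂ Γ (p + 1) q (z (p + 1) (q + 1)) = 0 :=
        congrFun (congrFun (LinearMap.mem_ker.1 hz.2) (p + 1)) q
      have h5 := congrArg (barPart w) (eq_neg_of_add_eq_zero_left h)
      refine (barPart_smul _ _ _).trans (Eq.trans ?_ (barPart_homogDiff hw _).symm)
      rw [map_neg, map_smul, smul_eq_mul] at h5
      refine Eq.trans ?_ h5.symm
      refine (congrArg _ (barPart_simpDiff w _)).trans ?_
      ring

variable {π : GrpCat.{0}} (a : Γ _⦋0⦌ ⟶ π)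

open Classical in
/-- A functional on the bar complex of `π`, restricted to the part of the homogeneous cochains of `Γ_0` over the unit
element of `π`. -/
def startCochain {n : ℕ} (c : ((Fin n → π) →₀ ℂ) →ₗ[ℂ] ℂ) : Γ _⦋0⦌ → (Fin (n + 1) → Γ _⦋0⦌) → ℂ :=
  fun m x => if a m = 1 then c (Finsupp.single (ratios (a ∘ x)) 1) else 0

theorem startCochain_mem {n : ℕ} (c : ((Fin n → π) →₀ ℂ) →ₗ[ℂ] ℂ) :
    startCochain a c ∈ conjCochains (Γ _⦋0⦌) n := by
  refine ⟨fun y m x => ?_, fun m x i => ?_⟩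
  · have h1 : a (y * m * y⁻¹) = 1 ↔ a m = 1 := by
      rw [map_mul, map_mul, map_inv, conj_eq_one_iff]
    have h2 : (a ∘ fun i => y * x i) = fun i => a y * (a ∘ x) i :=
      funext fun i => map_mul a.hom y (x i)
    by_cases h : a m = 1
    · simp only [startCochain, if_pos h, if_pos (h1.2 h), h2, ratios_mul]
    · simp only [startCochain, if_neg h, if_neg (mt h1.1 h)]
  · by_cases h : a m = 1
    · have h2 : a ∘ Function.update x i (m * x i) = a ∘ x := by
        rw [Function.comp_update, map_mul, h, one_mul]
        exact Function.update_eq_self i (a ∘ x)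
      simp only [startCochain, h2]
    · simp only [startCochain, if_neg h]

theorem homogDiff_startCochain {n : ℕ} {c : ((Fin n → π) →₀ ℂ) →ₗ[ℂ] ℂ}
    (hc : c ∘ₗ barD ℂ π n = 0) : homogDiff _ n (startCochain a c) = 0 := by
  funext m x
  rw [homogDiff_apply]
  by_cases h : a m = 1
  · simp only [startCochain, if_pos h]
    have h1 := LinearMap.congr_fun hc (Finsupp.single (ratios (a ∘ x)) 1)
    rw [LinearMap.comp_apply, barD_ratios, map_sum] at h1
    simp only [map_smul, smul_eq_mul] at h1
    exact h1
  · simp [startCochain, if_neg h]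

theorem simpDiff_startCochain {n : ℕ} (c : ((Fin n → π) →₀ ℂ) →ₗ[ℂ] ℂ)
    (ha : Γ.δ 0 ≫ a = Γ.δ 1 ≫ a) : simpDiff Γ n 0 (startCochain a c) = 0 := by
  funext m x
  rw [simpDiff_apply, Fin.sum_univ_two]
  have h : ∀ y, a (Γ.δ 0 y) = a (Γ.δ 1 y) := fun y => ConcreteCategory.congr_hom ha y
  have h2 : a ∘ Γ.δ 0 ∘ x = a ∘ Γ.δ 1 ∘ x := funext fun i => h (x i)
  by_cases h3 : a (Γ.δ 1 m) = 1
  · simp only [startCochain, if_pos h3, if_pos ((h m).trans h3), h2]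
    simp
  · simp only [startCochain, if_neg h3, if_neg (mt (h m).symm.trans h3)]
    simp

theorem barPart_startCochain {n : ℕ} (c : ((Fin n → π) →₀ ℂ) →ₗ[ℂ] ℂ)
    (z : (Fin n → Γ _⦋0⦌) →₀ ℂ) :
    barPart (startCochain a c) z = c (((Cyclic.bar ℂ).map a).f n z) := by
  let u : ((Fin n → Γ _⦋0⦌) →₀ ℂ) →ₗ[ℂ] ((Fin n → π) →₀ ℂ) := (((Cyclic.bar ℂ).map a).f n).hom
  suffices h : barPart (startCochain a c) = c ∘ₗ u from LinearMap.congr_fun h z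
  refine Finsupp.lhom_ext' fun g => LinearMap.ext_ring ?_
  simp only [LinearMap.comp_apply, Finsupp.lsingle_apply]
  have h1 : u (Finsupp.single g 1) = Finsupp.single (a ∘ g) 1 := Cyclic.barMap_single ℂ a.hom n g 1
  rw [h1, barPart_single, one_mul, startCochain, if_pos (map_one a.hom)]
  congr 2
  have : a ∘ Fin.partialProd g = Fin.partialProd (a ∘ g) := comp_partialProd a.hom g
  rw [this, ratios_partialProd]

end Descent

/-- A nonzero class of `H_{N+1}(Bπ; ℂ)` is detected by a cocycle of the bar complex. -/
theorem exists_functional_of_augH_ne_zero (A : SimplicialObject.Augmented GrpCat.{0}) {N : ℕ}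
    (z : (bic (Cyclic.bar ℂ) A.left).cycles (N + 1))
    (hz : augH ℂ A N (Submodule.Quotient.mk z) ≠ 0) :
    ∃ c : ((Fin (N + 1) → A.right) →₀ ℂ) →ₗ[ℂ] ℂ, c ∘ₗ barD ℂ A.right (N + 1) = 0 ∧
      c (augLin ℂ A (N + 1) z.1) ≠ 0 := by
  let y : (Fin (N + 1) → A.right) →₀ ℂ := augLin ℂ A (N + 1) z.1
  have hy : y ∉ LinearMap.range (barD ℂ A.right (N + 1)) := by
    rintro ⟨w', hw⟩
    let w : ((Cyclic.bar ℂ).obj A.right).X (N + 2) := w'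
    refine hz ?_
    have e : augCycles ℂ A N z = groupHomology.toCycles (Rep.trivial ℂ A.right ℂ) (N + 2) (N + 1) w := by
      refine (ModuleCat.mono_iff_injective (groupHomology.iCycles _ (N + 1))).1 inferInstance ?_
      refine (augCycles_i ℂ A N z).trans (hw.symm.trans ?_)
      exact (ConcreteCategory.congr_hom (HomologicalComplex.toCycles_i _ _ _) w).symm
    refine (congrArg (groupHomology.π (Rep.trivial ℂ A.right ℂ) (N + 1)) e).trans ?_
    exact ConcreteCategory.congr_hom (HomologicalComplex.toCycles_comp_homologyπ _ _ _) w
  obtain ⟨c, hc, hc2⟩ := Submodule.exists_le_ker_of_notMem hy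
  refine ⟨c, LinearMap.ext fun w => hc2 ⟨w, rfl⟩, hc⟩

/-! ### Cyclic cocycles from homogeneous cocycles -/

section CyclicCochain

theorem homogDiff_one_apply {G : Type} (u : G → (Fin 2 → G) → ℂ) (m x y z : G) :
    homogDiff G 1 u m ![x, y, z] = u m ![y, z] - u m ![x, z] + u m ![x, y] := by
  have h0 : ![x, y, z] ∘ (0 : Fin 3).succAbove = ![y, z] := by
    funext i; fin_cases i <;> rfl
  have h1 : ![x, y, z] ∘ (1 : Fin 3).succAbove = ![x, z] := by
    funext i; fin_cases i <;> rfl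
  have h2 : ![x, y, z] ∘ (2 : Fin 3).succAbove = ![x, y] := by
    funext i; fin_cases i <;> rfl
  rw [homogDiff_apply, Fin.sum_univ_three, h0, h1, h2]
  simp
  ring

section Alternating
variable {G : Type} {u : G → (Fin 2 → G) → ℂ}

theorem cocycle_apply_add (hd : homogDiff G 1 u = 0) (m x y z : G) :
    u m ![y, z] - u m ![x, z] + u m ![x, y] = 0 := by
  rw [← homogDiff_one_apply, hd]
  rfl

theorem cocycle_apply_self (hd : homogDiff G 1 u = 0) (m x : G) : u m ![x, x] = 0 := by
  have := cocycle_apply_add hd m x x x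
  rwa [sub_self, zero_add] at this

theorem cocycle_apply_swap (hd : homogDiff G 1 u = 0) (m x y : G) :
    u m ![y, x] = -u m ![x, y] := by
  have := cocycle_apply_add hd m x y x
  rw [cocycle_apply_self hd, sub_zero] at this
  exact eq_neg_of_add_eq_zero_left this

variable [Group G]

theorem conjCochains_pair_conj (hu : u ∈ conjCochains G 1) {m m' : G} (y : G) {a b a' b' : G}
    (hm : y * m * y⁻¹ = m') (ha : y * a = a') (hb : y * b = b') :
    u m ![a, b] = u m' ![a', b'] := by
  subst hm ha hb
  rw [← hu.1 y m ![a, b]]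
  refine congrArg _ (funext fun i => ?_)
  fin_cases i <;> rfl

theorem conjCochains_pair_update (hu : u ∈ conjCochains G 1) (m a b : G) :
    u m ![m * a, b] = u m ![a, b] := by
  rw [← hu.2 m ![a, b] 0]
  refine congrArg _ (funext fun i => ?_)
  fin_cases i <;> rfl

end Alternating

/-- The functional `g_0 ⊗ g_1 ↦ u(g_1 g_0; 1, g_1)` on the group algebra of `G`. -/
def hochschildCochain {G : Type} [Group G] (u : G → (Fin 2 → G) → ℂ) : Cyclic.Chain G 1 →ₗ[ℂ] ℂ :=
  Finsupp.linearCombination ℂ fun g => u (g 1 * g 0) ![1, g 1]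

theorem hochschildCochain_single {G : Type} [Group G] (u : G → (Fin 2 → G) → ℂ)
    (g : Fin 2 → G) (a : ℂ) :
    hochschildCochain u (Finsupp.single g a) = a * u (g 1 * g 0) ![1, g 1] :=
  Finsupp.linearCombination_single ..

section Cocycle
variable {G : Type} [Group G] {u : G → (Fin 2 → G) → ℂ} (hu : u ∈ conjCochains G 1)
  (hd : homogDiff G 1 u = 0)

include hu hd in
/-- Invariance under the cyclic operator: conjugation by `g_1⁻¹` turns the rotated argument into a pair which
the invariance under multiplication by `m` and the cocycle identity identify with the original one. -/
theorem hochschildCochain_comp_t : hochschildCochain u ∘ₗ Cyclic.t G 1 = hochschildCochain u := by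
  refine Finsupp.lhom_ext fun g a => ?_
  rw [LinearMap.comp_apply, Cyclic.t_single, map_smul, hochschildCochain_single,
    hochschildCochain_single]
  have h0 : Cyclic.rot g 0 = g 1 := rfl
  have h1 : Cyclic.rot g 1 = g 0 := rfl
  have h2 : u (g 1 * g 0) ![1, g 1] = u (g 0 * g 1) ![(g 1)⁻¹, 1] :=
    conjCochains_pair_conj hu (g 1)⁻¹ (by group) (by group) (by group)
  have h3 := conjCochains_pair_update hu (g 0 * g 1) (g 1)⁻¹ 1
  rw [mul_inv_cancel_right] at h3
  rw [h0, h1, h2, ← h3, cocycle_apply_swap hd]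
  simp

/-- The cyclic cochain attached to a homogeneous cocycle of degree `1`. -/
def cyclicCochain : Cyclic.Coinv G 1 →ₗ[ℂ] ℂ :=
  Submodule.liftQ _ (hochschildCochain u) (by
    rintro _ ⟨c, rfl⟩
    have := LinearMap.congr_fun (hochschildCochain_comp_t hu hd) c
    rw [LinearMap.comp_apply] at this
    rw [LinearMap.mem_ker, LinearMap.sub_apply, map_sub, this, LinearMap.id_apply, sub_self])

theorem cyclicCochain_mk (c : Cyclic.Chain G 1) :
    cyclicCochain hu hd (Submodule.Quotient.mk c) = hochschildCochain u c := rfl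

/-- The Hochschild cocycle identity is the homogeneous one, after a conjugation by `g_1` in the last face. -/
theorem cyclicCochain_bCoinv (c : Cyclic.Coinv G 2) :
    cyclicCochain hu hd (Cyclic.bCoinv G 1 c) = 0 := by
  obtain ⟨c, rfl⟩ := Submodule.Quotient.mk_surjective _ c
  change hochschildCochain u (Cyclic.b G 1 c) = 0
  suffices h : hochschildCochain u ∘ₗ Cyclic.b G 1 = 0 from LinearMap.congr_fun h c
  refine Finsupp.lhom_ext fun g a => ?_
  rw [LinearMap.comp_apply, Cyclic.b_single, map_sum, Fin.sum_univ_three]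
  simp only [map_smul, hochschildCochain_single, Cyclic.face_apply]
  have h := cocycle_apply_add hd (g 1 * g 2 * g 0) 1 (g 1) (g 1 * g 2)
  have h2 : u (g 2 * (g 0 * g 1)) ![1, g 2] = u (g 1 * g 2 * g 0) ![g 1, g 1 * g 2] :=
    conjCochains_pair_conj hu (g 1) (by group) (by group) (by group)
  rw [← h2] at h
  simp [← mul_assoc] at h ⊢
  linear_combination a * h

theorem cyclicCochain_mapCoinv {H : Type} [Group H] (f : H →* G) (g : Fin 2 → H) (a : ℂ) :
    cyclicCochain hu hd (Cyclic.mapCoinv f 1 (Submodule.Quotient.mk (Finsupp.single g a))) =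
      a * u (f (g 1 * g 0)) ![1, f (g 1)] := by
  change hochschildCochain u (Cyclic.mapChain f 1 (Finsupp.single g a)) = _
  rw [Cyclic.mapChain_single, hochschildCochain_single, map_mul]
  rfl

end Cocycle

variable {Γ : SimplicialObject GrpCat.{0}} {N : ℕ} {u : Γ _⦋N⦌ → (Fin 2 → Γ _⦋N⦌) → ℂ}
  (hu : u ∈ conjCochains (Γ _⦋N⦌) 1) (hd : homogDiff (Γ _⦋N⦌) 1 u = 0)

/-- The cyclic cochain attached to a homogeneous cocycle, on the bicomplex of a simplicial group. -/
def bicCyclicCochain : ((cyclicBicomplex Γ).X N).X 1 →ₗ[ℂ] ℂ := cyclicCochain hu hd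

theorem bicCyclicCochain_dv : bicCyclicCochain hu hd ∘ₗ (cyclicBicomplex Γ).dv 1 N = 0 := by
  refine LinearMap.ext fun c => ?_
  refine Eq.trans (congrArg (cyclicCochain hu hd)
    (congrArg (fun f => f.hom c) (Cyclic.cx_d (G := Γ _⦋N⦌) 1))) ?_
  exact cyclicCochain_bCoinv hu hd c

theorem bicCyclicCochain_dh (hs : simpDiff Γ 1 N u = 0) :
    bicCyclicCochain hu hd ∘ₗ (cyclicBicomplex Γ).dh 1 N = 0 := by
  let v : Cyclic.Coinv (Γ _⦋N + 1⦌) 1 →ₗ[ℂ] ℂ :=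
    bicCyclicCochain hu hd ∘ₗ (cyclicBicomplex Γ).dh 1 N
  suffices h : v = 0 from h
  refine Submodule.linearMap_qext _ (Finsupp.lhom_ext fun g a => ?_)
  refine (congrArg (cyclicCochain hu hd) (bic_dh Cyclic.functor Γ 1 N
    (Submodule.Quotient.mk (Finsupp.single g a) : Cyclic.Coinv (Γ _⦋N + 1⦌) 1))).trans ?_
  refine (map_sum (cyclicCochain hu hd) _ _).trans ?_
  have h1 : ∀ i : Fin (N + 2), cyclicCochain hu hd ((-1 : ℤ) ^ (i : ℕ) •
      Cyclic.mapCoinv (Γ.δ i).hom 1 (Submodule.Quotient.mk (Finsupp.single g a))) =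
      a * ((-1 : ℂ) ^ (i : ℕ) * u (Γ.δ i (g 1 * g 0)) (Γ.δ i ∘ ![1, g 1])) := by
    intro i
    rw [map_zsmul, cyclicCochain_mapCoinv, zsmul_eq_mul]
    have h2 : Γ.δ i ∘ ![1, g 1] = ![1, Γ.δ i (g 1)] := by
      funext k
      fin_cases k
      · exact map_one (Γ.δ i).hom
      · rfl
    rw [h2]
    push_cast
    exact mul_left_comm _ _ _
  refine (Finset.sum_congr rfl fun i _ => h1 i).trans ?_
  rw [← Finset.mul_sum, ← simpDiff_apply, hs]
  exact mul_zero a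

theorem bicCyclicCochain_symbol (g : Γ _⦋N⦌) :
    bicCyclicCochain hu hd (cyclicSymbol Γ g) = u 1 ![1, g] := by
  refine (congrArg (cyclicCochain hu hd) (Cyclic.barToCyclicLin_single (Γ _⦋N⦌) 1 _ 1)).trans ?_
  rw [cyclicCochain_mk, hochschildCochain_single, one_mul]
  have h0 : Cyclic.nerveLift (fun _ : Fin 1 => g) 0 = g⁻¹ := by
    simp [Cyclic.nerveLift]
  have h1 : Cyclic.nerveLift (fun _ : Fin 1 => g) 1 = g := rfl
  rw [h0, h1, mul_inv_cancel]

end CyclicCochain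

/-! ### Homogeneous cocycles with integral values on symbols -/

section Hom
variable {G : Type} [Group G] {u : G → (Fin 2 → G) → ℂ} (hu : u ∈ conjCochains G 1)
  (hd : homogDiff G 1 u = 0)

/-- The part of a homogeneous cocycle of degree `1` at `m = 1` is a homomorphism. -/
def cocycleHom : G →* Multiplicative ℂ where
  toFun g := Multiplicative.ofAdd (u 1 ![1, g])
  map_one' := congrArg Multiplicative.ofAdd (cocycle_apply_self hd 1 1)
  map_mul' g h := by
    have h1 := cocycle_apply_add hd 1 1 g (g * h)
    have h2 : u 1 ![1, h] = u 1 ![g, g * h] :=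
      conjCochains_pair_conj hu g (by group) (by group) rfl
    rw [← h2] at h1
    rw [← ofAdd_add]
    exact congrArg Multiplicative.ofAdd (by linear_combination -h1)

end Hom

section Simplicial
variable {Γ : SimplicialObject GrpCat.{0}} {N : ℕ} {u : Γ _⦋N⦌ → (Fin 2 → Γ _⦋N⦌) → ℂ}

theorem simpDiff_apply_one (u : Γ _⦋N⦌ → (Fin 2 → Γ _⦋N⦌) → ℂ) (g : Γ _⦋N + 1⦌) :
    simpDiff Γ 1 N u 1 ![1, g] = ∑ i : Fin (N + 2), (-1 : ℂ) ^ (i : ℕ) * u 1 ![1, Γ.δ i g] := by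
  rw [simpDiff_apply]
  refine Finset.sum_congr rfl fun i _ => ?_
  have h1 : Γ.δ i 1 = 1 := map_one (Γ.δ i).hom
  have h2 : Γ.δ i ∘ ![1, g] = ![1, Γ.δ i g] := by
    funext k
    fin_cases k
    · exact h1
    · rfl
  rw [h1, h2]

section AbHom
variable (hu : u ∈ conjCochains (Γ _⦋N⦌) 1) (hd : homogDiff (Γ _⦋N⦌) 1 u = 0)

/-- The homomorphism of `cocycleHom`, on the abelianization. -/
def cocycleAbHom : (simplicialAb Γ) _⦋N⦌ →+ ℂ := abLift (cocycleHom hu hd)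

theorem cocycleAbHom_abOf (g : Γ _⦋N⦌) : cocycleAbHom hu hd (abOf Γ g) = u 1 ![1, g] :=
  abLift_abOf _ g

theorem cocycleAbHom_altFace (hs : simpDiff Γ 1 N u = 0) (x : (simplicialAb Γ) _⦋N + 1⦌) :
    cocycleAbHom hu hd (altFace (simplicialAb Γ) N x) = 0 := by
  obtain ⟨g, rfl⟩ := abOf_surjective x
  have h := simpDiff_apply_one u g
  rw [hs] at h
  refine Eq.trans ?_ h.symm
  rw [altFace_apply, map_sum]
  refine Finset.sum_congr rfl fun i _ => ?_
  refine (map_zsmul (cocycleAbHom hu hd) _ _).trans ?_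
  rw [zsmul_eq_mul]
  push_cast
  exact congrArg _ (cocycleAbHom_abOf hu hd _)

end AbHom

/-- A cocycle which detects a cycle of the augmented bar complex gives a homogeneous cocycle which detects its leading
term. -/
theorem exists_homogeneous_cocycle (hΓ : ∀ m, IsFreeGroup (Γ.obj m)) {π : GrpCat.{0}}
    (a : Γ _⦋0⦌ ⟶ π) (ha : Γ.δ 0 ≫ a = Γ.δ 1 ≫ a)
    {c : ((Fin (N + 1) → π) →₀ ℂ) →ₗ[ℂ] ℂ} (hc : c ∘ₗ barD ℂ π (N + 1) = 0)
    (z : (bic (Cyclic.bar ℂ) Γ).cycles (N + 1)) (s : Γ _⦋N⦌) (hzs : z.1 1 N = barSymbol ℂ Γ s)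
    (hcz : c (((Cyclic.bar ℂ).map a).f (N + 1) (z.1 (N + 1) 0)) ≠ 0) :
    ∃ u ∈ conjCochains (Γ _⦋N⦌) 1, homogDiff _ 1 u = 0 ∧ simpDiff Γ 1 N u = 0 ∧
      u 1 ![1, s] ≠ 0 := by
  obtain ⟨u, hu, hd, hs, h⟩ := exists_zigzag hΓ (startCochain_mem a c)
    (homogDiff_startCochain a hc) (simpDiff_startCochain a c ha) 0 N (by omega)
  refine ⟨u, hu, hd, hs, ?_⟩
  have h1 := h z.1 z.2
  have h2 : barPart u (z.1 (0 + 1) N) = u 1 ![1, s] := by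
    refine (congrArg (barPart u) hzs).trans ((barPart_single u _ 1).trans ?_)
    rw [one_mul]
    refine congrArg _ (funext fun i => ?_)
    fin_cases i
    · rfl
    · exact (Fin.partialProd_succ _ 0).trans (one_mul s)
  rw [← h2, h1]
  exact fun h3 => hcz ((barPart_startCochain a c _).symm.trans h3)

/-- `u` is a homogeneous cocycle, closed under the simplicial coboundary, whose values at `m = 1` are those of the
integral homomorphism `f`. -/
structure IsHomogeneousCocycle (u : Γ _⦋N⦌ → (Fin 2 → Γ _⦋N⦌) → ℂ)
    (f : (simplicialAb Γ) _⦋N⦌ →+ ℤ) : Prop where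
  mem : u ∈ conjCochains (Γ _⦋N⦌) 1
  homogDiff_eq : homogDiff (Γ _⦋N⦌) 1 u = 0
  simpDiff_eq : simpDiff Γ 1 N u = 0
  apply_one : ∀ g, u 1 ![1, g] = f (abOf Γ g)

theorem IsHomogeneousCocycle.altFace_eq_zero {f : (simplicialAb Γ) _⦋N⦌ →+ ℤ}
    (h : IsHomogeneousCocycle u f) (x : (simplicialAb Γ) _⦋N + 1⦌) :
    f (altFace (simplicialAb Γ) N x) = 0 := by
  have h1 := cocycleAbHom_altFace h.mem h.homogDiff_eq h.simpDiff_eq x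
  obtain ⟨g, hg⟩ := abOf_surjective (altFace (simplicialAb Γ) N x)
  rw [← hg, cocycleAbHom_abOf, h.apply_one] at h1
  rw [← hg]
  exact_mod_cast h1

/-- A homomorphism from a finitely generated group to `ℂ` becomes integral after a projection `ℂ → ℚ` and
multiplication by a common denominator. -/
theorem exists_integral_multiple {B : Type} [AddCommGroup B] {S : Set B} (hS : S.Finite)
    (hS2 : AddSubgroup.closure S = ⊤) (w : B →+ ℂ) (s : B) (hs : w s ≠ 0) :
    ∃ (ρ : ℂ →+ ℂ) (f : B →+ ℤ), (∀ b, ρ (w b) = f b) ∧ f s ≠ 0 := by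
  obtain ⟨r, hr⟩ : ∃ r : Module.Dual ℚ ℂ, r (w s) ≠ 0 := by
    by_contra! h
    exact hs ((Module.forall_dual_apply_eq_zero_iff ℚ (w s)).1 h)
  let D : ℕ := ∏ y ∈ hS.toFinset, (r (w y)).den
  have hD : (D : ℚ) ≠ 0 :=
    Nat.cast_ne_zero.2 (Finset.prod_ne_zero_iff.2 fun y _ => (r (w y)).den_ne_zero)
  have hint : ∀ b, ∃ k : ℤ, (D : ℚ) * r (w b) = k := by
    intro b
    have hb : b ∈ AddSubgroup.closure S := by rw [hS2]; exact AddSubgroup.mem_top b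
    induction hb using AddSubgroup.closure_induction with
    | mem y hy =>
      obtain ⟨m, hm⟩ : (r (w y)).den ∣ D := Finset.dvd_prod_of_mem _ (hS.mem_toFinset.2 hy)
      refine ⟨m * (r (w y)).num, ?_⟩
      rw [hm]
      push_cast
      rw [mul_comm ((r (w y)).den : ℚ), mul_assoc, Rat.den_mul_eq_num]
    | zero => exact ⟨0, by simp⟩
    | add x y _ _ hx hy =>
      obtain ⟨k, hk⟩ := hx
      obtain ⟨l, hl⟩ := hy
      exact ⟨k + l, by rw [map_add, map_add, mul_add, hk, hl]; push_cast; rfl⟩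
    | neg x _ hx =>
      obtain ⟨k, hk⟩ := hx
      exact ⟨-k, by rw [map_neg, map_neg, mul_neg, hk]; push_cast; rfl⟩
  choose f hf using hint
  refine ⟨AddMonoidHom.mk' (fun z => (((D : ℚ) * r z : ℚ) : ℂ)) fun a b => by
      rw [map_add, mul_add]; push_cast; rfl,
    AddMonoidHom.mk' f fun a b => ?_, fun b => ?_, ?_⟩
  · have h : ((f (a + b) : ℤ) : ℚ) = ((f a + f b : ℤ) : ℚ) := by
      push_cast
      rw [← hf, ← hf, ← hf, map_add, map_add, mul_add]
    exact_mod_cast h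
  · change (((D : ℚ) * r (w b) : ℚ) : ℂ) = ((f b : ℤ) : ℂ)
    rw [hf]
    push_cast
    rfl
  · intro h
    have h1 := hf s
    change f s = 0 at h
    rw [h, Int.cast_zero] at h1
    exact (mul_ne_zero hD hr) h1

theorem map_neg_one_pow_mul (ρ : ℂ →+ ℂ) (i : ℕ) (a : ℂ) :
    ρ ((-1 : ℂ) ^ i * a) = (-1 : ℂ) ^ i * ρ a := by
  rcases neg_one_pow_eq_or ℂ i with h | h <;> simp [h]

/-- Composition with an additive map `ℂ → ℂ` that has integral values on the generators, and a nonzero one at `s`, makes a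
cocycle integral without destroying its symmetries. -/
theorem exists_integral_cocycle_of_finite {X : Set (Γ _⦋N⦌)} (hX : X.Finite)
    (hX2 : Function.Bijective (FreeGroup.lift (Subtype.val : X → Γ _⦋N⦌)))
    (hu : u ∈ conjCochains (Γ _⦋N⦌) 1) (hd : homogDiff (Γ _⦋N⦌) 1 u = 0)
    (hs : simpDiff Γ 1 N u = 0) (s : Γ _⦋N⦌) (hus : u 1 ![1, s] ≠ 0) :
    ∃ u' f, IsHomogeneousCocycle (Γ := Γ) (N := N) u' f ∧ f (abOf Γ s) ≠ 0 := by
  obtain ⟨ρ, f, hf, hfs⟩ := exists_integral_multiple (hX.image (abOf Γ))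
    (closure_abOf_eq_top hX2 _ fun y hy => ⟨y, hy, rfl⟩) (cocycleAbHom hu hd) (abOf Γ s)
    (by rwa [cocycleAbHom_abOf])
  refine ⟨fun m x => ρ (u m x), f, ⟨⟨fun y m x => congrArg ρ (hu.1 y m x),
    fun m x i => congrArg ρ (hu.2 m x i)⟩, ?_, ?_, fun g => ?_⟩, hfs⟩
  · funext m x
    rw [homogDiff_apply]
    simp only [← map_neg_one_pow_mul]
    rw [← map_sum, ← homogDiff_apply, hd]
    exact map_zero ρ
  · funext m x
    rw [simpDiff_apply]
    simp only [← map_neg_one_pow_mul]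
    rw [← map_sum, ← simpDiff_apply, hs]
    exact map_zero ρ
  · rw [← hf, cocycleAbHom_abOf]

open Classical in
/-- The homogeneous cocycle, concentrated at `m = 1`, of a homomorphism from the abelianization. -/
def unitCocycle (ψ : (simplicialAb Γ) _⦋N⦌ →+ ℂ) : Γ _⦋N⦌ → (Fin 2 → Γ _⦋N⦌) → ℂ :=
  fun m x => if m = 1 then ψ (abOf Γ ((x 0)⁻¹ * x 1)) else 0

theorem unitCocycle_mem (ψ : (simplicialAb Γ) _⦋N⦌ →+ ℂ) :
    unitCocycle ψ ∈ conjCochains (Γ _⦋N⦌) 1 := by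
  refine ⟨fun y m x => ?_, fun m x i => ?_⟩
  · have h : (y * x 0)⁻¹ * (y * x 1) = (x 0)⁻¹ * x 1 := by group
    have h2 : y * m * y⁻¹ = 1 ↔ m = 1 := conj_eq_one_iff
    by_cases hm : m = 1
    · exact (if_pos (h2.2 hm)).trans ((congrArg (fun g => ψ (abOf Γ g)) h).trans (if_pos hm).symm)
    · exact (if_neg (mt h2.1 hm)).trans (if_neg hm).symm
  · by_cases h : m = 1
    · subst h
      simp
    · simp only [unitCocycle, if_neg h]

theorem homogDiff_unitCocycle (ψ : (simplicialAb Γ) _⦋N⦌ →+ ℂ) :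
    homogDiff (Γ _⦋N⦌) 1 (unitCocycle ψ) = 0 := by
  funext m x
  obtain ⟨a, b, c, rfl⟩ : ∃ a b c, x = ![a, b, c] :=
    ⟨x 0, x 1, x 2, by funext i; fin_cases i <;> rfl⟩
  rw [homogDiff_one_apply]
  by_cases h : m = 1
  · have h1 : ψ (abOf Γ (a⁻¹ * c)) = ψ (abOf Γ (a⁻¹ * b)) + ψ (abOf Γ (b⁻¹ * c)) := by
      rw [← map_add, ← abOf_mul]
      congr 2
      group
    simp [unitCocycle, h, h1]
  · simp [unitCocycle, if_neg h]

/-- If `H_1(BΓ_{M+1}; ℤ)` is spanned by degenerate classes and the class of `s`, then a multiple of `u` and `f` differ on it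
by a coboundary, so that `u` can be changed by a `unitCocycle` to have restriction `f`. -/
theorem exists_integral_cocycle_of_generates {M : ℕ} {u : Γ _⦋M + 1⦌ → (Fin 2 → Γ _⦋M + 1⦌) → ℂ}
    (hu : u ∈ conjCochains (Γ _⦋M + 1⦌) 1) (hd : homogDiff (Γ _⦋M + 1⦌) 1 u = 0)
    (hs : simpDiff Γ 1 (M + 1) u = 0) (s : Γ _⦋M + 1⦌) (hus : u 1 ![1, s] ≠ 0)
    (hs0 : altFace (simplicialAb Γ) M (abOf Γ s) = 0)
    (htop : AddSubgroup.closure ({y | ∃ (i : Fin (M + 1)) (z : (simplicialAb Γ) _⦋M⦌),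
      (simplicialAb Γ).σ i z = y} ∪ {abOf Γ s}) = ⊤)
    (f : (simplicialAb Γ) _⦋M + 1⦌ →+ ℤ) (hf : ∀ x, f (altFace (simplicialAb Γ) (M + 1) x) = 0)
    (hfs : f (abOf Γ s) = 1) :
    ∃ u', IsHomogeneousCocycle u' f := by
  let a : ℂ := (u 1 ![1, s])⁻¹
  let fC : (simplicialAb Γ) _⦋M + 1⦌ →+ ℂ := (Int.castAddHom ℂ).comp f
  let w := cocycleAbHom hu hd
  obtain ⟨ψ, hψ⟩ := exists_comp_altFace_eq (simplicialAb Γ) M (abOf Γ s) hs0 htop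
    ((AddMonoidHom.mulLeft a).comp w - fC)
    (fun x => by
      change a * w (altFace _ (M + 1) x) - ((f (altFace _ (M + 1) x) : ℤ) : ℂ) = 0
      rw [cocycleAbHom_altFace hu hd hs, hf]
      simp)
    (by
      change a * w (abOf Γ s) - ((f (abOf Γ s) : ℤ) : ℂ) = 0
      rw [cocycleAbHom_abOf, hfs, inv_mul_cancel₀ hus]
      simp)
  refine ⟨a • u - simpDiff Γ 1 M (unitCocycle ψ), Submodule.sub_mem _ (Submodule.smul_mem _ _ hu)
    (simpDiff_mem (unitCocycle_mem ψ)), ?_, ?_, fun g => ?_⟩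
  · rw [map_sub, map_smul, hd, homogDiff_simpDiff, homogDiff_unitCocycle, map_zero, smul_zero,
      sub_zero]
  · rw [map_sub, map_smul, hs, simpDiff_simpDiff, smul_zero, sub_zero]
  · have h1 : a * u 1 ![1, g] - ((f (abOf Γ g) : ℤ) : ℂ) =
        ψ (altFace (simplicialAb Γ) M (abOf Γ g)) := by
      rw [← hψ, ← cocycleAbHom_abOf hu hd]
      rfl
    have h2 : simpDiff Γ 1 M (unitCocycle ψ) 1 ![1, g] =
        ψ (altFace (simplicialAb Γ) M (abOf Γ g)) := by
      rw [simpDiff_apply_one, altFace_apply, map_sum]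
      refine Finset.sum_congr rfl fun i _ => ?_
      rw [map_zsmul, zsmul_eq_mul]
      push_cast
      refine congrArg _ ((if_pos rfl).trans ?_)
      have h3 : (![1, Γ.δ i g] 0)⁻¹ * ![1, Γ.δ i g] 1 = Γ.δ i g := by simp
      rw [h3]
      rfl
    change a * u 1 ![1, g] - simpDiff Γ 1 M (unitCocycle ψ) 1 ![1, g] = _
    rw [h2, ← h1]
    ring

end Simplicial

/-! ### The dual class of the local group -/

theorem complexify_barSymbol (Γ : SimplicialObject GrpCat.{0}) {q : ℕ} (g : Γ _⦋q⦌) :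
    (complexify Γ).toFun 1 q (barSymbol ℤ Γ g) = barSymbol ℂ Γ g := by
  refine (complexifyHom_single _ _ _).trans ?_
  rw [Int.cast_one]
  rfl

namespace FreeResolution
variable {A : SimplicialObject.Augmented GrpCat.{0}} (R : FreeResolution A) {N : ℕ}
  {x : groupHomology (Rep.trivial ℂ A.right ℂ) (N + 1)} {xt : A.left _⦋N⦌}

/-- A nonzero class `x` yields a homogeneous cocycle on the local group which does not vanish at the symbol `s`. -/
theorem exists_homogeneous_cocycle_fund (hx0 : x ≠ 0) (hx : IsLift A x xt)
    {W : Set (A.left _⦋N - 1⦌)} (hW : 2 ≤ N → R.IsCommutatorSupport xt W) :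
    ∃ u ∈ conjCochains ((R.localGroup xt W) _⦋N⦌) 1, homogDiff _ 1 u = 0 ∧
      simpDiff (R.localGroup xt W) 1 N u = 0 ∧ u 1 ![1, R.fund xt W] ≠ 0 := by
  obtain ⟨z, hz, hzs⟩ := R.exists_cycle_fund hx hW
  let y := (complexify (R.localGroup xt W)).cyclesMap (N + 1) z
  let y' := (bicMap (Cyclic.bar ℂ) (R.incl xt W)).cyclesMap (N + 1) y
  have h1 : augH ℂ A N (Submodule.Quotient.mk y') = x := R.augH_of_cycle_fund hx W z hz hzs
  obtain ⟨c, hc, hcy⟩ := exists_functional_of_augH_ne_zero A y' (by rwa [h1])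
  have ha : A.left.δ 0 ≫ augmentation A = A.left.δ 1 ≫ augmentation A :=
    (A.hom.naturality (SimplexCategory.δ 0).op).trans
      (A.hom.naturality (SimplexCategory.δ 1).op).symm
  have hi : ∀ i : Fin 2, (R.localGroup xt W).δ i ≫ (R.incl xt W).app (op ⦋0⦌) =
      (R.incl xt W).app (op ⦋1⦌) ≫ A.left.δ i := fun i =>
    (R.incl xt W).naturality (SimplexCategory.δ i).op
  refine exists_homogeneous_cocycle (R.isFreeGroup_localGroup xt hW)
    ((R.incl xt W).app (op ⦋0⦌) ≫ augmentation A) ?_ hc y (R.fund xt W) ?_ ?_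
  · rw [← Category.assoc, ← Category.assoc, hi, hi, Category.assoc, Category.assoc, ha]
  · exact (congrArg ((complexify (R.localGroup xt W)).toFun 1 N) hzs).trans
      (complexify_barSymbol _ _)
  · rw [Functor.map_comp]
    exact hcy

/-- A nonzero class `x` yields an integral homomorphism on the abelianization of the local group in degree `N` which
extends to a homogeneous cocycle and does not vanish at the symbol `s`. -/
theorem exists_integral_cocycle_fund (hx0 : x ≠ 0) (hx : IsLift A x xt)
    {W : Set (A.left _⦋N - 1⦌)} (hW : 2 ≤ N → R.IsCommutatorSupport xt W) :
    ∃ u f, IsHomogeneousCocycle (Γ := R.localGroup xt W) (N := N) u f ∧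
      f (abOf _ (R.fund xt W)) ≠ 0 ∧ (2 ≤ N → f (abOf _ (R.fund xt W)) = 1) := by
  obtain ⟨u, hu, hd, hs, hus⟩ := R.exists_homogeneous_cocycle_fund hx0 hx hW
  by_cases hN : 2 ≤ N
  · obtain ⟨M, rfl⟩ : ∃ M, N = M + 1 := ⟨N - 1, by omega⟩
    have hM : 1 ≤ M := by omega
    obtain ⟨u', hu'⟩ := exists_integral_cocycle_of_generates hu hd hs (R.fund xt W) hus
      (R.altFace_fund hx hW) (R.closure_degenerate_fund hW hM) (R.symbolExp hW hM)
      (R.symbolExp_altFace hW hM) (R.symbolExp_fund hW hM)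
    exact ⟨u', _, hu', by rw [R.symbolExp_fund]; exact one_ne_zero, fun _ => R.symbolExp_fund hW hM⟩
  · obtain ⟨u', f, hu', hf⟩ := exists_integral_cocycle_of_finite (R.finite_localGens xt hW (op ⦋N⦌))
      (R.localGens_bijective xt hW (op ⦋N⦌)) hu hd hs (R.fund xt W) hus
    exact ⟨u', f, hu', hf, fun h => absurd h hN⟩

/-- If `2 ≤ N`, a class led by the symbol `s` generates the homology in degree `N + 1`. -/
theorem bijective_zsmul_fund (hx : IsLift A x xt)
    {W : Set (A.left _⦋N - 1⦌)} (hW : 2 ≤ N → R.IsCommutatorSupport xt W) (hN : 2 ≤ N)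
    (z : (bic (Cyclic.bar ℤ) (R.localGroup xt W)).cycles (N + 1))
    (hz : z.1 ∈ (bic (Cyclic.bar ℤ) (R.localGroup xt W)).filtLT (N + 1))
    (hzs : z.1 1 N = barSymbol ℤ (R.localGroup xt W) (R.fund xt W)) :
    Function.Bijective fun k : ℤ =>
      k • (Submodule.Quotient.mk z : barHomology ℤ (R.localGroup xt W) (N + 1)) := by
  obtain ⟨M, rfl⟩ : ∃ M, N = M + 1 := ⟨N - 1, by omega⟩
  have hM : 1 ≤ M := by omega
  exact bijective_zsmul_of_generates (R.isFreeGroup_localGroup xt hW) (R.fund xt W)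
    (R.closure_degenerate_fund hW hM) (R.symbolExp hW hM) (R.symbolExp_fund hW hM)
    (R.symbolExp_altFace hW hM) z hz hzs

/-- If `2 ≤ N`, a cocycle with value `1` at the symbol `s` generates the cohomology in degree `N + 1`. -/
theorem bijective_zsmul_dualClass_fund (hx : IsLift A x xt)
    {W : Set (A.left _⦋N - 1⦌)} (hW : 2 ≤ N → R.IsCommutatorSupport xt W) (hN : 2 ≤ N)
    (f : (simplicialAb (R.localGroup xt W)) _⦋N⦌ →+ ℤ)
    (hf : ∀ x, f (altFace (simplicialAb (R.localGroup xt W)) N x) = 0)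
    (hf1 : f (abOf _ (R.fund xt W)) = 1)
    (z : (bic (Cyclic.bar ℤ) (R.localGroup xt W)).cycles (N + 1))
    (hzs : z.1 1 N = barSymbol ℤ (R.localGroup xt W) (R.fund xt W)) :
    Function.Bijective fun k : ℤ => k • dualClass f hf := by
  obtain ⟨M, rfl⟩ : ∃ M, N = M + 1 := ⟨N - 1, by omega⟩
  exact bijective_zsmul_dualClass (R.isFreeGroup_localGroup xt hW) (R.fund xt W)
    (R.closure_degenerate_fund hW (by omega)) f hf1 hf (R.altFace_fund hx hW) z hzs

end FreeResolution

end
end LocalClass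

theorem mainTheorem6 {A : SimplicialObject.Augmented GrpCat.{0}} (R : FreeResolution A) (N : ℕ)
    (x : groupHomology (Rep.trivial ℂ A.right ℂ) (N + 1)) (xt : A.left _⦋N⦌)
    (hx : IsLift A x xt) (W : Set (A.left _⦋N - 1⦌))
    (hW : 2 ≤ N → R.IsCommutatorSupport xt W) :
    -- the canonical map
    ((R.incl xt W).app (op ⦋N⦌) (R.fund xt W) = xt ∧
      (x ≠ 0 → ∀ m, Function.Injective ((R.incl xt W).app m))) ∧
    -- agreement in degrees -1, 0, 1
    (Function.Bijective (R.inclAug xt W).right ∧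
      Function.Bijective ((R.inclAug xt W).left.app (op ⦋0⦌)) ∧
      Function.Bijective ((R.inclAug xt W).left.app (op ⦋1⦌))) ∧
    -- free and finitely generated in each degree
    (IsFreeSimplicialBasis (R.localGroup xt W) (R.localGens xt W) ∧
      ∀ m, (R.localGens xt W m).Finite) ∧
    -- the fundamental class
    ∃ μ : barHomology ℤ (R.localGroup xt W) (N + 1),
      (bic (Cyclic.bar ℤ) (R.localGroup xt W)).Detects (N + 1)
        (barSymbol ℤ (R.localGroup xt W) (R.fund xt W)) μ ∧
      augH ℂ A N (barHomologyMap ℂ (R.incl xt W) (N + 1)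
        (complexifyH (R.localGroup xt W) (N + 1) μ)) = x ∧
      (2 ≤ N → Function.Bijective fun k : ℤ => k • μ) ∧
      -- the cyclic homology spectral sequence
      (cyclicBicomplex (R.localGroup xt W)).Detects (N + 1)
        (cyclicSymbol (R.localGroup xt W) (R.fund xt W))
        (barToCyclicH (R.localGroup xt W) (N + 1) (complexifyH (R.localGroup xt W) (N + 1) μ)) ∧
      (∃ h : cyclicSymbol (R.localGroup xt W) (R.fund xt W) ∈
          (cyclicBicomplex (R.localGroup xt W)).ZInf 1 N,
        x ≠ 0 → (Submodule.Quotient.mk ⟨_, h⟩ :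
          (cyclicBicomplex (R.localGroup xt W)).EInf 1 N) ≠ 0) ∧
      -- the dual class and the cyclic cohomology spectral sequence
      (x ≠ 0 → ∃ μd : barCohomology ℤ (R.localGroup xt W) (N + 1),
        (bic (Cyclic.bar ℤ) (R.localGroup xt W)).pairing (N + 1) μd μ ≠ 0 ∧
        (2 ≤ N → (bic (Cyclic.bar ℤ) (R.localGroup xt W)).pairing (N + 1) μd μ = 1 ∧
          Function.Bijective fun k : ℤ => k • μd) ∧
        ∃ (f : ((bic (Cyclic.bar ℤ) (R.localGroup xt W)).X N).X 1 →ₗ[ℤ] ℤ)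
          (φ : ((cyclicBicomplex (R.localGroup xt W)).X N).X 1 →ₗ[ℂ] ℂ)
          (η : (cyclicBicomplex (R.localGroup xt W)).CoH (N + 1)),
          (bic (Cyclic.bar ℤ) (R.localGroup xt W)).CoDetects (N + 1) f μd ∧
          (∀ g : (R.localGroup xt W) _⦋N⦌, φ (cyclicSymbol (R.localGroup xt W) g) =
            (f (barSymbol ℤ (R.localGroup xt W) g) : ℂ)) ∧
          (cyclicBicomplex (R.localGroup xt W)).CoDetects (N + 1) φ η ∧
          (cyclicBicomplex (R.localGroup xt W)).pairing (N + 1) η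
            (barToCyclicH (R.localGroup xt W) (N + 1)
              (complexifyH (R.localGroup xt W) (N + 1) μ)) ≠ 0 ∧
          ∃ h : φ ∈ (cyclicBicomplex (R.localGroup xt W)).coZInf 1 N,
            (Submodule.Quotient.mk ⟨φ, h⟩ :
              (cyclicBicomplex (R.localGroup xt W)).coEInf 1 N) ≠ 0) := by
  obtain ⟨z, hz, hzs⟩ := R.exists_cycle_fund hx hW
  let Λ := R.localGroup xt W
  -- the image of the fundamental cycle in the cyclic bicomplex
  let y := (bicNat Cyclic.barToCyclic Λ).cyclesMap (N + 1) ((complexify Λ).cyclesMap (N + 1) z)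
  have hy : y.1 ∈ (cyclicBicomplex Λ).filtLT (N + 1) := fun p q h => by
    have h1 : z.1 p q = 0 := hz p q h
    change (bicNat Cyclic.barToCyclic Λ).toFun p q ((complexify Λ).toFun p q (z.1 p q)) = 0
    rw [h1, map_zero, map_zero]
  have hys : y.1 1 N = cyclicSymbol Λ (R.fund xt W) :=
    congrArg ((bicNat Cyclic.barToCyclic Λ).toFun 1 N)
      ((congrArg ((complexify Λ).toFun 1 N) hzs).trans (complexify_barSymbol Λ _))
  have hmem : cyclicSymbol Λ (R.fund xt W) ∈ (cyclicBicomplex Λ).ZInf 1 N := by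
    rw [← hys]
    exact (cyclicBicomplex Λ).mem_ZInf_of_cycle (Nat.add_comm 1 N) y hy
  refine ⟨⟨R.incl_fund xt W, fun hx0 m => R.incl_injective_of_ne_zero hx0 hx hW m⟩,
    ⟨Function.bijective_id, R.incl_bijective_zero xt W, R.incl_bijective_one xt W⟩,
    ⟨R.isFreeSimplicialBasis_localGens xt hW, R.finite_localGens xt hW⟩,
    Submodule.Quotient.mk z, ⟨z, hz, hzs, rfl⟩, R.augH_of_cycle_fund hx W z hz hzs,
    fun hN => R.bijective_zsmul_fund hx hW hN z hz hzs, ⟨y, hy, hys, rfl⟩,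
    ⟨hmem, fun hx0 => ?_⟩, fun hx0 => ?_⟩
  · obtain ⟨u, f, hu, hf, -⟩ := R.exists_integral_cocycle_fund hx0 hx hW
    refine (cyclicBicomplex Λ).eInf_mk_ne_zero (bicCyclicCochain hu.mem hu.homogDiff_eq)
      (bicCyclicCochain_dv _ _) (bicCyclicCochain_dh _ _ hu.simpDiff_eq) _ hmem ?_
    rw [bicCyclicCochain_symbol, hu.apply_one]
    exact_mod_cast hf
  · obtain ⟨u, f, hu, hf, hf1⟩ := R.exists_integral_cocycle_fund hx0 hx hW
    let φ := bicCyclicCochain hu.mem hu.homogDiff_eq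
    have hv : φ ∘ₗ (cyclicBicomplex Λ).dv 1 N = 0 := bicCyclicCochain_dv _ _
    have hh : φ ∘ₗ (cyclicBicomplex Λ).dh 1 N = 0 := bicCyclicCochain_dh _ _ hu.simpDiff_eq
    have hφ : ∀ g : Λ _⦋N⦌, φ (cyclicSymbol Λ g) = (f (abOf Λ g) : ℂ) := fun g => by
      rw [← hu.apply_one]
      exact bicCyclicCochain_symbol _ _ g
    have hφ0 : φ (y.1 1 N) ≠ 0 := by
      rw [hys, hφ]
      exact_mod_cast hf
    have hpair := pairing_dualClass f hu.altFace_eq_zero (R.fund xt W) z hzs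
    let F : (cyclicBicomplex Λ).cocycles (N + 1) := ⟨(cyclicBicomplex Λ).cosingle 1 N φ,
      (cyclicBicomplex Λ).cosingle_mem_cocycles (Nat.add_comm 1 N) φ hv hh⟩
    refine ⟨dualClass f hu.altFace_eq_zero, ?_, fun hN => ⟨?_, ?_⟩, cochainOf f, φ,
      Submodule.Quotient.mk F, coDetects_dualClass f _, fun g => ?_,
      ⟨F, (cyclicBicomplex Λ).cosingle_mem_filtGE 1 N φ, (cyclicBicomplex Λ).cosingle_same 1 N φ,
        rfl⟩, ?_, (cyclicBicomplex Λ).mem_coZInf φ hv hh,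
      (cyclicBicomplex Λ).coEInf_mk_ne_zero (Nat.add_comm 1 N) φ _ y hy hφ0⟩
    · rw [hpair]
      exact hf
    · rw [hpair, hf1 hN]
    · exact R.bijective_zsmul_dualClass_fund hx hW hN f hu.altFace_eq_zero (hf1 hN) z hzs
    · rw [cochainOf_barSymbol]
      exact hφ g
    · have h1 : (cyclicBicomplex Λ).pairing (N + 1) (Submodule.Quotient.mk F)
          (Submodule.Quotient.mk y) = φ (y.1 1 N) :=
        (cyclicBicomplex Λ).pairTot_cosingle (Nat.add_comm 1 N) φ y.1
      exact fun h => hφ0 (h1.symm.trans h)
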